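/- Let $K$ be an algebraically closed field of characteristic $p>0$, let $n>m>0$ be relatively prime integers, and let $X=X_{n,m}\subset\mathbb{P}^2_K$ be the plane curve $x^n=y^mz^{n-m}$. Let $\pi_X\colon\{(P,\ell)\in X\times(\mathbb{P}^2)^*: P\in\ell\}\to(\mathbb{P}^2)^*$ be its sectional covering (finite of degree $n$). Let $\delta$ be a geometric point of $(\mathbb{P}^2)^*$, with values in an algebraically closed extension of $K$, above which $\pi_X$ is étale; equivalently, the line $\delta$ meets $X$ in $n$ distinct points. Let $\Omega$ be the fiber of $\pi_X$ above $\delta$, and let $G\subset\mathrm{Sym}(\Omega)$ be the sectional monodromy group of $X$ acting on $\Omega$: the Galois group $\mathrm{Gal}(\overline{L}/L)$ of $L=K(t_1,t_2)$ permutes the $\overline{L}$-points of the intersection of $X$ with the generic line $x+t_1y+t_2z=0$, and $G$ is the image of this action, transported to $\Omega$ by specialization (this is the image of the étale fundamental group, based at $\delta$, of the étale locus of $\pi_X$). For a power $q$ of $p$, $\operatorname{AGL}_1(q)$ is the group of maps $x\mapsto ax+b$, $a\neq 0$, of $\mathbb{F}_q$; saying that the image of a group in $\mathrm{Sym}(A)$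 equals (contains) $\operatorname{AGL}_1(q)$ means that it does so after identifying $A$ with $\mathbb{F}_q$ by some bijection. Then the following hold. 1. Assume $p\mid n$, and write $n=qd$ with $q$ a power of $p$ and $d$ prime to $p$. Then there exist a decomposition $\Omega=A_1\sqcup\dots\sqcup A_d$, a subgroup $H\subset G$, subgroups $H_1,\dots,H_d\subset G$, all preserving each $A_j$, and an element $h\in H$ such that, for every $i$: - $A_i$ has cardinality $q$; - the image of $H$ in $\mathrm{Sym}(A_i)$ equals $\operatorname{AGL}_1(q)$; - $h$ acts on $A_i$ with one fixed point and one orbit of size $q-1$ (for $q=2$ this means that $A_i$ consists of two orbits of size $1$, and likewise below); - $H_i$ acts on $A_i$ with one fixed point and one orbit of size $q-1$, and for every $j\neq i$ the image of $H_i$ in $\mathrm{Sym}(A_j)$ contains $\operatorname{AGL}_1(q)$. 2. Assume $p\mid n-m$, and write $n-m=qd$ with $q$ a power of $p$ and $d$ prime to $p$. Then there exist a decomposition $\Omega=A_1\sqcup\dots\sqcup A_d\sqcup B$ with $\#B=m$, a subgroup $H\subset G$ preserving $B$ and each $A_i$, subgroups $H_1,\dots,H_d\subset G$, and an element $h\in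 H$ such that, for every $i$: - $A_i$ has cardinality $q$; - the image of $H$ in $\mathrm{Sym}(A_i)$ equals $\operatorname{AGL}_1(q)$; - $h$ acts on $A_i$ with one fixed point and one orbit of size $q-1$; - the image of $H$ in $\mathrm{Sym}(B)$ is $\mathbb{Z}/m\mathbb{Z}$ acting on itself by translations (for some bijection of $B$ with $\mathbb{Z}/m\mathbb{Z}$), and $h$ maps to a generator of it; - $H_i$ fixes every point of $A_i\cup B$, and for every $j\neq i$ it stabilizes $A_j$ and acts transitively on it. -/

import Mathlib

open scoped LinearAlgebra.Projectivization

noncomputable section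

namespace SectionalMonodromy

/-! ### Points of the projective plane, plane curves and their line sections -/

section Sections

variable {K : Type*} [Field K]

/-- The set of `E`-points of the intersection of the plane curve `f = 0` (with `f` a homogeneous
form over `K`) with the line `l 0 * x + l 1 * y + l 2 * z = 0`, where `l` is an `E`-point of the
dual plane. In other words: the `E`-points of the fiber over `l` of the sectional covering
`π : {(P, l) | P ∈ X, P ∈ l} → (ℙ²)^*`. A point of the projective plane over `E` is a line in
`E³`, and `P.submodule` is the set of its homogeneous coordinate vectors. -/
def fiber (f : MvPolynomial (Fin 3) K) {E : Type*} [Field E] [Algebra K E]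
    (l : ℙ E (Fin 3 → E)) : Set (ℙ E (Fin 3 → E)) :=
  {P | (∀ v ∈ P.submodule, MvPolynomial.aeval v f = 0) ∧
    ∀ c ∈ l.submodule, ∀ v ∈ P.submodule, ∑ i, c i * v i = 0}

/-- The sectional covering of the plane curve `f = 0` is étale over the geometric point `l` of the
dual plane. The covering is finite flat of degree `deg f`, so this says that the geometric fiber
consists of `deg f` distinct points. -/
def IsEtaleOver (f : MvPolynomial (Fin 3) K) {E : Type*} [Field E] [Algebra K E]
    (l : ℙ E (Fin 3 → E)) : Prop :=
  (fiber f l).ncard = f.totalDegree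

end Sections

/-! ### The geometric generic line and the Galois action on its intersection with the curve -/

section Generic

universe u

variable (K : Type u) [Field K]

/-- The field `K(t₁, t₂)`, the function field of the dual plane. -/
abbrev FunField : Type u := FractionRing (MvPolynomial (Fin 2) K)

/-- An algebraic closure of `K(t₁, t₂)`. -/
abbrev GeomField : Type u := AlgebraicClosure (FunField K)

/-- The absolute Galois group of `K(t₁, t₂)`. -/
abbrev Gal : Type u := GeomField K ≃ₐ[FunField K] GeomField K

variable {K}

/-- The coordinate `t₁` or `t₂` as an element of `K(t₁, t₂)`. -/
def coord (j : Fin 2) : FunField K :=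
  algebraMap (MvPolynomial (Fin 2) K) (FunField K) (MvPolynomial.X j)

/-- The coefficients `(1, t₁, t₂)` of the generic line. -/
def genericVec : Fin 3 → FunField K := ![1, coord 0, coord 1]

/-- The coefficients of the generic line, in the algebraic closure of `K(t₁, t₂)`. -/
def genericGeomVec (K : Type u) [Field K] : Fin 3 → GeomField K :=
  fun i => algebraMap (FunField K) (GeomField K) (genericVec i)

theorem genericGeomVec_ne_zero : genericGeomVec K ≠ 0 := by
  intro h
  have h0 := congrFun h 0
  simp [genericGeomVec, genericVec] at h0

/-- The generic line `x + t₁ y + t₂ z = 0`, as a geometric generic point of the dual plane. -/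
def genericLine (K : Type u) [Field K] : ℙ (GeomField K) (Fin 3 → GeomField K) :=
  Projectivization.mk (GeomField K) (genericGeomVec K) genericGeomVec_ne_zero

/-- The coordinatewise action of a Galois element on vectors, as a semilinear map. -/
def conjVec (σ : Gal K) :
    (Fin 3 → GeomField K) →ₛₗ[(σ : GeomField K →+* GeomField K)] (Fin 3 → GeomField K) where
  toFun v := fun i => σ (v i)
  map_add' v w := by ext i; simp
  map_smul' c v := by ext i; simp

theorem conjVec_injective (σ : Gal K) : Function.Injective (conjVec σ) := by
  intro v w h
  ext i
  exact σ.injective (congrFun h i)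

/-- The action of a Galois element on the points of the projective plane. -/
def conj (σ : Gal K) :
    ℙ (GeomField K) (Fin 3 → GeomField K) → ℙ (GeomField K) (Fin 3 → GeomField K) :=
  Projectivization.map (conjVec σ) (conjVec_injective σ)

theorem conj_one (P : ℙ (GeomField K) (Fin 3 → GeomField K)) : conj 1 P = P := by
  induction P with | h v hv => rfl

theorem conj_mul (σ τ : Gal K) (P : ℙ (GeomField K) (Fin 3 → GeomField K)) :
    conj (σ * τ) P = conj σ (conj τ P) := by
  induction P with | h v hv => rfl

theorem exists_of_mem_conj {σ : Gal K} {P : ℙ (GeomField K) (Fin 3 → GeomField K)}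
    {w : Fin 3 → GeomField K} (hw : w ∈ (conj σ P).submodule) :
    ∃ v ∈ P.submodule, conjVec σ v = w := by
  induction P with
  | h v hv =>
    rw [conj, Projectivization.map_mk, Projectivization.submodule_mk,
      Submodule.mem_span_singleton] at hw
    obtain ⟨a, rfl⟩ := hw
    refine ⟨σ.symm a • v, ?_, ?_⟩
    · rw [Projectivization.submodule_mk]
      exact Submodule.smul_mem _ _ (Submodule.mem_span_singleton_self v)
    · ext i
      simp [conjVec]

theorem conj_genericLine (σ : Gal K) : conj σ (genericLine K) = genericLine K := by
  have h : conjVec σ (genericGeomVec K) = genericGeomVec K := by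
    ext i
    exact σ.commutes _
  simp only [conj, genericLine, Projectivization.map_mk, h]

theorem aeval_conjVec (f : MvPolynomial (Fin 3) K) (σ : Gal K) (v : Fin 3 → GeomField K) :
    MvPolynomial.aeval (conjVec σ v) f = σ (MvPolynomial.aeval v f) :=
  (MvPolynomial.comp_aeval_apply (fun i => v i) ((σ : GeomField K →ₐ[FunField K]
    GeomField K).restrictScalars K) f).symm

theorem conj_mem_fiber (f : MvPolynomial (Fin 3) K) (σ : Gal K)
    {P : ℙ (GeomField K) (Fin 3 → GeomField K)} (hP : P ∈ fiber f (genericLine K)) :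
    conj σ P ∈ fiber f (genericLine K) := by
  refine ⟨fun w hw => ?_, fun c hc w hw => ?_⟩
  · obtain ⟨v, hv, rfl⟩ := exists_of_mem_conj hw
    rw [aeval_conjVec, hP.1 v hv, map_zero]
  · obtain ⟨v, hv, rfl⟩ := exists_of_mem_conj hw
    rw [← conj_genericLine σ] at hc
    obtain ⟨b, hb, rfl⟩ := exists_of_mem_conj hc
    have h := congrArg σ (hP.2 b hb v hv)
    simpa [conjVec] using h

/-- The permutation action of the absolute Galois group of `K(t₁, t₂)` on the geometric points of
the intersection of the curve `f = 0` with the generic line. Its image is the sectional monodromy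
group of the curve, as a group of permutations of the geometric generic fiber. -/
def galPerm (f : MvPolynomial (Fin 3) K) : Gal K →* Equiv.Perm (fiber f (genericLine K)) where
  toFun σ :=
    { toFun := fun P => ⟨conj σ P.1, conj_mem_fiber f σ P.2⟩
      invFun := fun P => ⟨conj σ⁻¹ P.1, conj_mem_fiber f σ⁻¹ P.2⟩
      left_inv := fun P => Subtype.ext (by
        change conj σ⁻¹ (conj σ P.1) = P.1
        rw [← conj_mul, inv_mul_cancel, conj_one])
      right_inv := fun P => Subtype.ext (by
        change conj σ (conj σ⁻¹ P.1) = P.1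
        rw [← conj_mul, mul_inv_cancel, conj_one]) }
  map_one' := Equiv.ext fun P => Subtype.ext (conj_one P.1)
  map_mul' σ τ := Equiv.ext fun P => Subtype.ext (conj_mul σ τ P.1)

end Generic

/-! ### The monodromy group at an arbitrary geometric point of the étale locus -/

section Monodromy

universe u v

variable (K : Type u) [Field K] (F : Type v) [Field F] [Algebra K F]

/-- A `K`-place of the algebraic closure of `K(t₁, t₂)` with values in `F`: a valuation ring `ring`
containing `K`, together with a homomorphism of `K`-algebras from `ring` to `F`. -/
structure Place where
  ring : Subalgebra K (GeomField K)
  mem_or_inv_mem : ∀ x : GeomField K, x ∈ ring ∨ x⁻¹ ∈ ring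
  hom : ring →ₐ[K] F

variable {K F}

/-- The point `P` of the projective plane (or of its dual) specializes to `Q` along the place `φ`:
`P` has homogeneous coordinates in the valuation ring of `φ` whose images under `φ` are homogeneous
coordinates of `Q`. -/
def Place.SpecializesTo (φ : Place K F) (P : ℙ (GeomField K) (Fin 3 → GeomField K))
    (Q : ℙ F (Fin 3 → F)) : Prop :=
  ∃ v : Fin 3 → φ.ring, (fun i => (v i : GeomField K)) ∈ P.submodule ∧
    (fun i => φ.hom (v i)) ∈ Q.submodule ∧ (fun i => φ.hom (v i)) ≠ 0

/-- A path for the sectional covering of the curve `f = 0` from the geometric generic point of the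
dual plane to the geometric point `δ`: a place of the algebraic closure of `K(t₁, t₂)` along which
the generic line specializes to `δ`, together with the resulting bijection of fibers.
Over the étale locus of the covering these are exactly the bijections of fibers induced by the
étale paths from the geometric generic point to `δ`. -/
structure Path (f : MvPolynomial (Fin 3) K) (δ : ℙ F (Fin 3 → F)) extends Place K F where
  specializes_line : toPlace.SpecializesTo (genericLine K) δ
  equiv : fiber f (genericLine K) ≃ fiber f δ
  specializes_point : ∀ P : fiber f (genericLine K), toPlace.SpecializesTo P (equiv P)

/-- The sectional monodromy group of the curve `f = 0`, as a group of permutations of the fiber of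
the sectional covering over the geometric point `δ`: the Galois action on the geometric generic
fiber, transported to the fiber over `δ` along paths from the geometric generic point to `δ`.
When the covering is étale over `δ`, each path gives the same group, the image of the étale
fundamental group based at `δ`. -/
def monodromyGroup (f : MvPolynomial (Fin 3) K) (δ : ℙ F (Fin 3 → F)) :
    Subgroup (Equiv.Perm (fiber f δ)) :=
  ⨆ γ : Path f δ, ((galPerm f).range.map γ.equiv.permCongrHom.toMonoidHom)

/-- The form `x ^ n - y ^ m * z ^ (n - m)`, with `x`, `y`, `z` the variables `0`, `1`, `2`. -/
def trinomialCurve (K : Type u) [Field K] (n m : ℕ) : MvPolynomial (Fin 3) K :=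
  MvPolynomial.X 0 ^ n - MvPolynomial.X 1 ^ m * MvPolynomial.X 2 ^ (n - m)

end Monodromy

/-! ### Permutation groups -/

section Permutations

variable {Ω : Type*}

/-- The subset `A` is stable under the group `H` of permutations. -/
def Preserves (H : Subgroup (Equiv.Perm Ω)) (A : Set Ω) : Prop :=
  ∀ g ∈ H, ∀ x ∈ A, g x ∈ A

/-- The image of `H` in the symmetric group of `A`: all permutations of `A` that are restrictions
of elements of `H`. -/
def imageInSym (H : Subgroup (Equiv.Perm Ω)) (A : Set Ω) : Subgroup (Equiv.Perm A) where
  carrier := {τ | ∃ g ∈ H, ∀ a : A, g a = τ a}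
  one_mem' := ⟨1, H.one_mem, fun _ => rfl⟩
  mul_mem' := by
    rintro σ τ ⟨g, hg, hgσ⟩ ⟨k, hk, hkτ⟩
    exact ⟨g * k, H.mul_mem hg hk, fun a => by
      rw [Equiv.Perm.mul_apply, hkτ, hgσ, Equiv.Perm.mul_apply]⟩
  inv_mem' := by
    rintro τ ⟨g, hg, hgτ⟩
    refine ⟨g⁻¹, H.inv_mem hg, fun a => ?_⟩
    rw [Equiv.Perm.inv_eq_iff_eq, hgτ]
    exact congrArg Subtype.val (τ.apply_symm_apply a).symm

/-- `AGL₁(𝔽)` as a group of permutations of the affine line: the maps `x ↦ a * x + b`, `a ≠ 0`. -/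
def AGL1 (𝔽 : Type*) [Field 𝔽] : Subgroup (Equiv.Perm 𝔽) where
  carrier := {τ | ∃ a b : 𝔽, a ≠ 0 ∧ ∀ x, τ x = a * x + b}
  one_mem' := ⟨1, 0, one_ne_zero, fun x => by simp⟩
  mul_mem' := by
    rintro σ τ ⟨a, b, ha, hσ⟩ ⟨c, d, hc, hτ⟩
    exact ⟨a * c, a * d + b, mul_ne_zero ha hc, fun x => by
      rw [Equiv.Perm.mul_apply, hτ, hσ]; ring⟩
  inv_mem' := by
    rintro τ ⟨a, b, ha, hτ⟩
    refine ⟨a⁻¹, -(a⁻¹ * b), inv_ne_zero ha, fun x => ?_⟩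
    rw [Equiv.Perm.inv_eq_iff_eq, hτ]
    field_simp
    ring

/-- `ℤ/m` as a group of permutations of itself: the translations `x ↦ x + c`. -/
def translations (m : ℕ) : Subgroup (Equiv.Perm (ZMod m)) where
  carrier := {τ | ∃ c : ZMod m, ∀ x, τ x = x + c}
  one_mem' := ⟨0, fun x => by simp⟩
  mul_mem' := by
    rintro σ τ ⟨a, hσ⟩ ⟨c, hτ⟩
    exact ⟨c + a, fun x => by rw [Equiv.Perm.mul_apply, hτ, hσ]; ring⟩
  inv_mem' := by
    rintro τ ⟨c, hτ⟩
    exact ⟨-c, fun x => by rw [Equiv.Perm.inv_eq_iff_eq, hτ]; ring⟩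

/-- The image of `H` in `Sym(A)` equals `AGL₁(q)`, `q = p ^ k`, embedded via its action on the
affine line over the field with `q` elements (for a suitable bijection from `A` to that line). -/
def ActsAsAGL1 (p k : ℕ) [Fact p.Prime] (H : Subgroup (Equiv.Perm Ω)) (A : Set Ω) : Prop :=
  ∃ e : A ≃ GaloisField p k,
    (imageInSym H A).map e.permCongrHom.toMonoidHom = AGL1 (GaloisField p k)

/-- The image of `H` in `Sym(A)` contains `AGL₁(q)`, `q = p ^ k`, embedded via its action on the
affine line over the field with `q` elements (for a suitable bijection from `A` to that line). -/
def ActsWithAGL1 (p k : ℕ) [Fact p.Prime] (H : Subgroup (Equiv.Perm Ω)) (A : Set Ω) : Prop :=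
  ∃ e : A ≃ GaloisField p k,
    AGL1 (GaloisField p k) ≤ (imageInSym H A).map e.permCongrHom.toMonoidHom

/-- The image of `H` in `Sym(B)` is `ℤ/m` in its natural embedding (for a suitable bijection from
`B` to `ℤ/m`), and the element `h` maps to a generator of this image. -/
def ActsAsCyclic (m : ℕ) (H : Subgroup (Equiv.Perm Ω)) (h : Equiv.Perm Ω) (B : Set Ω) : Prop :=
  (∃ e : B ≃ ZMod m, (imageInSym H B).map e.permCongrHom.toMonoidHom = translations m) ∧
    ∃ τ : Equiv.Perm B, (∀ b : B, h b = τ b) ∧ Subgroup.zpowers τ = imageInSym H B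

/-- `H` acts on `A` with one fixed point and one orbit of size `r`. -/
def FixedPointAndOrbit (r : ℕ) (H : Subgroup (Equiv.Perm Ω)) (A : Set Ω) : Prop :=
  ∃ a b : Ω, MulAction.orbit H a = {a} ∧ (MulAction.orbit H b).ncard = r ∧
    a ∉ MulAction.orbit H b ∧ A = {a} ∪ MulAction.orbit H b

/-- `H` stabilizes `A` and acts transitively on it. -/
def ActsTransitively (H : Subgroup (Equiv.Perm Ω)) (A : Set Ω) : Prop :=
  ∀ x ∈ A, MulAction.orbit H x = A

end Permutations

end SectionalMonodromy

end

open SectionalMonodromy (fiber IsEtaleOver monodromyGroup trinomialCurve Preserves ActsAsAGL1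
  ActsWithAGL1 ActsAsCyclic FixedPointAndOrbit ActsTransitively)

/-! The curve is parametrized by `u ↦ (u ^ m : u ^ n : 1)`, so its section by the generic line is
the set of roots of the trinomial `u ^ n + a * u ^ m + b` with `a = 1 / t₁`, `b = t₂ / t₁`, and the
monodromy group is the Galois group of this trinomial over `K(a, b)`. The required subgroups are
local monodromy groups: let `a` and `b` run along an arc, that is, take values in `K((π))` close to
a point `(a₀, b₀)`, and let the Galois group of `K((π))` act on the roots.

Write `q` for the exact power of `p`. The degenerate members are `u ^ n - 1 = (u ^ d - 1) ^ q` if `p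
∣ n`, and `u ^ n - u ^ m = u ^ m * (u ^ d - 1) ^ q` if `p ∣ n - m`. On nearby arcs the roots form
clusters of `q` roots around each `d`-th root of unity `η`, which are the sets `A i`, and in the
second case a cluster `B` of `m` roots around `0`.

Subtracting two equations shows that a difference `y` of roots in a cluster satisfies `y ^ q * D = w
* y * D'`, where `D`, `D'` reduce to nonzero constants and `w` is `π` or `b`. If `w = π`, division
by a suitable `(q - 1)`-st root turns this into `t ^ q = t` in the residue field. So the cluster
acquires a coordinate in the field with `q` elements, on which Galois acts by affine maps
(`IsArc.actsAsAGL1_cluster`). The homotheties come from tame inertia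
(`IsValuedClosure.exists_gal_eq`). The translations come from transitivity: in general the roots lie
at distance `‖π‖ ^ (1 / q)` from `η`, so `q` divides the size of their orbits
(`IsValuedClosure.dvd_card`). Near `0` the equation is `u ^ m = b` to leading order, a Kummer
equation, whence the cyclic action on `B`.

A general arc gives `H`. For `H_i` the arc is bent so that `η_i` remains an exact root. If `p ∣ n`,
that root is fixed and the other `q - 1` roots of its cluster form one orbit. If `p ∣ n - m`, one
also takes `b = π ^ (m * (q - 1))`, which makes the ramification in `A_i` and `B` disappear, while
`q` remains prime to `m * (q - 1)`, so that the other clusters are still totally ramified. Since `d`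
and `m` are coprime, the values `η_j ^ m` are distinct, and bending for `η_i` does not affect the
other clusters.

Local Galois groups map to the global one by a conjugacy argument (`exists_algEquiv_of_agree`): two
specializations of the integral closure of the chart `K[a, b]` that agree on the chart differ, on
the roots, by an element of the Galois group. The same argument makes the labelling of the clusters
independent of the arc (`exists_arcs`), so that `H` and all `H_i` refer to the same sets. Finally,
Chevalley's theorem on extension of places provides a path from the generic point to `δ`
(`exists_path`). -/

namespace SectionalMonodromy

/-! ### The normed algebraic closure of a Laurent series field -/

/-- `F` is an algebraic closure of `E`, normed compatibly with a discrete valuation of `E` with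
uniformizer `π` and residue field `K`, where `K` is a field of constants; the norm is invariant
under the absolute Galois group. -/
structure IsValuedClosure (K : Type*) {E F : Type*} [Field K] [Field E] [NormedField F]
    [Algebra K F] [Algebra E F] (π : E) : Prop where
  isUltrametric : IsUltrametricDist F
  isAlgClosed : IsAlgClosed F
  isAlgebraic : Algebra.IsAlgebraic E F
  norm_const : ∀ c : K, c ≠ 0 → ‖algebraMap K F c‖ = 1
  exists_residue : ∀ x : F, ‖x‖ ≤ 1 → ∃ c : K, ‖x - algebraMap K F c‖ < 1
  norm_gal : ∀ (σ : F ≃ₐ[E] F) (x : F), ‖σ x‖ = ‖x‖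
  norm_uniformizer_pos : 0 < ‖algebraMap E F π‖
  norm_uniformizer_lt : ‖algebraMap E F π‖ < 1
  norm_base : ∀ e : E, e ≠ 0 → ∃ k : ℤ, ‖algebraMap E F e‖ = ‖algebraMap E F π‖ ^ k

theorem exists_norm_sum_lt_one {F : Type*} [NormedField F] [IsUltrametricDist F]
    {ι : Type*} {s : Finset ι} {f : ι → F} (h : ∀ i ∈ s, ‖f i‖ < 1) : ‖∑ i ∈ s, f i‖ < 1 := by
  rcases s.eq_empty_or_nonempty with rfl | hs
  · simp
  · obtain ⟨i, hi, h2⟩ := IsUltrametricDist.exists_norm_finsetSum_le_of_nonempty hs f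
    exact h2.trans_lt (h i hi)

open Polynomial in
/-- Over an algebraically closed field of constants, a root of a monic polynomial that reduces to
a polynomial with constant coefficients itself reduces to a constant. -/
theorem exists_norm_sub_lt_one {K F : Type*} [Field K] [IsAlgClosed K] [NormedField F]
    [IsUltrametricDist F] [Algebra K F] {N : ℕ} (c : ℕ → F)
    (κ : ℕ → K) (hc : ∀ i, ‖c i - algebraMap K F (κ i)‖ < 1) (x : F) (hx : ‖x‖ ≤ 1)
    (h : x ^ N + ∑ i ∈ Finset.range N, c i * x ^ i = 0) :
    ∃ k : K, ‖x - algebraMap K F k‖ < 1 := by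
  set Q : K[X] := X ^ N + ∑ i ∈ Finset.range N, C (κ i) * X ^ i with hQ
  have hQm : Q.Monic := by
    refine monic_X_pow_add ?_
    refine (degree_sum_le _ _).trans_lt ((Finset.sup_lt_iff (WithBot.bot_lt_coe N)).2 ?_)
    intro i hi
    exact (degree_C_mul_X_pow_le i _).trans_lt (Nat.cast_lt.2 (Finset.mem_range.1 hi))
  have hval : ‖aeval x Q‖ < 1 := by
    have : aeval x Q = ∑ i ∈ Finset.range N, (algebraMap K F (κ i) - c i) * x ^ i := by
      have h2 : aeval x Q = x ^ N + ∑ i ∈ Finset.range N, algebraMap K F (κ i) * x ^ i := by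
        simp [hQ]
      rw [h2, ← sub_zero (x ^ N + _), ← h, add_sub_add_left_eq_sub, ← Finset.sum_sub_distrib]
      simp [sub_mul]
    rw [this]
    refine exists_norm_sum_lt_one fun i _ => ?_
    rw [norm_mul, norm_pow, norm_sub_rev]
    exact mul_lt_one_of_nonneg_of_lt_one_left (norm_nonneg _) (hc i)
      (pow_le_one₀ (norm_nonneg _) hx)
  -- If `x` were close to no constant, every linear factor of `Q` would have norm at least `1` at
  -- `x`, against `‖Q(x)‖ < 1`.
  have hs := (IsAlgClosed.splits Q).eq_prod_roots_of_monic hQm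
  by_contra! hcon
  rw [hs, map_multiset_prod, Multiset.map_map] at hval
  refine absurd hval (not_lt.2 ?_)
  generalize Q.roots = m
  induction m using Multiset.induction_on with
  | empty => simp
  | cons a m ih =>
    rw [Multiset.map_cons, Multiset.prod_cons, norm_mul]
    refine one_le_mul_of_one_le_of_one_le ?_ ih
    simpa using hcon a

-- The model is `K((X))` with the spectral norm on its algebraic closure, which is Galois invariant
-- by construction. The residue field does not grow because `K` is algebraically closed.
universe u in
open scoped Valued in
theorem exists_isValuedClosure (K : Type u) [Field K] [IsAlgClosed K] :
    ∃ (E F : Type u) (_ : Field E) (_ : NormedField F) (_ : Algebra K E) (_ : Algebra K F)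
      (_ : Algebra E F) (_ : IsScalarTower K E F) (π : E), IsValuedClosure K (F := F) π := by
  let v : Valuation (LaurentSeries K) _ := Valued.v
  have hX0 : v ((PowerSeries.X : PowerSeries K) : LaurentSeries K) = WithZero.exp (-1) := by
    simpa using LaurentSeries.valuation_X_pow K 1
  -- The base `2` is an arbitrary choice of a number greater than `1`.
  let : (Valued.v : Valuation (LaurentSeries K) _).RankOne :=
    { hom' := (WithZeroMulInt.toNNReal (e := 2) (by norm_num)).comp
        (MonoidWithZeroHom.ValueGroup₀.embedding)
      strictMono' := (WithZeroMulInt.toNNReal_strictMono (by norm_num)).comp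
        (MonoidWithZeroHom.ValueGroup₀.embedding_strictMono)
      exists_val_nontrivial := ⟨((PowerSeries.X : PowerSeries K) : LaurentSeries K), by
        change v _ ≠ 0 ∧ v _ ≠ 1
        rw [hX0]
        exact ⟨WithZero.coe_ne_zero, by decide⟩⟩ }
  let nf := spectralNorm.normedField (LaurentSeries K) (AlgebraicClosure (LaurentSeries K))
  have hext : ∀ e : LaurentSeries K,
      ‖algebraMap (LaurentSeries K) (AlgebraicClosure (LaurentSeries K)) e‖ = ‖e‖ :=
    fun e => spectralNorm_extends e
  have hC : ∀ c : K, algebraMap K (AlgebraicClosure (LaurentSeries K)) c =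
      algebraMap (LaurentSeries K) _ (HahnSeries.C c) := fun c => by
    rw [IsScalarTower.algebraMap_apply K (LaurentSeries K), LaurentSeries.algebraMap_apply]
  have hnC : ∀ c : K, c ≠ 0 → ‖(HahnSeries.C c : LaurentSeries K)‖ = 1 := by
    have hle : ∀ c : K, ‖(HahnSeries.C c : LaurentSeries K)‖ ≤ 1 := fun c => by
      rw [Valued.toNormedField.norm_le_one_iff, LaurentSeries.val_le_one_iff_eq_coe]
      exact ⟨PowerSeries.C c, by simp⟩
    intro c hc
    refine le_antisymm (hle c) ?_
    have h1 := hle c⁻¹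
    rw [map_inv₀, norm_inv] at h1
    exact (inv_le_one₀ (norm_pos_iff.2 (by simpa using hc))).1 h1
  have hXlt : ‖((PowerSeries.X : PowerSeries K) : LaurentSeries K)‖ < 1 := by
    rw [Valued.toNormedField.norm_lt_one_iff]
    change v _ < 1
    rw [hX0]
    decide
  have hultra : IsUltrametricDist (AlgebraicClosure (LaurentSeries K)) :=
    IsUltrametricDist.isUltrametricDist_of_isNonarchimedean_norm isNonarchimedean_spectralNorm
  have hres : ∀ e : LaurentSeries K, ‖e‖ ≤ 1 →
      ∃ c : K, ‖e - HahnSeries.C c‖ < 1 := by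
    intro e he
    rw [Valued.toNormedField.norm_le_one_iff, LaurentSeries.val_le_one_iff_eq_coe] at he
    obtain ⟨f, rfl⟩ := he
    refine ⟨PowerSeries.constantCoeff f, ?_⟩
    obtain ⟨g, hg⟩ := PowerSeries.X_dvd_iff.2
      (show PowerSeries.constantCoeff (f - PowerSeries.C (PowerSeries.constantCoeff f)) = 0 by simp)
    have h2 : (f : LaurentSeries K) - HahnSeries.C (PowerSeries.constantCoeff f) =
        ((PowerSeries.X : PowerSeries K) : LaurentSeries K) * (g : LaurentSeries K) := by
      rw [← map_mul, ← hg, map_sub, PowerSeries.coe_C]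
    rw [h2, norm_mul]
    refine mul_lt_one_of_nonneg_of_lt_one_left (norm_nonneg _) hXlt ?_
    rw [Valued.toNormedField.norm_le_one_iff, LaurentSeries.val_le_one_iff_eq_coe]
    exact ⟨g, rfl⟩
  refine ⟨LaurentSeries K, AlgebraicClosure (LaurentSeries K), inferInstance, nf, inferInstance,
    inferInstance, inferInstance, inferInstance,
    ((PowerSeries.X : PowerSeries K) : LaurentSeries K), ?_⟩
  refine ⟨hultra, inferInstanceAs (IsAlgClosed (AlgebraicClosure _)), inferInstance,
    ?_, ?_, ?_, ?_, ?_, ?_⟩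
  · intro c hc
    rw [hC, hext]
    exact hnC c hc
  · intro x hx
    have hint := Algebra.IsIntegral.isIntegral (R := LaurentSeries K) x
    have hm := minpoly.monic hint
    -- The spectral norm is read off the coefficients of the minimal polynomial, so norm at most `1`
    -- makes all of them integral, and each reduces to a constant.
    have hco := (spectralValue_le_one_iff hm).1 hx
    choose κ hκ using fun i => hres _ (hco i)
    refine exists_norm_sub_lt_one (N := (minpoly (LaurentSeries K) x).natDegree)
      (fun i => algebraMap _ _ ((minpoly (LaurentSeries K) x).coeff i)) κ ?_ x hx ?_
    · intro i
      rw [hC, ← map_sub, hext]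
      exact hκ i
    · have := minpoly.aeval (LaurentSeries K) x
      rw [hm.as_sum] at this
      simpa using this
  · exact fun σ x => (spectralNorm_eq_of_equiv σ x).symm
  · rw [hext, norm_pos_iff]
    intro h
    rw [h, map_zero] at hX0
    exact WithZero.coe_ne_zero hX0.symm
  · rw [hext]
    exact hXlt
  · intro e he
    rw [hext, hext]
    refine ⟨-WithZero.log (v e), ?_⟩
    rw [← norm_zpow]
    have h2 : v e = v (((PowerSeries.X : PowerSeries K) : LaurentSeries K) ^
        (-WithZero.log (v e))) := by
      rw [map_zpow₀, hX0, ← WithZero.exp_zsmul, smul_eq_mul, mul_neg, mul_one, neg_neg,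
        WithZero.exp_log ((Valuation.ne_zero_iff _).2 he)]
    exact le_antisymm (Valued.toNormedField.norm_le_iff.2 h2.le)
      (Valued.toNormedField.norm_le_iff.2 h2.ge)

/-! ### Chevalley's extension theorem for places -/

section PlaceExtension

open Polynomial

variable {K M Ω : Type*} [Field K] [Field M] [Field Ω] [Algebra K M] [Algebra K Ω]

/-- A subalgebra of `M × Ω` is the graph of a partially defined homomorphism from `M` to `Ω`. -/
def IsPartialHom (Γ : Subalgebra K (M × Ω)) : Prop :=
  ∀ w ∈ Γ, w.1 = 0 → w.2 = 0

/-- A maximal partial homomorphism is defined at `z` as soon as it can be extended to `z`. -/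
theorem mem_of_maximal_isPartialHom {Γ : Subalgebra K (M × Ω)}
    (hΓ : Maximal (IsPartialHom (K := K) (M := M) (Ω := Ω)) Γ) (w : M × Ω)
    (hw : ∀ f : Γ[X], f.eval₂ ((RingHom.fst M Ω).comp Γ.subtype) w.1 = 0 →
      f.eval₂ ((RingHom.snd M Ω).comp Γ.subtype) w.2 = 0) : w ∈ Γ := by
  let T : Subalgebra K (M × Ω) :=
    (eval₂AlgHom Γ.val w (fun _ => Commute.all _ _)).range
  have hT1 : ∀ f : Γ[X], (eval₂AlgHom Γ.val w (fun _ => Commute.all _ _) f).1 =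
      f.eval₂ ((RingHom.fst M Ω).comp Γ.subtype) w.1 := fun f =>
    hom_eval₂ f Γ.subtype (RingHom.fst M Ω) w
  have hT2 : ∀ f : Γ[X], (eval₂AlgHom Γ.val w (fun _ => Commute.all _ _) f).2 =
      f.eval₂ ((RingHom.snd M Ω).comp Γ.subtype) w.2 := fun f =>
    hom_eval₂ f Γ.subtype (RingHom.snd M Ω) w
  have hT : IsPartialHom T := by
    rintro _ ⟨f, rfl⟩ h
    erw [hT1] at h
    erw [hT2]
    exact hw f h
  have hle : Γ ≤ T := fun x hx => ⟨C ⟨x, hx⟩, by simp⟩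
  exact hΓ.le_of_ge hT hle ⟨X, by simp⟩

/-- A relation for `w.1⁻¹` is, after reversing the polynomial, a relation for `w.1`. The reversed
polynomial evaluated at `w` is an element of `Γ`, so its second component vanishes along with the
first. -/
theorem inv_mem_of_maximal_isPartialHom {Γ : Subalgebra K (M × Ω)}
    (hΓ : Maximal (IsPartialHom (K := K) (M := M) (Ω := Ω)) Γ) (w : M × Ω) (hw : w ∈ Γ)
    (h2 : w.2 ≠ 0) : (w.1⁻¹, w.2⁻¹) ∈ Γ := by
  refine mem_of_maximal_isPartialHom hΓ _ fun f hf => ?_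
  have h1 : w.1 ≠ 0 := fun h => h2 (hΓ.prop w hw h)
  let := invertibleOfNonzero (inv_ne_zero h1)
  let := invertibleOfNonzero (inv_ne_zero h2)
  rw [← eval₂_reverse_eq_zero_iff] at hf ⊢
  simp only [invOf_eq_inv, inv_inv] at hf ⊢
  let g : Γ := eval ⟨w, hw⟩ (reverse f)
  have e1 : (g : M × Ω).1 = eval₂ ((RingHom.fst M Ω).comp Γ.subtype) w.1 f.reverse :=
    (eval₂_at_apply ((RingHom.fst M Ω).comp Γ.subtype) (⟨w, hw⟩ : Γ)).symm
  have e2 : (g : M × Ω).2 = eval₂ ((RingHom.snd M Ω).comp Γ.subtype) w.2 f.reverse :=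
    (eval₂_at_apply ((RingHom.snd M Ω).comp Γ.subtype) (⟨w, hw⟩ : Γ)).symm
  rw [← e2]
  exact hΓ.prop _ g.2 (e1.trans hf)

/-- The domain of a maximal partial homomorphism to an algebraically closed field is a valuation
ring. -/
theorem exists_mem_of_maximal_isPartialHom [IsAlgClosed Ω] {Γ : Subalgebra K (M × Ω)}
    (hΓ : Maximal (IsPartialHom (K := K) (M := M) (Ω := Ω)) Γ) (x : M) :
    (∃ y, (x, y) ∈ Γ) ∨ ∃ y, (x⁻¹, y) ∈ Γ := by
  let p : Γ →+* M := (RingHom.fst M Ω).comp Γ.subtype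
  let q : Γ →+* Ω := (RingHom.snd M Ω).comp Γ.subtype
  have hunit : ∀ s : Γ, IsUnit s ↔ q s ≠ 0 := by
    refine fun s => ⟨fun h => (h.map q).ne_zero, fun h => ?_⟩
    refine IsUnit.of_mul_eq_one ⟨_, inv_mem_of_maximal_isPartialHom hΓ s s.2 h⟩ ?_
    have h1 : (s : M × Ω).1 ≠ 0 := fun h1 => h (hΓ.prop s s.2 h1)
    exact Subtype.ext (Prod.ext (mul_inv_cancel₀ h1) (mul_inv_cancel₀ h))
  have : IsLocalRing Γ := IsLocalRing.of_nonunits_add fun a b ha hb => by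
    rw [mem_nonunits_iff, hunit, not_not] at *
    rw [map_add, ha, hb, add_zero]
  have : IsLocalHom q := ⟨fun s hs => (hunit s).2 hs.ne_zero⟩
  -- The domain is a local ring, hence dominated by a valuation ring `W`. By maximality it suffices
  -- to extend the homomorphism to one element of `W` at a time.
  obtain ⟨W, hWle, hW⟩ := (LocalSubring.range p).exists_le_valuationSubring
  have hmem : ∀ s, p s ∈ W := fun s => hWle ⟨s, rfl⟩
  let ι : Γ →+* W := p.codRestrict W.toSubring hmem
  have : IsLocalHom ι := ⟨fun s hs => by
    have h1 : IsUnit (⟨p s, ⟨s, rfl⟩⟩ : (LocalSubring.range p).toSubring) :=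
      hW.map_nonunit _ hs
    obtain ⟨⟨_, ⟨t, rfl⟩⟩, ht⟩ := h1.exists_right_inv
    have ht' : p s * p t = 1 := congrArg Subtype.val ht
    rw [← map_mul, ← map_one p, ← sub_eq_zero, ← map_sub] at ht'
    have h2 := hΓ.prop _ (s * t - 1 : Γ).2 ht'
    refine (hunit s).2 fun h0 => ?_
    change q (s * t - 1) = 0 at h2
    rw [map_sub, map_mul, h0] at h2
    simp at h2⟩
  have key : ∀ z ∈ W, ∃ y, (z, y) ∈ Γ := by
    intro z hz
    let k := IsLocalRing.ResidueField Γ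
    let _ : Algebra k (IsLocalRing.ResidueField W) := (IsLocalRing.ResidueField.map ι).toAlgebra
    let _ : Algebra k Ω := (IsLocalRing.ResidueField.lift q).toAlgebra
    let ζ : IsLocalRing.ResidueField W := IsLocalRing.residue W ⟨z, hz⟩
    -- The value at `z` must be a root of the minimal polynomial of the residue of `z`. If that
    -- residue is transcendental there is no constraint, and `0` is as good as any value.
    obtain ⟨η, hη⟩ : ∃ η : Ω, aeval η (minpoly k ζ) = 0 := by
      by_cases hi : IsIntegral k ζ
      · exact IsAlgClosed.exists_aeval_eq_zero _ _ (minpoly.degree_pos hi).ne'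
      · exact ⟨0, by rw [minpoly.eq_zero hi, map_zero]⟩
    refine ⟨η, mem_of_maximal_isPartialHom hΓ _ fun f hf => ?_⟩
    have h1 : eval₂ ι ⟨z, hz⟩ f = 0 := by
      apply Subtype.val_injective
      have := hom_eval₂ f ι W.subtype ⟨z, hz⟩
      exact this.trans hf
    have h2 : aeval ζ (f.map (IsLocalRing.residue Γ)) = 0 := by
      have := hom_eval₂ f ι (IsLocalRing.residue W) ⟨z, hz⟩
      rw [h1, map_zero] at this
      rw [aeval_def, eval₂_map]
      exact this.symm
    obtain ⟨g, hg⟩ := minpoly.dvd k ζ h2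
    have h3 : aeval η (f.map (IsLocalRing.residue Γ)) = 0 := by
      rw [hg, map_mul, hη, zero_mul]
    rw [aeval_def, eval₂_map] at h3
    exact h3
  rcases W.mem_or_inv_mem x with h | h
  · exact Or.inl (key _ h)
  · exact Or.inr (key _ h)

/-- Chevalley's extension theorem: a homomorphism from a subalgebra of a field to an algebraically
closed field extends to a valuation ring. -/
theorem exists_valuationRing_extension [IsAlgClosed Ω] (A : Subalgebra K M) (φ : A →ₐ[K] Ω) :
    ∃ (V : Subalgebra K M) (ψ : V →ₐ[K] Ω), (∀ x : M, x ∈ V ∨ x⁻¹ ∈ V) ∧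
      (∀ x : V, ψ x ≠ 0 → (x : M)⁻¹ ∈ V) ∧ ∃ h : A ≤ V, ∀ a : A, ψ ⟨a, h a.2⟩ = φ a := by
  let Γ₀ : Subalgebra K (M × Ω) := (A.val.prod φ).range
  have hΓ₀ : IsPartialHom Γ₀ := by
    rintro _ ⟨a, rfl⟩ h
    have : a = 0 := Subtype.ext h
    simp [this]
  obtain ⟨Γ, hle, hΓ⟩ := zorn_le_nonempty₀ {Γ : Subalgebra K (M × Ω) | IsPartialHom Γ}
    (fun c hc hchain y hy => by
      refine ⟨sSup c, ?_, fun z hz => le_sSup hz⟩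
      intro w hw
      have : Nonempty c := ⟨⟨y, hy⟩⟩
      rw [sSup_eq_iSup', ← SetLike.mem_coe,
        Subalgebra.coe_iSup_of_directed hchain.directed] at hw
      obtain ⟨Γ, hwΓ⟩ := Set.mem_iUnion.1 hw
      exact hc Γ.2 w hwΓ) Γ₀ hΓ₀
  have hmax : Maximal (IsPartialHom (K := K) (M := M) (Ω := Ω)) Γ := hΓ
  let V : Subalgebra K M := Γ.map (AlgHom.fst K M Ω)
  have hV : ∀ x : V, ∃ y, ((x : M), y) ∈ Γ := by
    rintro ⟨_, ⟨w, hw, rfl⟩⟩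
    exact ⟨w.2, hw⟩
  choose ψ hψ using hV
  have huniq : ∀ x y z, (x, y) ∈ Γ → (x, z) ∈ Γ → y = z := fun x y z h1 h2 =>
    sub_eq_zero.1 (hmax.prop _ (Γ.sub_mem h1 h2) (sub_self x))
  have hA : A ≤ V := fun a ha => ⟨(a, φ ⟨a, ha⟩), hle ⟨⟨a, ha⟩, rfl⟩, rfl⟩
  refine ⟨V, ⟨⟨⟨⟨ψ, ?_⟩, ?_⟩, ?_, ?_⟩, ?_⟩, ?_, ?_, hA, ?_⟩
  · exact huniq _ _ _ (hψ 1) Γ.one_mem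
  · exact fun x y => huniq _ _ _ (hψ _) (Γ.mul_mem (hψ x) (hψ y))
  · exact huniq _ _ _ (hψ 0) Γ.zero_mem
  · exact fun x y => huniq _ _ _ (hψ _) (Γ.add_mem (hψ x) (hψ y))
  · exact fun c => huniq _ _ _ (hψ _) (Γ.algebraMap_mem c)
  · intro x
    rcases exists_mem_of_maximal_isPartialHom hmax x with ⟨y, hy⟩ | ⟨y, hy⟩
    · exact Or.inl ⟨_, hy, rfl⟩
    · exact Or.inr ⟨_, hy, rfl⟩
  · intro x hx
    exact ⟨_, inv_mem_of_maximal_isPartialHom hmax _ (hψ x) hx, rfl⟩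
  · exact fun a => huniq _ _ _ (hψ _) (hle ⟨a, rfl⟩)

end PlaceExtension

/-! ### Descent of separable Galois-invariant elements -/

section GaloisDescent

variable {E F : Type*} [Field E] [Field F] [Algebra E F] [Normal E F]

theorem mem_range_of_forall_algEquiv_eq {x : F} (hs : IsSeparable E x)
    (hx : ∀ σ : F ≃ₐ[E] F, σ x = x) : x ∈ (algebraMap E F).range := by
  by_contra h
  obtain ⟨y, hne, hy⟩ := (notMem_iff_exists_ne_and_isConjRoot hs (Normal.splits' x)).1
    (fun h2 => h (Algebra.mem_bot.1 h2))
  obtain ⟨σ, hσ⟩ := (IsConjRoot.comm.1 hy).exists_algEquiv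
  exact hne ((hx σ).symm.trans hσ)

theorem finset_prod_mem_range {S : Finset F} (hS : ∀ σ : F ≃ₐ[E] F, ∀ x ∈ S, σ x ∈ S)
    (hs : ∀ x ∈ S, IsSeparable E x) : ∏ x ∈ S, x ∈ (algebraMap E F).range := by
  refine mem_range_of_forall_algEquiv_eq ?_ fun σ => ?_
  · exact (separableClosure E F).prod_mem hs
  · rw [map_prod]
    refine Finset.prod_bij (fun x _ => σ x) (fun x hx => hS σ x hx)
      (fun x _ y _ h => σ.injective h) (fun x hx => ⟨σ.symm x, hS σ.symm x hx, by simp⟩)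
      (fun _ _ => rfl)

end GaloisDescent

/-! ### Ramification bounds the size of orbits from below -/

section Orbits

variable {K E F : Type*} [Field K] [Field E] [NormedField F] [Algebra K F] [Algebra E F] {π : E}

/-- If the elements of a Galois-stable finite set have valuation `b / a` in lowest terms, then `a`
divides the cardinality of the set. -/
theorem IsValuedClosure.dvd_card (hF : IsValuedClosure K (F := F) π) {S : Finset F}
    (hS : ∀ σ : F ≃ₐ[E] F, ∀ x ∈ S, σ x ∈ S) (hs : ∀ x ∈ S, IsSeparable E x) {a b : ℕ}
    (ha : 0 < a) (hab : a.Coprime b) (hn : ∀ x ∈ S, ‖x‖ ^ a = ‖algebraMap E F π‖ ^ b) :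
    a ∣ S.card := by
  have := hF.isAlgClosed
  have := hF.isAlgebraic
  have hn0 : Normal E F := normal_iff.2 fun x =>
    ⟨Algebra.IsIntegral.isIntegral x, IsAlgClosed.splits _⟩
  have hπ := hF.norm_uniformizer_pos
  obtain ⟨e, he⟩ := finset_prod_mem_range hS hs
  have hpos : ∀ x ∈ S, 0 < ‖x‖ := fun x hx => by
    refine lt_of_le_of_ne (norm_nonneg x) fun h => ?_
    have := hn x hx
    rw [← h, zero_pow ha.ne'] at this
    exact (pow_pos hπ b).ne this
  have he0 : e ≠ 0 := by
    rintro rfl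
    rw [map_zero, eq_comm, Finset.prod_eq_zero_iff] at he
    obtain ⟨x, hx, rfl⟩ := he
    simpa using hpos _ hx
  obtain ⟨k, hk⟩ := hF.norm_base e he0
  -- The product over `S` lies in `E`, so its norm is an integral power of `‖π‖`; its `a`-th power
  -- is computed from the norms of the factors.
  have h1 : ‖algebraMap E F π‖ ^ ((b * S.card : ℕ) : ℤ) = ‖algebraMap E F π‖ ^ (k * a) := by
    rw [zpow_mul, ← hk, he, norm_prod, zpow_natCast, zpow_natCast, ← Finset.prod_pow,
      Finset.prod_congr rfl hn, Finset.prod_const, pow_mul]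
  have h2 := (zpow_right_injective₀ hπ hF.norm_uniformizer_lt.ne) h1
  have h3 : (a : ℤ) ∣ ((b * S.card : ℕ) : ℤ) := ⟨k, by rw [h2, mul_comm]⟩
  exact hab.dvd_of_dvd_mul_left (Int.natCast_dvd_natCast.1 h3)

end Orbits

/-! ### Conjugacy of specializations with the same restriction to the base -/

section Conjugacy

open Polynomial

variable {K L M Ω : Type*} [Field K] [Infinite K] [Field L] [Field M] [Field Ω] [Algebra K L]
  [Algebra K M] [Algebra L M] [IsScalarTower K L M] [Algebra K Ω] [Normal L M]

theorem isIntegral_algEquiv {K L M : Type*} [Field K] [Field L] [Field M] [Algebra K L]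
    [Algebra L M] (A : Subalgebra K L) (σ : M ≃ₐ[L] M) {x : M} (hx : IsIntegral A x) :
    IsIntegral A (σ x) :=
  hx.map (σ.toAlgHom.restrictScalars A)

/-- Two homomorphisms that agree on an integrally closed subalgebra of the base field are
conjugate under the Galois group, on any finite family of separable integral elements. -/
theorem exists_algEquiv_of_agree (A : Subalgebra K L)
    (hA : ∀ x : L, IsIntegral A x → x ∈ A) (B : Subalgebra K M)
    (hB : ∀ x : M, x ∈ B ↔ IsIntegral A x) {ι : Type*} [Fintype ι] (u : ι → B)
    (hs : ∀ i, IsSeparable L (u i : M)) (Φ Ψ : B →ₐ[K] Ω)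
    (hΦ : ∀ x : L, x ∈ A → ∀ h : algebraMap L M x ∈ B, Φ ⟨_, h⟩ = Ψ ⟨_, h⟩) :
    ∃ σ : M ≃ₐ[L] M, ∀ i, ∃ h : σ (u i) ∈ B, Ψ (u i) = Φ ⟨σ (u i), h⟩ := by
  classical
  have hσB : ∀ (σ : M ≃ₐ[L] M) (x : B), σ x ∈ B := fun σ x =>
    (hB _).2 (isIntegral_algEquiv A σ ((hB _).1 x.2))
  let S : Set (ι → B) := Set.range fun σ : M ≃ₐ[L] M => fun i => ⟨σ (u i), hσB σ (u i)⟩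
  have hSfin : S.Finite := by
    have : S ⊆ Set.pi Set.univ fun i => {y : B | (y : M) ∈ (minpoly L (u i : M)).rootSet M} := by
      rintro _ ⟨σ, rfl⟩ i -
      have hi : minpoly L (u i : M) ≠ 0 := minpoly.ne_zero (Normal.isIntegral inferInstance _)
      refine (mem_rootSet_of_ne hi).2 ?_
      have h1 := minpoly.aeval L (σ (u i))
      rwa [minpoly.algEquiv_eq] at h1
    refine (Set.Finite.pi' fun i => ?_).subset (fun w hw i => this hw i trivial)
    exact ((rootSet_finite _ M).preimage Subtype.val_injective.injOn)
  by_contra! hcon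
  -- a linear combination separating the values
  have hprop : ∀ w ∈ S, ∃ i, Ψ (u i) ≠ Φ (w i) := by
    rintro _ ⟨σ, rfl⟩
    obtain ⟨i, hi⟩ := hcon σ
    exact ⟨i, hi (hσB σ (u i))⟩
  let lin : (ι → B) → (ι → K) →ₗ[K] Ω := fun w =>
    ∑ i, (LinearMap.toSpanSingleton K Ω (Ψ (u i) - Φ (w i))).comp (LinearMap.proj i)
  have hlin : ∀ w c, lin w c = ∑ i, c i • (Ψ (u i) - Φ (w i)) := fun w c => by simp [lin]
  obtain ⟨c, hc⟩ : ∃ c : ι → K, ∀ w ∈ S, lin w c ≠ 0 := by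
    -- Each `w` excludes a proper subspace of coefficient vectors, and over an infinite field
    -- finitely many of these do not fill the whole space.
    have hne := Subspace.biUnion_ne_univ_of_top_notMem
      (s := hSfin.toFinset.image fun w => LinearMap.ker (lin w)) (by
        intro h
        obtain ⟨w, hw, hk⟩ := Finset.mem_image.1 h
        obtain ⟨i, hi⟩ := hprop w (hSfin.mem_toFinset.1 hw)
        have h0 : lin w (Pi.single i 1) = 0 := by
          rw [← LinearMap.mem_ker, hk]
          trivial
        rw [hlin, Finset.sum_eq_single i (fun j _ hj => by simp [hj]) (by simp)] at h0
        simp only [Pi.single_eq_same, one_smul] at h0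
        exact hi (sub_eq_zero.1 h0))
    obtain ⟨c, hc⟩ := (Set.ne_univ_iff_exists_notMem _).1 hne
    refine ⟨c, fun w hw h0 => hc ?_⟩
    refine Set.mem_biUnion (Finset.mem_image_of_mem _ (hSfin.mem_toFinset.2 hw)) ?_
    exact h0
  let comb : (ι → B) → B := fun w => ∑ i, c i • w i
  -- The roots of `P` are the images of `comb u` under Galois. Its coefficients are invariant,
  -- separable and integral, so they come from `A`, where `Φ` and `Ψ` agree.
  let P : B[X] := ∏ w ∈ hSfin.toFinset, (X - C (comb w))
  have hPM : P.map (B.val : B →+* M) = ∏ w ∈ hSfin.toFinset, (X - C (comb w : M)) := by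
    simp [P, Polynomial.map_prod]
  have hsep : ∀ j, IsSeparable L (P.coeff j : M) := by
    intro j
    have h1 : P.map (B.val : B →+* M) ∈ lifts (algebraMap (separableClosure L M) M) := by
      rw [hPM]
      refine Subsemiring.prod_mem _ fun w hw => ?_
      obtain ⟨σ, rfl⟩ := hSfin.mem_toFinset.1 hw
      have h2 : (comb fun i => ⟨σ (u i), hσB σ (u i)⟩ : M) ∈ separableClosure L M := by
        have h3 : (comb fun i => ⟨σ (u i), hσB σ (u i)⟩ : M) =
            ∑ i, algebraMap L M (algebraMap K L (c i)) * σ (u i) := by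
          simp [comb, Algebra.smul_def, ← IsScalarTower.algebraMap_apply]
        rw [h3]
        refine sum_mem fun i _ => mul_mem (algebraMap_mem _ _) ?_
        exact (map_mem_separableClosure_iff σ.toAlgHom).2 (hs i)
      exact ⟨X - C ⟨_, h2⟩, by simp⟩
    obtain ⟨y, hy⟩ := (lifts_iff_coeff_lifts _).1 h1 j
    rw [coeff_map] at hy
    have := y.2
    rw [show (y : M) = P.coeff j from hy] at this
    exact this
  have hfix : ∀ j (σ : M ≃ₐ[L] M), σ (P.coeff j : M) = P.coeff j := by
    intro j σ
    have h1 : (P.map (B.val : B →+* M)).map (σ : M →+* M) = P.map (B.val : B →+* M) := by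
      rw [hPM, Polynomial.map_prod]
      refine Finset.prod_bij (fun w _ => fun i => ⟨σ (w i), hσB σ (w i)⟩) ?_ ?_ ?_ ?_
      · intro w hw
        obtain ⟨τ, rfl⟩ := hSfin.mem_toFinset.1 hw
        exact hSfin.mem_toFinset.2 ⟨σ * τ, rfl⟩
      · intro w _ w' _ h
        funext i
        have := congrArg Subtype.val (congrFun h i)
        exact Subtype.ext (σ.injective this)
      · intro w hw
        obtain ⟨τ, rfl⟩ := hSfin.mem_toFinset.1 hw
        refine ⟨_, hSfin.mem_toFinset.2 ⟨σ⁻¹ * τ, rfl⟩, ?_⟩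
        funext i
        exact Subtype.ext (σ.apply_symm_apply _)
      · intro w _
        have h3 : σ (comb w : M) = comb fun i => ⟨σ (w i), hσB σ (w i)⟩ := by
          simp [comb, Algebra.smul_def, IsScalarTower.algebraMap_apply K L M]
        rw [← h3]
        simp
    have h2 := congrArg (fun p => coeff p j) h1
    simpa [coeff_map] using h2
  have hcoef : ∀ j, Φ (P.coeff j) = Ψ (P.coeff j) := by
    intro j
    obtain ⟨x, hx⟩ := mem_range_of_forall_algEquiv_eq (hsep j) (hfix j)
    have hxB : algebraMap L M x ∈ B := hx ▸ (P.coeff j).2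
    have hxA : x ∈ A := hA x <| by
      have := (hB _).1 hxB
      exact (isIntegral_algHom_iff ((Algebra.ofId L M).restrictScalars A)
        (algebraMap L M).injective).1 this
    have e : P.coeff j = ⟨_, hxB⟩ := Subtype.ext hx.symm
    rw [e]
    exact hΦ x hxA hxB
  have hPmap : P.map (Φ : B →+* Ω) = P.map (Ψ : B →+* Ω) := by
    ext j
    simpa [coeff_map] using hcoef j
  have hu : u ∈ S := ⟨1, rfl⟩
  -- Since `Φ` and `Ψ` have the same effect on `P`, the value `Ψ (comb u)` equals `Φ (comb w)` for
  -- some `w`, which the choice of `c` forbids.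
  have h1 : (P.map (Ψ : B →+* Ω)).eval (Ψ (comb u)) = 0 := by
    simp only [P, Polynomial.map_prod, eval_prod]
    exact Finset.prod_eq_zero (hSfin.mem_toFinset.2 hu) (by simp)
  rw [← hPmap] at h1
  simp only [P, Polynomial.map_prod, eval_prod] at h1
  obtain ⟨w, hw, h2⟩ := Finset.prod_eq_zero_iff.1 h1
  refine hc w (hSfin.mem_toFinset.1 hw) ?_
  rw [hlin]
  simp only [Polynomial.map_sub, map_X, map_C, eval_sub, eval_X, eval_C] at h2
  simpa [comb, smul_sub, Finset.sum_sub_distrib] using h2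

end Conjugacy

/-! ### Valuation rings are integrally closed -/

section IntegralValuation

open Polynomial

theorem mem_of_eval₂_eq_zero {K M A : Type*} [Field K] [Field M] [Algebra K M] [CommRing A]
    (V : Subalgebra K M) (hV : ∀ x : M, x ∈ V ∨ x⁻¹ ∈ V) (f : A →+* M) (hf : ∀ a, f a ∈ V)
    {p : A[X]} (hp : p.Monic) {x : M} (hx : p.eval₂ f x = 0) : x ∈ V := by
  let W : ValuationSubring M := { V.toSubring with mem_or_inv_mem' := hV }
  have hi : IsIntegral W x := by
    refine ⟨p.map (f.codRestrict W.toSubring hf), hp.map _, ?_⟩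
    rw [eval₂_map]
    exact hx
  obtain ⟨y, rfl⟩ := IsIntegrallyClosed.isIntegral_iff.1 hi
  exact y.2

end IntegralValuation

/-! ### The chart of the dual plane with coordinates `1 / t₁`, `t₂ / t₁` -/

section AffineChart

universe u
variable (K : Type u) [Field K]

/-- The functions `1 / t₁` and `t₂ / t₁` on the dual plane. -/
noncomputable def affineCoord : Fin 2 → FunField K := ![(coord 0)⁻¹, coord 1 * (coord 0)⁻¹]

theorem affineCoord_zero : affineCoord K 0 = (coord 0)⁻¹ := rfl

theorem affineCoord_one : affineCoord K 1 = coord 1 * (coord 0)⁻¹ := rfl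

theorem coord_ne_zero (j : Fin 2) : (coord j : FunField K) ≠ 0 := by
  rw [coord, Ne, FaithfulSMul.algebraMap_eq_zero_iff]
  exact MvPolynomial.X_ne_zero j

/-- Clearing denominators in a polynomial in `1 / t₁` and `t₂ / t₁`. -/
theorem exists_clear_denominators (P : MvPolynomial (Fin 2) K) :
    ∃ (N : ℕ) (Q : MvPolynomial (Fin 2) K),
      algebraMap _ (FunField K) Q = coord 0 ^ N * MvPolynomial.aeval (affineCoord K) P ∧
      ∀ a b : K, a ≠ 0 → a ^ N * MvPolynomial.eval ![a⁻¹, b * a⁻¹] Q =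
        MvPolynomial.eval ![a, b] P := by
  have h0 := coord_ne_zero K 0
  induction P using MvPolynomial.induction_on with
  | C c =>
    refine ⟨0, MvPolynomial.C c, ?_, by simp⟩
    rw [pow_zero, one_mul, MvPolynomial.algHom_C, ← MvPolynomial.algebraMap_eq,
      ← IsScalarTower.algebraMap_apply]
  | add P P' h h' =>
    obtain ⟨N, Q, hQ, hev⟩ := h
    obtain ⟨N', Q', hQ', hev'⟩ := h'
    refine ⟨N + N', MvPolynomial.X 0 ^ N' * Q + MvPolynomial.X 0 ^ N * Q', ?_, ?_⟩
    · rw [map_add, map_mul, map_mul, hQ, hQ', map_pow, map_pow, map_add]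
      simp only [← coord.eq_1]
      ring
    · intro a b ha
      rw [map_add (MvPolynomial.eval ![a, b]), ← hev a b ha, ← hev' a b ha]
      simp only [map_add, map_mul, map_pow, MvPolynomial.eval_X, Matrix.cons_val_zero]
      generalize MvPolynomial.eval _ Q = x
      generalize MvPolynomial.eval _ Q' = y
      have e : ∀ k : ℕ, a ^ k * a⁻¹ ^ k = 1 := fun k => by
        rw [← mul_pow, mul_inv_cancel₀ ha, one_pow]
      linear_combination a ^ N * x * e N' + a ^ N' * y * e N
  | mul_X P i h =>
    obtain ⟨N, Q, hQ, hev⟩ := h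
    obtain rfl | rfl : i = 0 ∨ i = 1 := by omega
    · refine ⟨N + 1, Q, ?_, ?_⟩
      · rw [hQ, map_mul, MvPolynomial.aeval_X, affineCoord_zero, pow_succ, mul_assoc,
          mul_comm (coord 0), mul_assoc, inv_mul_cancel₀ h0, mul_one]
      · intro a b ha
        rw [map_mul, ← hev a b ha]
        simp
        ring
    · refine ⟨N + 1, Q * MvPolynomial.X 1, ?_, ?_⟩
      · rw [map_mul, hQ, map_mul, MvPolynomial.aeval_X, affineCoord_one, ← coord.eq_1, pow_succ,
          mul_assoc, mul_assoc, mul_comm (coord 0), mul_assoc, mul_assoc, inv_mul_cancel₀ h0,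
          mul_one]
      · intro a b ha
        rw [map_mul (MvPolynomial.eval ![a, b]), ← hev a b ha]
        simp only [map_mul, MvPolynomial.eval_X, Matrix.cons_val_one, Matrix.cons_val_fin_one]
        generalize MvPolynomial.eval _ Q = x
        linear_combination a ^ N * x * b * mul_inv_cancel₀ ha

variable {K}

theorem aeval_affineCoord_injective [Infinite K] :
    Function.Injective (MvPolynomial.aeval (R := K) (affineCoord K)) := by
  rw [injective_iff_map_eq_zero]
  intro P hP
  obtain ⟨N, Q, hQ, hev⟩ := exists_clear_denominators K P
  rw [hP, mul_zero, FaithfulSMul.algebraMap_eq_zero_iff] at hQ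
  -- The comparison of values is available only where the first coordinate is nonzero; the factor `X
  -- 0` takes care of the remaining points.
  have h0 : MvPolynomial.X 0 * P = 0 := by
    refine MvPolynomial.funext fun x => ?_
    by_cases hx : x 0 = 0
    · simp [hx]
    · have := hev (x 0) (x 1) hx
      rw [hQ, map_zero, mul_zero] at this
      have e : x = ![x 0, x 1] := by ext i; fin_cases i <;> rfl
      rw [map_mul, map_zero, e, ← this, mul_zero]
  exact (mul_eq_zero.1 h0).resolve_left (MvPolynomial.X_ne_zero 0)

/-- The coordinate ring of the chart `t₁ ≠ ∞` of the dual plane. -/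
noncomputable def chart (K : Type u) [Field K] : Subalgebra K (FunField K) :=
  (MvPolynomial.aeval (R := K) (affineCoord K)).range

/-- The chart is an affine plane. -/
noncomputable def chartEquiv (K : Type u) [Field K] [Infinite K] : MvPolynomial (Fin 2) K ≃ₐ[K] chart K :=
  AlgEquiv.ofInjective _ aeval_affineCoord_injective

theorem mem_chart_of_isIntegral [Infinite K] {x : FunField K} (hx : IsIntegral (chart K) x) :
    x ∈ chart K := by
  let g : MvPolynomial (Fin 2) K →ₐ[K] FunField K := MvPolynomial.aeval (affineCoord K)
  -- The substitution `(t₁, t₂) ↦ (1 / t₁, t₂ / t₁)` is an involution of `K(t₁, t₂)`. It exchanges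
  -- the chart with the polynomial ring, which is integrally closed.
  let θ : FunField K →ₐ[K] FunField K :=
    IsFractionRing.liftAlgHom (g := g) aeval_affineCoord_injective
  have hθ : ∀ P, θ (algebraMap _ _ P) = g P := fun P => by simp [θ]
  have hθc : ∀ i, θ (coord i) = affineCoord K i := fun i => by
    rw [coord, hθ]
    simp [g]
  have hθθ : ∀ y, θ (θ y) = y := by
    have h1 : (θ.comp θ) = AlgHom.id K _ := by
      refine IsLocalization.algHom_ext (nonZeroDivisors (MvPolynomial (Fin 2) K)) ?_
      refine MvPolynomial.algHom_ext fun i => ?_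
      change θ (θ (coord i)) = coord i
      have h0 := coord_ne_zero K 0
      rw [hθc]
      obtain rfl | rfl : i = 0 ∨ i = 1 := by omega
      · rw [affineCoord_zero, map_inv₀, hθc, affineCoord_zero, inv_inv]
      · rw [affineCoord_one, map_mul, map_inv₀, hθc, hθc, affineCoord_zero, affineCoord_one,
          inv_inv, mul_assoc, inv_mul_cancel₀ h0, mul_one]
    exact fun y => DFunLike.congr_fun h1 y
  have h1 : IsIntegral (MvPolynomial (Fin 2) K) (θ x) := by
    refine hx.map_of_comp_eq ((chartEquiv K).symm : chart K →+* MvPolynomial (Fin 2) K)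
      (θ : FunField K →+* FunField K) ?_
    ext y
    obtain ⟨P, rfl⟩ := (chartEquiv K).surjective y
    change algebraMap _ _ ((chartEquiv K).symm (chartEquiv K P)) = θ (g P)
    rw [AlgEquiv.symm_apply_apply, ← hθ, hθθ]
  obtain ⟨Q, hQ⟩ := IsIntegrallyClosed.isIntegral_iff.1 h1
  refine ⟨Q, ?_⟩
  change g Q = x
  rw [← hθ, hQ, hθθ]

end AffineChart

/-! ### Specializations of the integral closure of the chart -/

section Specialization

universe u
variable (K : Type u) [Field K]

/-- The integral closure of the chart `t₁ ≠ ∞` in the algebraic closure of `K(t₁, t₂)`. -/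
noncomputable def chartClosure : Subalgebra K (GeomField K) :=
  (integralClosure (chart K) (GeomField K)).restrictScalars K

variable {K}

theorem mem_chartClosure {x : GeomField K} : x ∈ chartClosure K ↔ IsIntegral (chart K) x := Iff.rfl

theorem algebraMap_mem_chartClosure {x : FunField K} (hx : x ∈ chart K) :
    algebraMap (FunField K) (GeomField K) x ∈ chartClosure K :=
  (isIntegral_algebraMap (R := chart K) (x := ⟨x, hx⟩) :
    IsIntegral (chart K) (algebraMap (chart K) (GeomField K) ⟨x, hx⟩))

/-- The inclusion of the chart in its integral closure. -/
noncomputable def chartIncl (K : Type u) [Field K] : chart K →ₐ[K] chartClosure K where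
  toFun x := ⟨algebraMap (FunField K) (GeomField K) x, algebraMap_mem_chartClosure x.2⟩
  map_one' := Subtype.ext (map_one (algebraMap (FunField K) (GeomField K)))
  map_mul' x y := Subtype.ext (map_mul (algebraMap (FunField K) (GeomField K)) x.1 y.1)
  map_zero' := Subtype.ext (map_zero (algebraMap (FunField K) (GeomField K)))
  map_add' x y := Subtype.ext (map_add (algebraMap (FunField K) (GeomField K)) x.1 y.1)
  commutes' c := Subtype.ext
    (IsScalarTower.algebraMap_apply K (FunField K) (GeomField K) c).symm

/-- The functions `1 / t₁` and `t₂ / t₁` in the integral closure of the chart. -/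
noncomputable def closureCoord (j : Fin 2) : chartClosure K :=
  chartIncl K ⟨affineCoord K j, MvPolynomial.X j, by simp⟩

/-- Homomorphisms from the chart are determined by the values of the coordinates. -/
theorem comp_chartIncl_eq [Infinite K] {Ω : Type*} [Field Ω] [Algebra K Ω]
    {Φ Ψ : chartClosure K →ₐ[K] Ω}
    (h : ∀ j, Φ (closureCoord j) = Ψ (closureCoord j)) (x : chart K) :
    Φ (chartIncl K x) = Ψ (chartIncl K x) := by
  have h1 : ((Φ.comp (chartIncl K)).comp (chartEquiv K : MvPolynomial (Fin 2) K →ₐ[K] chart K)) =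
      ((Ψ.comp (chartIncl K)).comp (chartEquiv K : MvPolynomial (Fin 2) K →ₐ[K] chart K)) := by
    refine MvPolynomial.algHom_ext fun j => ?_
    have e : chartEquiv K (MvPolynomial.X j) = ⟨affineCoord K j, MvPolynomial.X j, by simp⟩ :=
      Subtype.ext (MvPolynomial.aeval_X (affineCoord K) j)
    change Φ (chartIncl K (chartEquiv K _)) = Ψ (chartIncl K (chartEquiv K _))
    rw [e]
    exact h j
  obtain ⟨P, rfl⟩ := (chartEquiv K).surjective x
  exact DFunLike.congr_fun h1 P

/-- A pair of algebraically independent functions specializes to any pair of values along some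
place. -/
theorem exists_place_of_injective {Ω : Type*} [Field Ω] [Algebra K Ω] [IsAlgClosed Ω]
    (i : MvPolynomial (Fin 2) K →ₐ[K] GeomField K) (hi : Function.Injective i) (a : Fin 2 → Ω) :
    ∃ φ : Place K Ω, (∀ x : φ.ring, φ.hom x ≠ 0 → (x : GeomField K)⁻¹ ∈ φ.ring) ∧
      ∀ P, ∃ h : i P ∈ φ.ring, φ.hom ⟨i P, h⟩ = MvPolynomial.aeval a P := by
  let ε := AlgEquiv.ofInjective i hi
  obtain ⟨V, ψ, hV, hinv, hle, hψ⟩ := exists_valuationRing_extension i.range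
    ((MvPolynomial.aeval a).comp (ε.symm : i.range →ₐ[K] MvPolynomial (Fin 2) K))
  refine ⟨⟨V, hV, ψ⟩, hinv, fun P => ⟨hle ⟨P, rfl⟩, ?_⟩⟩
  refine (hψ (ε P)).trans ?_
  change MvPolynomial.aeval a (ε.symm (ε P)) = _
  rw [AlgEquiv.symm_apply_apply]

theorem exists_place_chart [Infinite K] {Ω : Type*} [Field Ω] [Algebra K Ω] [IsAlgClosed Ω]
    (a : Fin 2 → Ω) :
    ∃ φ : Place K Ω, (∀ x : φ.ring, φ.hom x ≠ 0 → (x : GeomField K)⁻¹ ∈ φ.ring) ∧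
      (∀ x : chart K, algebraMap (FunField K) (GeomField K) x ∈ φ.ring) ∧
      ∀ j, ∃ h : algebraMap (FunField K) (GeomField K) (affineCoord K j) ∈ φ.ring,
        φ.hom ⟨_, h⟩ = a j := by
  have hinj := (algebraMap (FunField K) (GeomField K)).injective.comp
    (aeval_affineCoord_injective (K := K))
  obtain ⟨φ, hφ, h⟩ := exists_place_of_injective
    ((IsScalarTower.toAlgHom K (FunField K) (GeomField K)).comp
      (MvPolynomial.aeval (affineCoord K))) hinj a
  refine ⟨φ, hφ, ?_, fun j => ?_⟩
  · rintro ⟨_, P, rfl⟩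
    exact (h P).1
  · have e := MvPolynomial.aeval_X (R := K) (affineCoord K) j
    obtain ⟨h1, h2⟩ := h (MvPolynomial.X j)
    rw [MvPolynomial.aeval_X] at h2
    rw [← h2]
    refine ⟨e ▸ h1, congrArg φ.hom (Subtype.ext ?_)⟩
    exact congrArg (algebraMap (FunField K) (GeomField K)) e.symm

/-- Every point of the chart with values in an algebraically closed field lifts to the integral
closure. -/
theorem exists_closureHom [Infinite K] {Ω : Type*} [Field Ω] [Algebra K Ω] [IsAlgClosed Ω]
    (a : Fin 2 → Ω) : ∃ Φ : chartClosure K →ₐ[K] Ω, ∀ j, Φ (closureCoord j) = a j := by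
  obtain ⟨φ, -, hc, h⟩ := exists_place_chart (K := K) a
  have hB : chartClosure K ≤ φ.ring := by
    intro x hx
    obtain ⟨p, hp, hpx⟩ := mem_chartClosure.1 hx
    exact mem_of_eval₂_eq_zero φ.ring φ.mem_or_inv_mem _ hc hp hpx
  exact ⟨φ.hom.comp (Subalgebra.inclusion hB), fun j => (h j).2⟩

/-- Two specializations of the integral closure that agree on the chart are conjugate on finite
families of separable elements. -/
theorem exists_gal_of_agree [Infinite K] {Ω : Type*} [Field Ω] [Algebra K Ω]
    {ι : Type*} [Fintype ι] (u : ι → chartClosure K)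
    (hs : ∀ i, IsSeparable (FunField K) (u i : GeomField K)) (Φ Ψ : chartClosure K →ₐ[K] Ω)
    (h : ∀ j, Φ (closureCoord j) = Ψ (closureCoord j)) :
    ∃ σ : Gal K, ∀ i, ∃ h : σ (u i) ∈ chartClosure K, Ψ (u i) = Φ ⟨σ (u i), h⟩ := by
  refine exists_algEquiv_of_agree (chart K) (fun x => mem_chart_of_isIntegral) _
    (fun x => mem_chartClosure) u hs Φ Ψ fun x hx h' => ?_
  exact comp_chartIncl_eq h ⟨x, hx⟩

/-- The Galois action on the integral closure of the chart. -/
noncomputable def galClosure (σ : Gal K) : chartClosure K →ₐ[K] chartClosure K :=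
  ((σ.toAlgHom.restrictScalars K).comp (chartClosure K).val).codRestrict (chartClosure K)
    fun x => isIntegral_algEquiv (chart K) σ (mem_chartClosure.1 x.2)

theorem galClosure_coord (σ : Gal K) (j : Fin 2) :
    galClosure σ (closureCoord j) = closureCoord j :=
  Subtype.ext (σ.commutes _)

end Specialization

/-! ### Residue homomorphisms -/

section Residues

variable {K E F : Type*} [Field K] [Field E] [NormedField F] [Algebra K F] [Algebra E F] {π : E}

theorem norm_sub_le_max_of_ultrametric {F : Type*} [NormedField F] [IsUltrametricDist F]
    (x y : F) : ‖x - y‖ ≤ max ‖x‖ ‖y‖ := by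
  rw [sub_eq_add_neg, ← norm_neg y]
  exact IsUltrametricDist.norm_add_le_max _ _

theorem IsValuedClosure.norm_const_le (hF : IsValuedClosure K (F := F) π) (c : K) :
    ‖algebraMap K F c‖ ≤ 1 := by
  by_cases h : c = 0
  · simp [h]
  · exact (hF.norm_const c h).le

theorem IsValuedClosure.eq_of_norm_sub_lt (hF : IsValuedClosure K (F := F) π) {c c' : K}
    (h : ‖algebraMap K F c - algebraMap K F c'‖ < 1) : c = c' := by
  by_contra hne
  rw [← map_sub, hF.norm_const _ (sub_ne_zero.2 hne)] at h
  exact lt_irrefl _ h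

theorem IsValuedClosure.eq_of_norm_sub_lt' (hF : IsValuedClosure K (F := F) π) {x : F} {c c' : K}
    (h : ‖x - algebraMap K F c‖ < 1) (h' : ‖x - algebraMap K F c'‖ < 1) : c = c' := by
  have := hF.isUltrametric
  refine hF.eq_of_norm_sub_lt ?_
  rw [← sub_sub_sub_cancel_left _ _ x]
  exact (norm_sub_le_max_of_ultrametric _ _).trans_lt (max_lt h' h)

/-- The valuation ring of the normed field. -/
def unitBall (hF : IsValuedClosure K (F := F) π) : Subalgebra K F where
  carrier := {x | ‖x‖ ≤ 1}
  mul_mem' {x y} hx hy := by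
    simp only [Set.mem_ofPred_eq, norm_mul] at *
    exact mul_le_one₀ hx (norm_nonneg _) hy
  add_mem' {x y} hx hy := by
    have := hF.isUltrametric
    exact (IsUltrametricDist.norm_add_le_max x y).trans (max_le hx hy)
  algebraMap_mem' c := hF.norm_const_le c

/-- Reduction to the residue field. -/
theorem IsValuedClosure.exists_residueHom (hF : IsValuedClosure K (F := F) π) {B : Type*}
    [CommRing B] [Algebra K B] (Φ : B →ₐ[K] F) (h : ∀ b, ‖Φ b‖ ≤ 1) :
    ∃ Ψ : B →ₐ[K] K, ∀ b, ‖Φ b - algebraMap K F (Ψ b)‖ < 1 := by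
  have := hF.isUltrametric
  choose r hr using fun b => hF.exists_residue (Φ b) (h b)
  have hc : ∀ c, r (algebraMap K B c) = c := fun c =>
    hF.eq_of_norm_sub_lt' (hr _) (by simp)
  refine ⟨⟨⟨⟨⟨r, ?_⟩, ?_⟩, ?_, ?_⟩, ?_⟩, hr⟩
  · simpa using hc 1
  · intro x y
    refine hF.eq_of_norm_sub_lt' (hr _) ?_
    have e : Φ (x * y) - algebraMap K F (r x * r y) =
        (Φ x - algebraMap K F (r x)) * Φ y + algebraMap K F (r x) *
          (Φ y - algebraMap K F (r y)) := by
      rw [map_mul, map_mul]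
      ring
    rw [e]
    refine (IsUltrametricDist.norm_add_le_max _ _).trans_lt (max_lt ?_ ?_)
    · rw [norm_mul]
      exact mul_lt_one_of_nonneg_of_lt_one_left (norm_nonneg _) (hr x) (h y)
    · rw [norm_mul]
      exact mul_lt_one_of_nonneg_of_lt_one_right (hF.norm_const_le _) (norm_nonneg _) (hr y)
  · simpa using hc 0
  · intro x y
    refine hF.eq_of_norm_sub_lt' (hr _) ?_
    have e : Φ (x + y) - algebraMap K F (r x + r y) =
        (Φ x - algebraMap K F (r x)) + (Φ y - algebraMap K F (r y)) := by
      rw [map_add, map_add]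
      ring
    rw [e]
    exact (IsUltrametricDist.norm_add_le_max _ _).trans_lt (max_lt (hr x) (hr y))
  · exact hc

end Residues

/-! ### Separability and factorization of trinomials -/

section Trinomials

open Polynomial

/-- Coprimality makes `m` invertible in `k`. If `p ∣ n`, then `f' = m * a * X ^ (m - 1)`; if `p ∣ n
- m`, then `X * f' = m * (f - b)`. In both cases the ideal of `f` and `f'` contains the nonzero
constant `b`, with explicit Bézout coefficients. -/
theorem separable_trinomial {k : Type*} [Field k] (p : ℕ) [Fact p.Prime] [CharP k p] {n m : ℕ}
    (hm : 0 < m) (hmn : m < n) (hcop : n.Coprime m) (hp : p ∣ n ∨ p ∣ n - m) {a b : k}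
    (ha : a ≠ 0) (hb : b ≠ 0) : (X ^ n + C a * X ^ m + C b : k[X]).Separable := by
  have hp1 : p ≠ 1 := (Fact.out : p.Prime).one_lt.ne'
  have hmp : ¬ p ∣ m := by
    intro h
    have : p ∣ n := hp.elim id fun h' => by
      have := dvd_add h' h
      rwa [Nat.sub_add_cancel hmn.le] at this
    exact hp1 (Nat.dvd_one.1 (hcop ▸ Nat.dvd_gcd this h))
  have hm0 : (m : k) ≠ 0 := fun h => hmp ((CharP.cast_eq_zero_iff k p m).1 h)
  have hCb : (C b⁻¹ * C b : k[X]) = 1 := by rw [← C_mul, inv_mul_cancel₀ hb, C_1]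
  have hCm : (C (m : k)⁻¹ * C (m : k) : k[X]) = 1 := by rw [← C_mul, inv_mul_cancel₀ hm0, C_1]
  have hCa : (C a⁻¹ * C a : k[X]) = 1 := by rw [← C_mul, inv_mul_cancel₀ ha, C_1]
  obtain ⟨m, rfl⟩ : ∃ l, m = l + 1 := ⟨m - 1, by omega⟩
  obtain ⟨r, rfl⟩ : ∃ r, n = m + 1 + r := ⟨n - (m + 1), by omega⟩
  rw [separable_def]
  have hder : derivative (X ^ (m + 1 + r) + C a * X ^ (m + 1) + C b : k[X]) =
      C ((m + 1 + r : ℕ) : k) * X ^ (m + r) + C a * (C ((m + 1 : ℕ) : k) * X ^ m) := by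
    simp only [derivative_add, derivative_X_pow, derivative_C_mul, derivative_C, add_zero]
    congr 3
    omega
  rcases hp with hp | hp
  · have h0 : ((m + 1 + r : ℕ) : k) = 0 := (CharP.cast_eq_zero_iff k p _).2 hp
    refine ⟨C b⁻¹, -C b⁻¹ * (C a⁻¹ * C ((m + 1 : ℕ) : k)⁻¹) * (X ^ (r + 1) + C a * X), ?_⟩
    rw [hder, h0, C_0]
    linear_combination hCb - C b⁻¹ * (X ^ (m + 1 + r) + C a * X ^ (m + 1)) *
      (C a⁻¹ * C a) * hCm - C b⁻¹ * (X ^ (m + 1 + r) + C a * X ^ (m + 1)) * hCa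
  · have h0 : ((m + 1 + r : ℕ) : k) = ((m + 1 : ℕ) : k) := by
      have : ((m + 1 + r - (m + 1) : ℕ) : k) = 0 := (CharP.cast_eq_zero_iff k p _).2 hp
      rw [Nat.add_sub_cancel_left] at this
      rw [Nat.cast_add, this, add_zero]
    refine ⟨C b⁻¹, -C b⁻¹ * C ((m + 1 : ℕ) : k)⁻¹ * X, ?_⟩
    rw [hder, h0]
    linear_combination hCb - C b⁻¹ * (X ^ (m + 1 + r) + C a * X ^ (m + 1)) * hCm

theorem monic_trinomial {R : Type*} [CommRing R] {n m : ℕ} (hmn : m < n) (a b : R) :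
    (X ^ n + C a * X ^ m + C b : R[X]).Monic := by
  nontriviality R
  rw [add_assoc]
  refine monic_X_pow_add ((degree_add_le _ _).trans_lt (max_lt ?_ ?_))
  · exact (degree_C_mul_X_pow_le _ _).trans_lt (Nat.cast_lt.2 hmn)
  · exact degree_C_le.trans_lt (Nat.cast_lt.2 (by omega : 0 < n))

theorem natDegree_trinomial {R : Type*} [CommRing R] [Nontrivial R] {n m : ℕ} (hmn : m < n)
    (a b : R) : (X ^ n + C a * X ^ m + C b : R[X]).natDegree = n := by
  refine natDegree_eq_of_degree_eq_some ?_
  rw [add_assoc, degree_add_eq_left_of_degree_lt, degree_X_pow]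
  rw [degree_X_pow]
  refine (degree_add_le _ _).trans_lt (max_lt ?_ ?_)
  · exact (degree_C_mul_X_pow_le _ _).trans_lt (Nat.cast_lt.2 hmn)
  · exact degree_C_le.trans_lt (Nat.cast_lt.2 (by omega : 0 < n))

theorem prod_X_sub_C_eq_trinomial {k : Type*} [Field k] {n m : ℕ} (hmn : m < n) {a b : k}
    {ι : Type*} [Fintype ι] (hι : Fintype.card ι = n) {u : ι → k} (hu : Function.Injective u)
    (hr : ∀ i, u i ^ n + a * u i ^ m + b = 0) :
    ∏ i, (X - C (u i)) = (X ^ n + C a * X ^ m + C b : k[X]) := by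
  have hmon := monic_trinomial hmn a b
  have hroots : (Finset.univ.val.map u) = (X ^ n + C a * X ^ m + C b : k[X]).roots := by
    refine Multiset.eq_of_le_of_card_le ?_ ?_
    · rw [Multiset.le_iff_subset (Finset.univ.nodup.map hu)]
      intro x hx
      obtain ⟨i, -, rfl⟩ := Multiset.mem_map.1 hx
      rw [mem_roots hmon.ne_zero]
      simpa using hr i
    · refine (card_roots' _).trans ?_
      rw [natDegree_trinomial hmn, Multiset.card_map, Finset.card_val, Finset.card_univ, hι]
  rw [← prod_multiset_X_sub_C_of_monic_of_roots_card_eq hmon, ← hroots, Multiset.map_map]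
  · rfl
  · rw [← hroots, natDegree_trinomial hmn, Multiset.card_map, Finset.card_val, Finset.card_univ,
      hι]

end Trinomials

/-! ### Arcs in the dual plane and their local monodromy -/

section Arcs

open Polynomial

universe u

/-- An arc in the dual plane with equation `u ^ n + a * u ^ m + b = 0` for the points of the line
section, and the resulting labelling `e` of the roots by the fiber `ι` of the covering; the
labels specialize to `ρ`, and the Galois group of the arc acts through the group `G`. -/
structure IsArc {K E F : Type*} [Field K] [Field E] [NormedField F] [Algebra K F] [Algebra E F]
    {ι : Type*} (G : Subgroup (Equiv.Perm ι)) (ρ : ι → K) (n m : ℕ) (a b : E) (e : ι → F) :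
    Prop where
  injective : Function.Injective e
  root : ∀ i, e i ^ n + algebraMap E F a * e i ^ m + algebraMap E F b = 0
  surj : ∀ x : F, x ^ n + algebraMap E F a * x ^ m + algebraMap E F b = 0 → ∃ i, e i = x
  near : ∀ i, ‖e i - algebraMap K F (ρ i)‖ < 1
  separable : ∀ i, IsSeparable E (e i)
  gal : ∀ τ : F ≃ₐ[E] F, ∃ g ∈ G, ∀ i, e (g i) = τ (e i)

variable {K : Type u} [Field K] {E F : Type*} [Field E] [NormedField F] [Algebra K F]
  [Algebra E F] {π : E}

/-- The factorization already holds over the integral closure of the chart, so it survives every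
specialization, even where roots collide. Multiplicities of a degenerate trinomial therefore count
the labels in each cluster. -/
theorem prod_X_sub_C_specialize {n m : ℕ} (hmn : m < n) {ι : Type*}
    [Fintype ι] (hι : Fintype.card ι = n) {v : ι → chartClosure K} (hv : Function.Injective v)
    (hr : ∀ i, (v i : GeomField K) ^ n + (closureCoord 0 : chartClosure K) * (v i : GeomField K) ^ m +
      (closureCoord 1 : chartClosure K) = 0)
    {Ω : Type*} [Field Ω] [Algebra K Ω] (Φ : chartClosure K →ₐ[K] Ω) :
    ∏ i, (X - C (Φ (v i))) =
      (X ^ n + C (Φ (closureCoord 0)) * X ^ m + C (Φ (closureCoord 1)) : Polynomial Ω) := by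
  have hprodB : ∏ i, (X - C (v i)) =
      (X ^ n + C (closureCoord 0) * X ^ m + C (closureCoord 1) : Polynomial (chartClosure K)) := by
    refine Polynomial.map_injective ((chartClosure K).val : chartClosure K →+* GeomField K)
      Subtype.val_injective ?_
    have := prod_X_sub_C_eq_trinomial (a := ((closureCoord 0 : chartClosure K) : GeomField K))
      (b := ((closureCoord 1 : chartClosure K) : GeomField K)) hmn hι (Subtype.val_injective.comp hv)
      hr
    simpa [Polynomial.map_prod] using this
  have := congrArg (Polynomial.map (Φ : chartClosure K →+* Ω)) hprodB
  simpa [Polynomial.map_prod] using this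

/-- A specialization of the chart into the valuation ring is integral on the integral closure. -/
theorem IsValuedClosure.norm_closureHom_le [Infinite K] (hF : IsValuedClosure K (F := F) π)
    (Φ : chartClosure K →ₐ[K] F) (h : ∀ j, ‖Φ (closureCoord j)‖ ≤ 1) (b : chartClosure K) :
    ‖Φ b‖ ≤ 1 := by
  have hA : ∀ x : chart K, Φ (chartIncl K x) ∈ unitBall hF := by
    intro x
    obtain ⟨P, rfl⟩ := (chartEquiv K).surjective x
    induction P using MvPolynomial.induction_on with
    | C c =>
      have : chartEquiv K (MvPolynomial.C c) = algebraMap K _ c := (chartEquiv K).commutes c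
      rw [this, AlgHom.commutes, AlgHom.commutes]
      exact (unitBall hF).algebraMap_mem c
    | add P Q hP hQ =>
      rw [map_add, map_add, map_add]
      exact (unitBall hF).add_mem hP hQ
    | mul_X P j hP =>
      rw [map_mul, map_mul, map_mul]
      refine (unitBall hF).mul_mem hP ?_
      have e : chartEquiv K (MvPolynomial.X j) = ⟨affineCoord K j, MvPolynomial.X j, by simp⟩ :=
        Subtype.ext (MvPolynomial.aeval_X (affineCoord K) j)
      rw [e]
      exact h j
  have hval : ∀ x : F, x ∈ unitBall hF ∨ x⁻¹ ∈ unitBall hF := by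
    intro x
    rcases le_total ‖x‖ 1 with hx | hx
    · exact Or.inl hx
    · refine Or.inr ?_
      change ‖x⁻¹‖ ≤ 1
      rw [norm_inv]
      exact inv_le_one_of_one_le₀ hx
  obtain ⟨p, hp, hpx⟩ := mem_chartClosure.1 b.2
  refine mem_of_eval₂_eq_zero (unitBall hF) hval
    ((Φ : chartClosure K →+* F).comp (chartIncl K : chart K →+* chartClosure K)) hA hp ?_
  have h1 : p.eval₂ (chartIncl K : chart K →+* chartClosure K) b = 0 := by
    apply Subtype.val_injective
    exact (hom_eval₂ p (chartIncl K : chart K →+* chartClosure K)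
      ((chartClosure K).val : chartClosure K →+* GeomField K) b).trans hpx
  have h2 := hom_eval₂ p (chartIncl K : chart K →+* chartClosure K) (Φ : chartClosure K →+* F) b
  rw [h1, map_zero] at h2
  exact h2.symm

/-- The labelling `ρ` is fixed before the arc is chosen. Hence all arcs through `(a₀, b₀)` have the
same clusters as subsets of `ι`, which is what allows the groups of different arcs to be compared.
-/
theorem exists_arcs [IsAlgClosed K] [Algebra K E] [IsScalarTower K E F] (p : ℕ) [Fact p.Prime]
    [CharP K p] (hF : IsValuedClosure K (F := F) π)
    {n m : ℕ} (hm : 0 < m) (hmn : m < n) (hcop : n.Coprime m) (hp : p ∣ n ∨ p ∣ n - m)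
    {ι : Type*} [Fintype ι] (hι : Fintype.card ι = n) {u : ι → GeomField K}
    (hu : Function.Injective u)
    (hr : ∀ i, u i ^ n + algebraMap _ _ (affineCoord K 0) * u i ^ m +
      algebraMap _ _ (affineCoord K 1) = 0)
    (G : Subgroup (Equiv.Perm ι)) (hG : ∀ σ : Gal K, ∃ g ∈ G, ∀ i, u (g i) = σ (u i))
    (a₀ b₀ : K) :
    ∃ ρ : ι → K, ∏ i, (X - C (ρ i)) = (X ^ n + C a₀ * X ^ m + C b₀ : K[X]) ∧
      ∀ a b : E, a ≠ 0 → b ≠ 0 → ‖algebraMap E F a - algebraMap K F a₀‖ < 1 →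
        ‖algebraMap E F b - algebraMap K F b₀‖ < 1 →
          ∃ e : ι → F, IsArc G ρ n m a b e := by
  have hInf : Infinite K := IsAlgClosed.instInfinite
  have := hF.isAlgClosed
  have := hF.isUltrametric
  have := hF.isAlgebraic
  have hL0 : affineCoord K 0 ≠ 0 := inv_ne_zero (coord_ne_zero K 0)
  have hL1 : affineCoord K 1 ≠ 0 := mul_ne_zero (coord_ne_zero K 1) hL0
  have hcharL : CharP (FunField K) p := charP_of_injective_algebraMap (algebraMap K _).injective p
  have hsep := separable_trinomial p hm hmn hcop hp hL0 hL1
  have hint : ∀ i, u i ∈ chartClosure K := fun i =>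
    ⟨X ^ n + C ⟨affineCoord K 0, MvPolynomial.X 0, by simp⟩ * X ^ m +
      C ⟨affineCoord K 1, MvPolynomial.X 1, by simp⟩, monic_trinomial hmn _ _, by
        simp only [eval₂_add, eval₂_mul, eval₂_C, eval₂_X_pow]
        exact hr i⟩
  have husep : ∀ i, IsSeparable (FunField K) (u i) := fun i => by
    refine hsep.of_dvd (minpoly.dvd _ _ ?_)
    simpa using hr i
  let v : ι → chartClosure K := fun i => ⟨u i, hint i⟩
  have hv : Function.Injective v := fun i j h => hu (congrArg Subtype.val h)
  have hvr : ∀ i, (v i : GeomField K) ^ n + (closureCoord 0 : chartClosure K) * (v i : GeomField K) ^ m +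
      (closureCoord 1 : chartClosure K) = 0 := hr
  obtain ⟨Φ₀, hΦ₀⟩ := exists_closureHom (K := K) (Ω := K) ![a₀, b₀]
  refine ⟨fun i => Φ₀ (v i), ?_, ?_⟩
  · have := prod_X_sub_C_specialize hmn hι hv hvr Φ₀
    rw [hΦ₀, hΦ₀] at this
    exact this
  intro a b ha hb hna hnb
  obtain ⟨Φ₁, hΦ₁⟩ := exists_closureHom (K := K) ![algebraMap E F a, algebraMap E F b]
  have hle : ∀ (x : F) (c : K), ‖x - algebraMap K F c‖ < 1 → ‖x‖ ≤ 1 := by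
    intro x c h
    rw [← sub_add_cancel x (algebraMap K F c)]
    exact (IsUltrametricDist.norm_add_le_max _ _).trans (max_le h.le (hF.norm_const_le c))
  have hΦ₁le := hF.norm_closureHom_le Φ₁ fun j => by
    rw [hΦ₁]
    obtain rfl | rfl : j = 0 ∨ j = 1 := by omega
    · exact hle _ _ hna
    · exact hle _ _ hnb
  obtain ⟨Ψ, hΨ⟩ := hF.exists_residueHom Φ₁ hΦ₁le
  -- The lift `Φ₁` of the arc was arbitrary, so its reduction `Ψ` may label the clusters differently
  -- from `Φ₀`. The two agree on the chart, and precomposing `Φ₁` with `σ₀` aligns the labels.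
  obtain ⟨σ₀, hσ₀⟩ := exists_gal_of_agree v husep Ψ Φ₀ fun j => by
    refine hF.eq_of_norm_sub_lt' (hΨ _) ?_
    rw [hΦ₁, hΦ₀]
    obtain rfl | rfl : j = 0 ∨ j = 1 := by omega
    · exact hna
    · exact hnb
  let Φ : chartClosure K →ₐ[K] F := Φ₁.comp (galClosure σ₀)
  have hΦ : ∀ j, Φ (closureCoord j) = ![algebraMap E F a, algebraMap E F b] j := fun j => by
    rw [← hΦ₁, ← galClosure_coord σ₀ j]
    simp only [Φ, AlgHom.comp_apply, galClosure_coord]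
  have hprodΦ := prod_X_sub_C_specialize hmn hι hv hvr Φ
  rw [hΦ, hΦ] at hprodΦ
  simp only [Matrix.cons_val_zero, Matrix.cons_val_one, Matrix.cons_val_fin_one] at hprodΦ
  have heval : ∀ x : F, ∏ i, (x - Φ (v i)) =
      x ^ n + algebraMap E F a * x ^ m + algebraMap E F b := fun x => by
    have := congrArg (eval x) hprodΦ
    simpa [eval_prod] using this
  have hcharF : CharP F p := charP_of_injective_algebraMap (algebraMap K F).injective p
  have hcharE : CharP E p := charP_of_injective_algebraMap (algebraMap K E).injective p
  have hroot : ∀ i, Φ (v i) ^ n + algebraMap E F a * Φ (v i) ^ m + algebraMap E F b = 0 := by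
    intro i
    rw [← heval]
    exact Finset.prod_eq_zero (Finset.mem_univ i) (sub_self _)
  refine ⟨fun i => Φ (v i), ⟨?_, hroot, ?_, ?_, fun i => ?_, ?_⟩⟩
  · have hs := separable_trinomial p hm hmn hcop hp
      ((map_ne_zero (algebraMap E F)).2 ha) ((map_ne_zero (algebraMap E F)).2 hb)
    rw [← hprodΦ] at hs
    exact separable_prod_X_sub_C_iff.1 hs
  · intro x hx
    rw [← heval] at hx
    obtain ⟨i, -, hi⟩ := Finset.prod_eq_zero_iff.1 hx
    exact ⟨i, (sub_eq_zero.1 hi).symm⟩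
  · intro i
    obtain ⟨h, hi⟩ := hσ₀ i
    have := hΨ (galClosure σ₀ (v i))
    rw [hi]
    exact this
  · refine (separable_trinomial p hm hmn hcop hp ha hb).of_dvd (minpoly.dvd _ _ ?_)
    simpa using hroot i
  · intro τ
    -- Since `τ` fixes `a` and `b`, the specializations `τ ∘ Φ` and `Φ` agree on the chart;
    -- conjugacy turns the local element `τ` into a global one, `σ`.
    obtain ⟨σ, hσ⟩ := exists_gal_of_agree v husep Φ
      ((τ.toAlgHom.restrictScalars K).comp Φ) fun j => by
        change Φ _ = τ (Φ _)
        rw [hΦ]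
        obtain rfl | rfl : j = 0 ∨ j = 1 := by omega
        · exact (τ.commutes a).symm
        · exact (τ.commutes b).symm
    obtain ⟨g, hg, hgu⟩ := hG σ
    refine ⟨g, hg, fun i => ?_⟩
    obtain ⟨h, hi⟩ := hσ i
    refine Eq.trans ?_ hi.symm
    exact congrArg Φ (Subtype.ext (hgu i))

end Arcs

/-! ### The parametrization of the curve -/

section CurvePoints

variable {K : Type*} [Field K] {k : Type*} [Field k] [Algebra K k] {n m : ℕ}

theorem curveVec_ne_zero (n m : ℕ) (u : k) : (![u ^ m, u ^ n, 1] : Fin 3 → k) ≠ 0 := fun h =>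
  one_ne_zero (congrFun h 2)

theorem pointAtInfinityVec_ne_zero : (![0, 1, 0] : Fin 3 → k) ≠ 0 := fun h =>
  one_ne_zero (congrFun h 1)

/-- The parametrization `u ↦ (u ^ m : u ^ n : 1)` of the curve `x ^ n = y ^ m * z ^ (n - m)`. -/
def curvePoint (n m : ℕ) (u : k) : ℙ k (Fin 3 → k) :=
  Projectivization.mk k ![u ^ m, u ^ n, 1] (curveVec_ne_zero n m u)

/-- The point `(0 : 1 : 0)` of the curve. -/
def pointAtInfinity (k : Type*) [Field k] : ℙ k (Fin 3 → k) :=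
  Projectivization.mk k ![0, 1, 0] pointAtInfinityVec_ne_zero

theorem curvePoint_injective (hcop : n.Coprime m) :
    Function.Injective (curvePoint n m : k → ℙ k (Fin 3 → k)) := by
  intro u u' h
  obtain ⟨a, ha⟩ := (Projectivization.mk_eq_mk_iff' k _ _ _ _).1 h
  have h2 := congrFun ha 2
  have h1 := congrFun ha 1
  have h0 := congrFun ha 0
  simp at h0 h1 h2
  subst h2
  rw [one_mul] at h0 h1
  by_cases hu : u = 0
  · subst hu
    by_contra hne
    have hu' : u' ≠ 0 := fun h => hne h.symm
    have e0 : m = 0 := by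
      by_contra h
      rw [zero_pow h] at h0
      exact pow_ne_zero _ hu' h0
    have e1 : n = 0 := by
      by_contra h
      rw [zero_pow h] at h1
      exact pow_ne_zero _ hu' h1
    simp [e0, e1] at hcop
  · have e0 : (u' / u) ^ m = 1 := by rw [div_pow, h0, div_self (pow_ne_zero _ hu)]
    have e1 : (u' / u) ^ n = 1 := by rw [div_pow, h1, div_self (pow_ne_zero _ hu)]
    have e2 : orderOf (u' / u) ∣ 1 := by
      rw [← hcop]
      exact Nat.dvd_gcd (orderOf_dvd_of_pow_eq_one e1) (orderOf_dvd_of_pow_eq_one e0)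
    have e3 : u' / u = 1 := orderOf_eq_one_iff.1 (Nat.dvd_one.1 e2)
    exact ((div_eq_one_iff_eq hu).1 e3).symm

theorem curvePoint_ne_pointAtInfinity (u : k) : curvePoint n m u ≠ pointAtInfinity k := by
  intro h
  obtain ⟨a, ha⟩ := (Projectivization.mk_eq_mk_iff' k _ _ _ _).1 h
  have h2 := congrFun ha 2
  simp at h2

theorem aeval_trinomialCurve (v : Fin 3 → k) :
    MvPolynomial.aeval v (trinomialCurve K n m) = v 0 ^ n - v 1 ^ m * v 2 ^ (n - m) := by
  simp [trinomialCurve]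

theorem mk_mem_fiber_iff (hmn : m < n) {v c : Fin 3 → k} (hv : v ≠ 0) (hc : c ≠ 0) :
    Projectivization.mk k v hv ∈ fiber (trinomialCurve K n m) (Projectivization.mk k c hc) ↔
      v 0 ^ n = v 1 ^ m * v 2 ^ (n - m) ∧ c 0 * v 0 + c 1 * v 1 + c 2 * v 2 = 0 := by
  simp only [fiber, Set.mem_ofPred_eq, Projectivization.submodule_mk]
  constructor
  · rintro ⟨h1, h2⟩
    have e1 := h1 v (Submodule.mem_span_singleton_self v)
    have e2 := h2 c (Submodule.mem_span_singleton_self c) v (Submodule.mem_span_singleton_self v)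
    rw [aeval_trinomialCurve, sub_eq_zero] at e1
    rw [Fin.sum_univ_three] at e2
    exact ⟨e1, e2⟩
  · rintro ⟨h1, h2⟩
    refine ⟨fun w hw => ?_, fun b hb w hw => ?_⟩
    · obtain ⟨t, rfl⟩ := Submodule.mem_span_singleton.1 hw
      rw [aeval_trinomialCurve]
      simp only [Pi.smul_apply, smul_eq_mul, mul_pow]
      have e : t ^ n = t ^ m * t ^ (n - m) := by rw [← pow_add, Nat.add_sub_cancel' hmn.le]
      rw [h1, e]
      ring
    · obtain ⟨t, rfl⟩ := Submodule.mem_span_singleton.1 hw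
      obtain ⟨s, rfl⟩ := Submodule.mem_span_singleton.1 hb
      rw [Fin.sum_univ_three]
      simp only [Pi.smul_apply, smul_eq_mul]
      linear_combination s * t * h2

theorem curvePoint_mem_fiber_iff (hmn : m < n) {u : k} {c : Fin 3 → k} (hc : c ≠ 0) :
    curvePoint n m u ∈ fiber (trinomialCurve K n m) (Projectivization.mk k c hc) ↔
      c 0 * u ^ m + c 1 * u ^ n + c 2 = 0 := by
  rw [curvePoint, mk_mem_fiber_iff hmn]
  simp [← pow_mul, mul_comm]

theorem pointAtInfinity_mem_fiber_iff (hmn : m < n) {c : Fin 3 → k} (hc : c ≠ 0) :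
    pointAtInfinity k ∈ fiber (trinomialCurve K n m) (Projectivization.mk k c hc) ↔ c 1 = 0 := by
  rw [pointAtInfinity, mk_mem_fiber_iff hmn]
  simp [show n - m ≠ 0 by omega, show n ≠ 0 by omega]

/-- The points of the curve. -/
theorem exists_curvePoint_of_mem_fiber (hm : 0 < m) (hmn : m < n) (hcop : n.Coprime m)
    {P l : ℙ k (Fin 3 → k)} (hP : P ∈ fiber (trinomialCurve K n m) l) :
    P = pointAtInfinity k ∨ ∃ u, P = curvePoint n m u := by
  induction P with | h v hv =>
  induction l with | h c hc =>
  obtain ⟨h1, -⟩ := (mk_mem_fiber_iff hmn hv hc).1 hP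
  by_cases hz : v 2 = 0
  · left
    rw [hz, zero_pow (by omega), mul_zero] at h1
    have h0 : v 0 = 0 := eq_zero_of_pow_eq_zero h1
    refine (Projectivization.mk_eq_mk_iff' k _ _ _ _).2 ⟨v 1, ?_⟩
    ext i
    fin_cases i <;> simp [h0, hz]
  · right
    set x := v 0 / v 2 with hx
    set y := v 1 / v 2 with hy
    have hxy : x ^ n = y ^ m := by
      rw [hx, hy, div_pow, div_pow, h1, div_eq_div_iff (pow_ne_zero _ hz) (pow_ne_zero _ hz),
        mul_assoc, ← pow_add, Nat.sub_add_cancel hmn.le]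
    obtain ⟨u, hu1, hu2⟩ : ∃ u : k, u ^ m = x ∧ u ^ n = y := by
      by_cases hx0 : x = 0
      · rw [hx0, zero_pow (by omega), eq_comm] at hxy
        have hy0 : y = 0 := eq_zero_of_pow_eq_zero hxy
        exact ⟨0, by rw [hx0, zero_pow hm.ne'], by rw [hy0, zero_pow (by omega)]⟩
      · have hy0 : y ≠ 0 := by
          intro h
          rw [h, zero_pow hm.ne'] at hxy
          exact pow_ne_zero _ hx0 hxy
        have hb := Nat.gcd_eq_gcd_ab n m
        rw [hcop, Nat.cast_one] at hb
        set s := Nat.gcdA n m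
        set r := Nat.gcdB n m
        have hxy' : x ^ (n : ℤ) = y ^ (m : ℤ) := by exact_mod_cast hxy
        -- From `x = u ^ m`, `y = u ^ n` and Bézout's identity `n * s + m * r = 1` one recovers `u =
        -- x ^ r * y ^ s`.
        refine ⟨x ^ r * y ^ s, ?_, ?_⟩
        · rw [← zpow_natCast, mul_zpow, ← zpow_mul, ← zpow_mul, mul_comm s, zpow_mul y, ← hxy',
            ← zpow_mul, ← zpow_add₀ hx0, mul_comm r, add_comm, ← hb, zpow_one]
        · rw [← zpow_natCast, mul_zpow, ← zpow_mul, ← zpow_mul, mul_comm r, zpow_mul x, hxy',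
            ← zpow_mul, ← zpow_add₀ hy0, mul_comm s, add_comm, ← hb, zpow_one]
    refine ⟨u, (Projectivization.mk_eq_mk_iff' k _ _ _ _).2 ⟨v 2, ?_⟩⟩
    rw [hu1, hu2, hx, hy]
    ext i
    fin_cases i
    · exact mul_div_cancel₀ _ hz
    · exact mul_div_cancel₀ _ hz
    · exact mul_one _

theorem totalDegree_trinomialCurve (hm : 0 < m) (hmn : m < n) :
    (trinomialCurve K n m).totalDegree = n := by
  have hh : (trinomialCurve K n m).IsHomogeneous n := by
    refine MvPolynomial.IsHomogeneous.sub (MvPolynomial.isHomogeneous_X_pow _ _) ?_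
    have := (MvPolynomial.isHomogeneous_X_pow (R := K) (1 : Fin 3) m).mul
      (MvPolynomial.isHomogeneous_X_pow (R := K) (2 : Fin 3) (n - m))
    rwa [Nat.add_sub_cancel' hmn.le] at this
  refine hh.totalDegree fun h => ?_
  have := congrArg (MvPolynomial.aeval (![1, 0, 0] : Fin 3 → K)) h
  rw [aeval_trinomialCurve] at this
  simp [zero_pow hm.ne'] at this

end CurvePoints

/-! ### Line sections as root sets, and transversality over the étale locus -/

section Fibers

open Polynomial

variable {K : Type*} [Field K] {k : Type*} [Field k] [Algebra K k] {n m : ℕ}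

/-- The points of a line section of the curve outside `(0 : 1 : 0)` correspond to the roots of a
trinomial. -/
noncomputable def sectionPoly (n m : ℕ) (c : Fin 3 → k) : k[X] :=
  C (c 1) * X ^ n + C (c 0) * X ^ m + C (c 2)

theorem sectionPoly_ne_zero (hm : 0 < m) (hmn : m < n) {c : Fin 3 → k} (hc : c ≠ 0) :
    sectionPoly n m c ≠ 0 := by
  intro h
  apply hc
  have h1 : ∀ j, (sectionPoly n m c).coeff j = 0 := fun j => by rw [h, coeff_zero]
  have e0 := h1 0
  have em := h1 m
  have en := h1 n
  simp [sectionPoly, coeff_X_pow, coeff_C, hm.ne, hm.ne', hmn.ne, hmn.ne', (hm.trans hmn).ne,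
    (hm.trans hmn).ne'] at e0 em en
  ext i
  fin_cases i
  · exact em
  · exact en
  · exact e0

theorem eval_sectionPoly (c : Fin 3 → k) (u : k) :
    (sectionPoly n m c).eval u = c 0 * u ^ m + c 1 * u ^ n + c 2 := by
  simp [sectionPoly]
  ring

open Classical in
theorem fiber_eq_image (hm : 0 < m) (hmn : m < n) (hcop : n.Coprime m) {c : Fin 3 → k}
    (hc : c ≠ 0) :
    fiber (trinomialCurve K n m) (Projectivization.mk k c hc) =
      curvePoint n m '' ((sectionPoly n m c).roots.toFinset : Set k) ∪
        if c 1 = 0 then {pointAtInfinity k} else ∅ := by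
  ext P
  constructor
  · intro hP
    rcases exists_curvePoint_of_mem_fiber hm hmn hcop hP with rfl | ⟨u, rfl⟩
    · rw [pointAtInfinity_mem_fiber_iff hmn] at hP
      right
      simp [hP]
    · rw [curvePoint_mem_fiber_iff hmn] at hP
      left
      refine ⟨u, ?_, rfl⟩
      rw [Finset.mem_coe, Multiset.mem_toFinset, mem_roots (sectionPoly_ne_zero hm hmn hc),
        IsRoot, eval_sectionPoly, hP]
  · rintro (⟨u, hu, rfl⟩ | hP)
    · rw [Finset.mem_coe, Multiset.mem_toFinset, mem_roots (sectionPoly_ne_zero hm hmn hc),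
        IsRoot, eval_sectionPoly] at hu
      exact (curvePoint_mem_fiber_iff hmn hc).2 hu
    · by_cases h : c 1 = 0
      · simp only [h, if_true, Set.mem_singleton_iff] at hP
        rw [hP]
        exact (pointAtInfinity_mem_fiber_iff hmn hc).2 h
      · simp [h] at hP

open Classical in
theorem ncard_fiber (hm : 0 < m) (hmn : m < n) (hcop : n.Coprime m) {c : Fin 3 → k}
    (hc : c ≠ 0) :
    (fiber (trinomialCurve K n m) (Projectivization.mk k c hc)).ncard =
      (sectionPoly n m c).roots.toFinset.card + if c 1 = 0 then 1 else 0 := by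
  rw [fiber_eq_image hm hmn hcop, Set.ncard_union_eq ?_ ?_ ?_]
  · rw [Set.ncard_image_of_injective _ (curvePoint_injective hcop), Set.ncard_coe_finset]
    split_ifs <;> simp
  · rw [Set.disjoint_left]
    rintro _ ⟨u, -, rfl⟩ h
    split_ifs at h
    · exact curvePoint_ne_pointAtInfinity u h
    · exact h
  · exact (Finset.finite_toSet _).image _
  · split_ifs <;> simp

theorem finite_fiber (hm : 0 < m) (hmn : m < n) (hcop : n.Coprime m) (l : ℙ k (Fin 3 → k)) :
    (fiber (trinomialCurve K n m) l).Finite := by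
  classical
  induction l with | h c hc =>
  rw [fiber_eq_image hm hmn hcop]
  refine ((Finset.finite_toSet _).image _).union ?_
  split_ifs <;> simp

theorem natDegree_sectionPoly_le (c : Fin 3 → k) (hmn : m < n) :
    (sectionPoly n m c).natDegree ≤ n ∧ (c 1 = 0 → (sectionPoly n m c).natDegree ≤ m) := by
  constructor
  · unfold sectionPoly
    compute_degree
    omega
  · intro h
    simp only [sectionPoly, h, C_0, zero_mul, zero_add]
    compute_degree

/-- The roots of the section polynomial of a line in the étale locus are simple. -/
theorem derivative_sectionPoly_ne_zero (hm : 0 < m) (hmn : m < n) (hcop : n.Coprime m)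
    {c : Fin 3 → k} (hc : c ≠ 0)
    (h : (fiber (trinomialCurve K n m) (Projectivization.mk k c hc)).ncard = n) {u : k}
    (hu : (sectionPoly n m c).eval u = 0) : (derivative (sectionPoly n m c)).eval u ≠ 0 := by
  classical
  intro hd
  rw [ncard_fiber hm hmn hcop] at h
  have h0 := sectionPoly_ne_zero hm hmn hc
  have h2 : 1 < (sectionPoly n m c).rootMultiplicity u :=
    (one_lt_rootMultiplicity_iff_isRoot h0).2 ⟨hu, hd⟩
  -- A double root loses a point of the section. The point at infinity cannot compensate for it:
  -- when it is present, the degree has dropped to at most `m < n`.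
  have h3 : (sectionPoly n m c).roots.toFinset.card < (sectionPoly n m c).roots.card := by
    refine lt_of_le_of_ne (Multiset.toFinset_card_le _) fun he => ?_
    have := Multiset.toFinset_card_eq_card_iff_nodup.1 he
    have := Multiset.nodup_iff_count_le_one.1 this u
    rw [count_roots] at this
    omega
  have h4 := card_roots' (sectionPoly n m c)
  obtain ⟨h5, h6⟩ := natDegree_sectionPoly_le c hmn
  split_ifs at h with h1
  · have := h6 h1
    omega
  · omega

/-- A line of the étale locus through `(0 : 1 : 0)` is transversal to the curve there. -/
theorem transversal_at_infinity (hm : 0 < m) (hmn : m < n) (hcop : n.Coprime m)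
    {c : Fin 3 → k} (hc : c ≠ 0)
    (h : (fiber (trinomialCurve K n m) (Projectivization.mk k c hc)).ncard = n) (h1 : c 1 = 0) :
    n = m + 1 ∧ c 0 ≠ 0 := by
  classical
  rw [ncard_fiber hm hmn hcop, if_pos h1] at h
  have h4 := card_roots' (sectionPoly n m c)
  have h5 := (natDegree_sectionPoly_le c hmn).2 h1
  have h6 := Multiset.toFinset_card_le (sectionPoly n m c).roots
  refine ⟨by omega, fun h0 => ?_⟩
  have : (sectionPoly n m c).natDegree = 0 := by
    simp [sectionPoly, h0, h1]
  omega

end Fibers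

/-! ### Existence of paths to points of the étale locus -/

section Paths

variable {K : Type*} [Field K] {F : Type*} [Field F] [Algebra K F] {n m : ℕ}

open Classical in
/-- The specialization of the point of the curve with parameter `u` along a place. -/
noncomputable def specialPoint (φ : Place K F) (n m : ℕ) (u : GeomField K) : ℙ F (Fin 3 → F) :=
  if h : u ∈ φ.ring then curvePoint n m (φ.hom ⟨u, h⟩) else pointAtInfinity F

theorem mul_sum_geom {R : Type*} [CommRing R] (x y : R) (l : ℕ) :
    (x - y) * ∑ i ∈ Finset.range l, x ^ i * y ^ (l - 1 - i) = x ^ l - y ^ l := by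
  rw [mul_comm, (Commute.all x y).geom_sum₂_mul]

/-- Distinct parameters with the same specialization: the divided difference of the equation
vanishes. -/
theorem specialize_divided_difference {V F : Type*} [CommRing V] [IsDomain V] [Field F]
    (φ : V →+* F) {a b c x y : V} {r s : ℕ} (hxy : x ≠ y) (hφ : φ x = φ y)
    (hx : a * x ^ r + b * x ^ s + c = 0) (hy : a * y ^ r + b * y ^ s + c = 0) :
    φ a * (r * φ x ^ (r - 1)) + φ b * (s * φ x ^ (s - 1)) = 0 := by
  have h : (x - y) * (a * ∑ i ∈ Finset.range r, x ^ i * y ^ (r - 1 - i) +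
      b * ∑ i ∈ Finset.range s, x ^ i * y ^ (s - 1 - i)) = 0 := by
    linear_combination a * mul_sum_geom x y r + b * mul_sum_geom x y s + hx - hy
  have h2 := congrArg φ ((mul_eq_zero.1 h).resolve_left (sub_ne_zero.2 hxy))
  have hs : ∀ l : ℕ, ∑ i ∈ Finset.range l, φ x ^ i * φ x ^ (l - 1 - i) = l * φ x ^ (l - 1) := by
    intro l
    rw [Finset.sum_congr rfl (g := fun _ => φ x ^ (l - 1)), Finset.sum_const, Finset.card_range,
      nsmul_eq_mul]
    intro i hi
    rw [← pow_add, Nat.add_sub_cancel' (by have := Finset.mem_range.1 hi; omega)]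
  simp only [map_add, map_mul, map_sum, map_pow, ← hφ, map_zero, hs] at h2
  exact h2

end Paths

section Paths

universe u

variable {K : Type u} [Field K] {F : Type*} [Field F] [Algebra K F] {n m : ℕ}

/-- The generic line specializes to any line other than `z = 0`. -/
theorem exists_place_specializes_line [Infinite K] [IsAlgClosed F] {c : Fin 3 → F}
    (hc : c 1 ≠ 0 ∨ c 0 ≠ 0) :
    ∃ φ : Place K F, (∀ x : φ.ring, φ.hom x ≠ 0 → (x : GeomField K)⁻¹ ∈ φ.ring) ∧
      ∃ (s : Fin 3 → φ.ring) (t : GeomField K), t ≠ 0 ∧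
        (∀ i, (s i : GeomField K) = t * genericGeomVec K i) ∧
        ∃ r : F, r ≠ 0 ∧ ∀ i, φ.hom (s i) = r * c i := by
  have h0 := coord_ne_zero K 0
  have h0' : algebraMap (FunField K) (GeomField K) (coord 0) ≠ 0 :=
    (map_ne_zero (algebraMap (FunField K) (GeomField K))).2 h0
  -- Lines with `c 1 = 0` lie outside the chart `1 / t₁`, `t₂ / t₁`; for them the coordinates `t₁`,
  -- `t₂` are used instead.
  by_cases hc1 : c 1 = 0
  · have hc0 : c 0 ≠ 0 := hc.resolve_left (not_not.2 hc1)
    have hinj : Function.Injective (IsScalarTower.toAlgHom K (MvPolynomial (Fin 2) K)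
        (GeomField K)) := by
      have := (algebraMap (FunField K) (GeomField K)).injective.comp
        (FaithfulSMul.algebraMap_injective (MvPolynomial (Fin 2) K) (FunField K))
      intro x y hxy
      apply this
      simpa [IsScalarTower.algebraMap_apply (MvPolynomial (Fin 2) K) (FunField K) (GeomField K)]
        using hxy
    obtain ⟨φ, hφ, h⟩ := exists_place_of_injective _ hinj ![c 1 / c 0, c 2 / c 0]
    have hX := fun j => h (MvPolynomial.X j)
    choose hX1 hX2 using hX
    have e : ∀ j, IsScalarTower.toAlgHom K (MvPolynomial (Fin 2) K) (GeomField K)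
        (MvPolynomial.X j) = algebraMap (FunField K) (GeomField K) (coord j) := fun j =>
      IsScalarTower.algebraMap_apply (MvPolynomial (Fin 2) K) (FunField K) (GeomField K) _
    refine ⟨φ, hφ, ![1, ⟨_, hX1 0⟩, ⟨_, hX1 1⟩], 1, one_ne_zero, fun i => ?_, (c 0)⁻¹,
      inv_ne_zero hc0, fun i => ?_⟩
    · fin_cases i
      · simp [genericGeomVec, genericVec]
      · simpa [genericGeomVec, genericVec] using e 0
      · simpa [genericGeomVec, genericVec] using e 1
    · fin_cases i
      · simp [hc0]
      · refine (hX2 0).trans ?_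
        simp [hc1]
      · refine (hX2 1).trans ?_
        simp [div_eq_inv_mul]
  · obtain ⟨φ, hφ, -, h⟩ := exists_place_chart (K := K) ![c 0 / c 1, c 2 / c 1]
    choose hX1 hX2 using h
    refine ⟨φ, hφ, ![⟨_, hX1 0⟩, 1, ⟨_, hX1 1⟩],
      algebraMap (FunField K) (GeomField K) (affineCoord K 0),
      (map_ne_zero (algebraMap (FunField K) (GeomField K))).2 (inv_ne_zero h0), fun i => ?_,
      (c 1)⁻¹, inv_ne_zero hc1, fun i => ?_⟩
    · fin_cases i
      · simp [genericGeomVec, genericVec]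
      · simp [genericGeomVec, genericVec, affineCoord_zero, h0']
      · simp [genericGeomVec, genericVec, affineCoord_zero, affineCoord_one, mul_comm]
    · fin_cases i
      · refine (hX2 0).trans ?_
        simp [div_eq_inv_mul]
      · simp [hc1]
      · refine (hX2 1).trans ?_
        simp [div_eq_inv_mul]

theorem genericGeomVec_one_ne_zero : genericGeomVec K 1 ≠ 0 :=
  (map_ne_zero (algebraMap (FunField K) (GeomField K))).2 (coord_ne_zero K 0)

/-- The points of the generic line section, by their parameter. -/
theorem mem_generic_fiber_iff (hm : 0 < m) (hmn : m < n) (hcop : n.Coprime m)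
    {P : ℙ (GeomField K) (Fin 3 → GeomField K)} :
    P ∈ fiber (trinomialCurve K n m) (genericLine K) ↔
      ∃ u, P = curvePoint n m u ∧ genericGeomVec K 0 * u ^ m + genericGeomVec K 1 * u ^ n +
        genericGeomVec K 2 = 0 := by
  constructor
  · intro hP
    rcases exists_curvePoint_of_mem_fiber hm hmn hcop hP with rfl | ⟨u, rfl⟩
    · exact absurd ((pointAtInfinity_mem_fiber_iff hmn _).1 hP) genericGeomVec_one_ne_zero
    · exact ⟨u, rfl, (curvePoint_mem_fiber_iff hmn _).1 hP⟩
  · rintro ⟨u, rfl, hu⟩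
    exact (curvePoint_mem_fiber_iff hmn _).2 hu

theorem generic_equation_iff {u : GeomField K} :
    genericGeomVec K 0 * u ^ m + genericGeomVec K 1 * u ^ n + genericGeomVec K 2 = 0 ↔
      u ^ n + algebraMap _ _ (affineCoord K 0) * u ^ m +
        algebraMap _ _ (affineCoord K 1) = 0 := by
  have h0' : algebraMap (FunField K) (GeomField K) (coord 0) ≠ 0 :=
    (map_ne_zero (algebraMap (FunField K) (GeomField K))).2 (coord_ne_zero K 0)
  have e0 : genericGeomVec K 0 = 1 := map_one (algebraMap (FunField K) (GeomField K))
  have e1 : genericGeomVec K 1 = algebraMap _ _ (coord 0) := rfl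
  have e2 : genericGeomVec K 2 = algebraMap _ _ (coord 1) := rfl
  rw [affineCoord_zero, affineCoord_one, e0, e1, e2, map_mul, map_inv₀]
  generalize algebraMap (FunField K) (GeomField K) (coord 0) = t at *
  generalize algebraMap (FunField K) (GeomField K) (coord 1) = t'
  have : u ^ n + t⁻¹ * u ^ m + t' * t⁻¹ = t⁻¹ * (1 * u ^ m + t * u ^ n + t') := by
    field_simp
    ring
  rw [this, mul_eq_zero]
  simp [h0']

end Paths

section Paths

open Polynomial

universe u

variable {K : Type u} [Field K] {F : Type*} [Field F] [Algebra K F] {n m : ℕ}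

theorem ncard_generic_fiber (p : ℕ) [Fact p.Prime] [CharP K p] (hm : 0 < m) (hmn : m < n)
    (hcop : n.Coprime m) (hp : p ∣ n ∨ p ∣ n - m) :
    (fiber (trinomialCurve K n m) (genericLine K)).ncard = n := by
  have hchar : CharP (FunField K) p := charP_of_injective_algebraMap (algebraMap K _).injective p
  have hL0 : affineCoord K 0 ≠ 0 := inv_ne_zero (coord_ne_zero K 0)
  have hL1 : affineCoord K 1 ≠ 0 := mul_ne_zero (coord_ne_zero K 1) hL0
  have hsep := separable_trinomial p hm hmn hcop hp hL0 hL1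
  set f : (FunField K)[X] := X ^ n + C (affineCoord K 0) * X ^ m + C (affineCoord K 1) with hf
  have himg : fiber (trinomialCurve K n m) (genericLine K) =
      curvePoint n m '' f.rootSet (GeomField K) := by
    ext P
    rw [mem_generic_fiber_iff hm hmn hcop]
    constructor
    · rintro ⟨u, rfl, hu⟩
      refine ⟨u, ?_, rfl⟩
      rw [mem_rootSet_of_ne (monic_trinomial hmn _ _).ne_zero]
      simpa [hf] using generic_equation_iff.1 hu
    · rintro ⟨u, hu, rfl⟩
      refine ⟨u, rfl, generic_equation_iff.2 ?_⟩
      rw [mem_rootSet_of_ne (monic_trinomial hmn _ _).ne_zero] at hu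
      simpa [hf] using hu
  rw [himg, Set.ncard_image_of_injective _ (curvePoint_injective hcop), ← Nat.card_coe_set_eq,
    Nat.card_eq_fintype_card, card_rootSet_eq_natDegree hsep (IsAlgClosed.splits _),
    natDegree_trinomial hmn]

variable {φ : Place K F} {s : Fin 3 → φ.ring} {t : GeomField K}

theorem place_equation (hs : ∀ i, (s i : GeomField K) = t * genericGeomVec K i) {u : GeomField K}
    (hu : genericGeomVec K 0 * u ^ m + genericGeomVec K 1 * u ^ n + genericGeomVec K 2 = 0)
    (h : u ∈ φ.ring) : s 0 * ⟨u, h⟩ ^ m + s 1 * ⟨u, h⟩ ^ n + s 2 = 0 := by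
  apply Subtype.val_injective
  have : (s 0 : GeomField K) * u ^ m + s 1 * u ^ n + s 2 = 0 := by
    rw [hs, hs, hs]
    linear_combination t * hu
  exact this

theorem place_equation_inv (hmn : m < n)
    (hs : ∀ i, (s i : GeomField K) = t * genericGeomVec K i) {u : GeomField K} (hu0 : u ≠ 0)
    (hu : genericGeomVec K 0 * u ^ m + genericGeomVec K 1 * u ^ n + genericGeomVec K 2 = 0)
    (h : u⁻¹ ∈ φ.ring) : s 0 * ⟨u⁻¹, h⟩ ^ (n - m) + s 2 * ⟨u⁻¹, h⟩ ^ n + s 1 = 0 := by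
  apply Subtype.val_injective
  have : (s 0 : GeomField K) * u⁻¹ ^ (n - m) + s 2 * u⁻¹ ^ n + s 1 = 0 := by
    rw [hs, hs, hs]
    have e1 : u⁻¹ ^ n * u ^ n = 1 := by rw [← mul_pow, inv_mul_cancel₀ hu0, one_pow]
    have e2 : u⁻¹ ^ n * u ^ m = u⁻¹ ^ (n - m) := by
      rw [← Nat.sub_add_cancel hmn.le, pow_add, mul_assoc, ← mul_pow, inv_mul_cancel₀ hu0,
        one_pow, mul_one, Nat.sub_add_cancel hmn.le]
    linear_combination t * u⁻¹ ^ n * hu - t * genericGeomVec K 0 * e2 -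
      t * genericGeomVec K 1 * e1
  exact this

/-- The condition `hφ`, that elements with nonzero value are units, is not part of `Place`. It is
what makes a parameter outside the ring specialize to infinity. -/
theorem inv_mem_and_hom_eq_zero
    (hφ : ∀ x : φ.ring, φ.hom x ≠ 0 → (x : GeomField K)⁻¹ ∈ φ.ring) {u : GeomField K}
    (hu : u ∉ φ.ring) : u ≠ 0 ∧ ∃ h : u⁻¹ ∈ φ.ring, φ.hom ⟨u⁻¹, h⟩ = 0 := by
  have h := (φ.mem_or_inv_mem u).resolve_left hu
  refine ⟨fun h0 => hu (h0 ▸ φ.ring.zero_mem), h, ?_⟩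
  by_contra hne
  exact hu (inv_inv u ▸ hφ _ hne)

theorem specialPoint_of_mem {u : GeomField K} (h : u ∈ φ.ring) :
    specialPoint φ n m u = curvePoint n m (φ.hom ⟨u, h⟩) := dif_pos h

theorem specialPoint_of_notMem {u : GeomField K} (h : u ∉ φ.ring) :
    specialPoint φ n m u = pointAtInfinity F := dif_neg h

theorem specialPoint_mem_fiber (hmn : m < n)
    (hφ : ∀ x : φ.ring, φ.hom x ≠ 0 → (x : GeomField K)⁻¹ ∈ φ.ring)
    (hs : ∀ i, (s i : GeomField K) = t * genericGeomVec K i)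
    (hc : (fun i => φ.hom (s i)) ≠ 0) {u : GeomField K}
    (hu : genericGeomVec K 0 * u ^ m + genericGeomVec K 1 * u ^ n + genericGeomVec K 2 = 0) :
    specialPoint φ n m u ∈ fiber (trinomialCurve K n m)
      (Projectivization.mk F (fun i => φ.hom (s i)) hc) := by
  by_cases h : u ∈ φ.ring
  · rw [specialPoint_of_mem h, curvePoint_mem_fiber_iff hmn]
    have := congrArg φ.hom (place_equation hs hu h)
    simpa only [map_add, map_mul, map_pow, map_zero] using this
  · rw [specialPoint_of_notMem h, pointAtInfinity_mem_fiber_iff hmn]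
    obtain ⟨hu0, h1, h2⟩ := inv_mem_and_hom_eq_zero hφ h
    have := congrArg φ.hom (place_equation_inv hmn hs hu0 hu h1)
    simp only [map_add, map_mul, map_pow, map_zero, h2] at this
    simpa [show n - m ≠ 0 by omega, show n ≠ 0 by omega] using this

theorem specializesTo_specialPoint (hmn : m < n)
    (hφ : ∀ x : φ.ring, φ.hom x ≠ 0 → (x : GeomField K)⁻¹ ∈ φ.ring) (u : GeomField K) :
    φ.SpecializesTo (curvePoint n m u) (specialPoint φ n m u) := by
  by_cases h : u ∈ φ.ring
  · rw [specialPoint_of_mem h]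
    refine ⟨![⟨u, h⟩ ^ m, ⟨u, h⟩ ^ n, 1], ?_, ?_, ?_⟩
    · rw [curvePoint, Projectivization.submodule_mk]
      convert Submodule.mem_span_singleton_self _ using 1
      ext i
      fin_cases i <;> rfl
    · rw [curvePoint, Projectivization.submodule_mk]
      convert Submodule.mem_span_singleton_self _ using 1
      ext i
      fin_cases i
      · exact map_pow φ.hom _ _
      · exact map_pow φ.hom _ _
      · exact map_one φ.hom
    · intro h0
      have := congrFun h0 2
      simp at this
  · rw [specialPoint_of_notMem h]
    obtain ⟨hu0, h1, h2⟩ := inv_mem_and_hom_eq_zero hφ h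
    refine ⟨![⟨u⁻¹, h1⟩ ^ (n - m), 1, ⟨u⁻¹, h1⟩ ^ n], ?_, ?_, ?_⟩
    · rw [curvePoint, Projectivization.submodule_mk, Submodule.mem_span_singleton]
      refine ⟨u⁻¹ ^ n, ?_⟩
      ext i
      fin_cases i
      · change u⁻¹ ^ n * u ^ m = u⁻¹ ^ (n - m)
        rw [← Nat.sub_add_cancel hmn.le, pow_add, mul_assoc, ← mul_pow, inv_mul_cancel₀ hu0,
          one_pow, mul_one, Nat.sub_add_cancel hmn.le]
      · change u⁻¹ ^ n * u ^ n = 1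
        rw [← mul_pow, inv_mul_cancel₀ hu0, one_pow]
      · exact mul_one _
    · rw [pointAtInfinity, Projectivization.submodule_mk]
      convert Submodule.mem_span_singleton_self _ using 1
      ext i
      fin_cases i
      · exact (map_pow φ.hom _ _).trans (by rw [h2, zero_pow (by omega)]; rfl)
      · exact map_one φ.hom
      · exact (map_pow φ.hom _ _).trans (by rw [h2, zero_pow (by omega)]; rfl)
    · intro h0
      have := congrFun h0 1
      simp at this

/-- If two points of the generic section collide, the divided difference of their equations
specializes to a derivative, which then vanishes at the common limit. That contradicts
transversality, at a finite parameter or, in the coordinate `u⁻¹`, at infinity. -/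
theorem specialPoint_injOn (hm : 0 < m) (hmn : m < n) (hcop : n.Coprime m)
    (hφ : ∀ x : φ.ring, φ.hom x ≠ 0 → (x : GeomField K)⁻¹ ∈ φ.ring)
    (hs : ∀ i, (s i : GeomField K) = t * genericGeomVec K i)
    (hc : (fun i => φ.hom (s i)) ≠ 0)
    (hcard : (fiber (trinomialCurve K n m)
      (Projectivization.mk F (fun i => φ.hom (s i)) hc)).ncard = n) {u u' : GeomField K}
    (hu : genericGeomVec K 0 * u ^ m + genericGeomVec K 1 * u ^ n + genericGeomVec K 2 = 0)
    (hu' : genericGeomVec K 0 * u' ^ m + genericGeomVec K 1 * u' ^ n + genericGeomVec K 2 = 0)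
    (h : specialPoint φ n m u = specialPoint φ n m u') : u = u' := by
  by_contra hne
  by_cases h1 : u ∈ φ.ring <;> by_cases h1' : u' ∈ φ.ring
  · rw [specialPoint_of_mem h1, specialPoint_of_mem h1'] at h
    have h2 := curvePoint_injective hcop h
    have e1 := place_equation hs hu h1
    have e2 := place_equation hs hu' h1'
    have h3 := specialize_divided_difference (φ.hom : φ.ring →+* F)
      (fun h => hne (congrArg Subtype.val h)) h2 e1 e2
    refine derivative_sectionPoly_ne_zero hm hmn hcop hc hcard (u := φ.hom ⟨u, h1⟩) ?_ ?_
    · rw [eval_sectionPoly]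
      have := congrArg φ.hom e1
      simpa only [map_add, map_mul, map_pow, map_zero] using this
    · simp only [sectionPoly, derivative_add, derivative_C_mul, derivative_X_pow, derivative_C,
        add_zero, eval_add, eval_mul, eval_C, eval_pow, eval_X]
      rw [add_comm]
      exact h3
  · rw [specialPoint_of_mem h1, specialPoint_of_notMem h1'] at h
    exact curvePoint_ne_pointAtInfinity _ h
  · rw [specialPoint_of_notMem h1, specialPoint_of_mem h1'] at h
    exact curvePoint_ne_pointAtInfinity _ h.symm
  · obtain ⟨hu0, h2, h3⟩ := inv_mem_and_hom_eq_zero hφ h1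
    obtain ⟨hu0', h2', h3'⟩ := inv_mem_and_hom_eq_zero hφ h1'
    have hmem := specialPoint_mem_fiber hmn hφ hs hc hu
    rw [specialPoint_of_notMem h1, pointAtInfinity_mem_fiber_iff hmn] at hmem
    obtain ⟨hn, h4⟩ := transversal_at_infinity hm hmn hcop hc hcard hmem
    have h5 := specialize_divided_difference (φ.hom : φ.ring →+* F)
      (fun h => hne (inv_injective (congrArg Subtype.val h))) (h3.trans h3'.symm)
      (place_equation_inv hmn hs hu0 hu h2) (place_equation_inv hmn hs hu0' hu' h2')
    -- Once `n = m + 1`, the divided difference at `u⁻¹ = 0` reduces to the coefficient of index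
    -- `0`, which is nonzero by transversality.
    rw [hn] at h5
    have h3c : (φ.hom : φ.ring →+* F) ⟨u⁻¹, h2⟩ = 0 := h3
    rw [h3c] at h5
    simp [hm.ne'] at h5
    exact h4 h5

/-- Paths from the generic point to any point of the étale locus exist. -/
theorem exists_path [IsAlgClosed K] [IsAlgClosed F] (p : ℕ) [Fact p.Prime] [CharP K p]
    (hm : 0 < m) (hmn : m < n) (hcop : n.Coprime m) (hp : p ∣ n ∨ p ∣ n - m)
    (δ : ℙ F (Fin 3 → F)) (hδ : IsEtaleOver (trinomialCurve K n m) δ) :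
    Nonempty (Path (trinomialCurve K n m) δ) := by
  classical
  have hInf : Infinite K := IsAlgClosed.instInfinite
  rw [IsEtaleOver, totalDegree_trinomialCurve hm hmn] at hδ
  induction δ with | h c hc =>
  -- The remaining line `z = 0` meets the curve only in `(0 : 1 : 0)` and is not in the étale locus.
  have hc' : c 1 ≠ 0 ∨ c 0 ≠ 0 := by
    by_contra! h
    exact (transversal_at_infinity hm hmn hcop hc hδ h.1).2 h.2
  obtain ⟨φ, hφ, s, t, ht, hs, r, hr, hsc⟩ := exists_place_specializes_line (K := K) hc'
  have hsc' : (fun i => φ.hom (s i)) = r • c := funext hsc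
  have hc2 : (fun i => φ.hom (s i)) ≠ 0 := by
    rw [hsc']
    exact smul_ne_zero hr hc
  have hmk : Projectivization.mk F c hc = Projectivization.mk F (fun i => φ.hom (s i)) hc2 :=
    (Projectivization.mk_eq_mk_iff' F _ _ _ _).2 ⟨r⁻¹, by
      rw [hsc', smul_smul, inv_mul_cancel₀ hr, one_smul]⟩
  rw [hmk] at hδ ⊢
  have hgen := fun P : fiber (trinomialCurve K n m) (genericLine K) =>
    (mem_generic_fiber_iff hm hmn hcop).1 P.2
  choose u hu1 hu2 using hgen
  let e : fiber (trinomialCurve K n m) (genericLine K) →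
      fiber (trinomialCurve K n m) (Projectivization.mk F (fun i => φ.hom (s i)) hc2) :=
    fun P => ⟨specialPoint φ n m (u P), specialPoint_mem_fiber hmn hφ hs hc2 (hu2 P)⟩
  have hinj : Function.Injective e := by
    intro P Q h
    have := specialPoint_injOn hm hmn hcop hφ hs hc2 hδ (hu2 P) (hu2 Q) (congrArg Subtype.val h)
    exact Subtype.ext (by rw [hu1, hu1, this])
  have := (finite_fiber (K := K) hm hmn hcop (genericLine K)).to_subtype
  have := (finite_fiber (K := K) hm hmn hcop
    (Projectivization.mk F (fun i => φ.hom (s i)) hc2)).to_subtype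
  have hcard : Nat.card (fiber (trinomialCurve K n m) (genericLine K)) = Nat.card
      (fiber (trinomialCurve K n m) (Projectivization.mk F (fun i => φ.hom (s i)) hc2)) := by
    rw [Nat.card_coe_set_eq, Nat.card_coe_set_eq, hδ, ncard_generic_fiber p hm hmn hcop hp]
  have hbij := (Nat.bijective_iff_injective_and_card e).2 ⟨hinj, hcard⟩
  refine ⟨⟨φ, ⟨s, ?_, ?_, hc2⟩, Equiv.ofBijective e hbij, fun P => ?_⟩⟩
  · rw [genericLine, Projectivization.submodule_mk, Submodule.mem_span_singleton]
    exact ⟨t, funext fun i => (hs i).symm⟩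
  · rw [Projectivization.submodule_mk]
    exact Submodule.mem_span_singleton_self _
  · conv_lhs => rw [hu1 P]
    exact specializesTo_specialPoint hmn hφ (u P)

end Paths

/-! ### Arcs labelled by the fiber over `δ` -/

section FiberArcs

open Polynomial

universe u

variable {K : Type u} [Field K] {n m : ℕ}

theorem conj_curvePoint (σ : Gal K) (u : GeomField K) :
    conj σ (curvePoint n m u) = curvePoint n m (σ u) := by
  rw [conj, curvePoint, Projectivization.map_mk, curvePoint]
  congr 1
  ext i
  fin_cases i
  · exact map_pow σ u m
  · exact map_pow σ u n
  · exact map_one σ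

/-- The arcs through the point `(a₀, b₀)` of the chart, with their roots labelled by the fiber over
an arbitrary point of the étale locus. -/
theorem exists_arcs_fiber [IsAlgClosed K] {F : Type*} [Field F] [Algebra K F] [IsAlgClosed F]
    (p : ℕ) [Fact p.Prime] [CharP K p]
    (hm : 0 < m) (hmn : m < n) (hcop : n.Coprime m) (hp : p ∣ n ∨ p ∣ n - m)
    {δ : ℙ F (Fin 3 → F)} (hδ : IsEtaleOver (trinomialCurve K n m) δ)
    [Fintype (fiber (trinomialCurve K n m) δ)]
    {E C : Type*} [Field E] [NormedField C] [Algebra K E] [Algebra K C] [Algebra E C]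
    [IsScalarTower K E C] {π : E} (hC : IsValuedClosure K (F := C) π) (a₀ b₀ : K) :
    ∃ ρ : fiber (trinomialCurve K n m) δ → K,
      ∏ i, (X - Polynomial.C (ρ i)) =
        (X ^ n + Polynomial.C a₀ * X ^ m + Polynomial.C b₀ : K[X]) ∧
      ∀ a b : E, a ≠ 0 → b ≠ 0 → ‖algebraMap E C a - algebraMap K C a₀‖ < 1 →
        ‖algebraMap E C b - algebraMap K C b₀‖ < 1 →
          ∃ e : fiber (trinomialCurve K n m) δ → C,
            IsArc (monodromyGroup (trinomialCurve K n m) δ) ρ n m a b e := by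
  obtain ⟨γ⟩ := exists_path p hm hmn hcop hp δ hδ
  have hgen := fun P : fiber (trinomialCurve K n m) (genericLine K) =>
    (mem_generic_fiber_iff hm hmn hcop).1 P.2
  choose u hu1 hu2 using hgen
  have hcard : Fintype.card (fiber (trinomialCurve K n m) δ) = n := by
    rw [IsEtaleOver, totalDegree_trinomialCurve hm hmn] at hδ
    rw [← Nat.card_eq_fintype_card, Nat.card_coe_set_eq, hδ]
  refine exists_arcs p hC hm hmn hcop hp hcard (u := fun Q => u (γ.equiv.symm Q)) ?_ ?_ _ ?_ a₀ b₀
  · intro Q Q' h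
    have : γ.equiv.symm Q = γ.equiv.symm Q' := Subtype.ext (by
      rw [hu1 (γ.equiv.symm Q), hu1 (γ.equiv.symm Q')]
      exact congrArg _ h)
    exact γ.equiv.symm.injective this
  · exact fun Q => generic_equation_iff.1 (hu2 _)
  · intro σ
    refine ⟨γ.equiv.permCongr (galPerm (trinomialCurve K n m) σ), ?_, fun Q => ?_⟩
    -- The monodromy group is a join over all paths, so the elements obtained from a single path
    -- already belong to it.
    · refine Subgroup.mem_iSup_of_mem γ ?_
      exact ⟨galPerm (trinomialCurve K n m) σ, ⟨σ, rfl⟩, rfl⟩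
    · apply curvePoint_injective (k := GeomField K) hcop
      rw [← hu1, ← conj_curvePoint, ← hu1, Equiv.permCongr_apply, Equiv.symm_apply_apply]
      rfl

end FiberArcs

/-! ### Calculus of reductions to the residue field -/

section Reduction

variable {K E F : Type*} [Field K] [Field E] [NormedField F] [Algebra K F] [Algebra E F] {π : E}

/-- The element `x` of the valuation ring reduces to `c` in the residue field. -/
def ReducesTo {K F : Type*} [Field K] [NormedField F] [Algebra K F] (x : F) (c : K) : Prop :=
  ‖x - algebraMap K F c‖ < 1

namespace ReducesTo

theorem const (c : K) : ReducesTo (algebraMap K F c) c := by simp [ReducesTo]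

theorem zero_iff {x : F} : ReducesTo x (0 : K) ↔ ‖x‖ < 1 := by simp [ReducesTo]

theorem one : ReducesTo (1 : F) (1 : K) := by simp [ReducesTo]

variable {x y : F} {c d : K}

theorem norm_le_one (hF : IsValuedClosure K (F := F) π) (h : ReducesTo x c) : ‖x‖ ≤ 1 := by
  have := hF.isUltrametric
  rw [← sub_add_cancel x (algebraMap K F c)]
  exact (IsUltrametricDist.norm_add_le_max _ _).trans (max_le h.le (hF.norm_const_le c))

theorem unique (hF : IsValuedClosure K (F := F) π) (h : ReducesTo x c) (h' : ReducesTo x d) :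
    c = d := hF.eq_of_norm_sub_lt' h h'

theorem norm_eq_one (hF : IsValuedClosure K (F := F) π) (h : ReducesTo x c) (hc : c ≠ 0) :
    ‖x‖ = 1 := by
  refine le_antisymm (h.norm_le_one hF) (not_lt.1 fun hlt => hc ?_)
  exact unique hF h (zero_iff.2 hlt)

theorem add (hF : IsValuedClosure K (F := F) π) (h : ReducesTo x c) (h' : ReducesTo y d) :
    ReducesTo (x + y) (c + d) := by
  have := hF.isUltrametric
  have e : x + y - algebraMap K F (c + d) =
      (x - algebraMap K F c) + (y - algebraMap K F d) := by
    rw [map_add]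
    ring
  rw [ReducesTo, e]
  exact (IsUltrametricDist.norm_add_le_max _ _).trans_lt (max_lt h h')

theorem neg (h : ReducesTo x c) : ReducesTo (-x) (-c) := by
  rw [ReducesTo, map_neg, neg_sub_neg, norm_sub_rev]
  exact h

theorem sub (hF : IsValuedClosure K (F := F) π) (h : ReducesTo x c) (h' : ReducesTo y d) :
    ReducesTo (x - y) (c - d) := by
  rw [sub_eq_add_neg, sub_eq_add_neg]
  exact h.add hF h'.neg

theorem mul (hF : IsValuedClosure K (F := F) π) (h : ReducesTo x c) (h' : ReducesTo y d) :
    ReducesTo (x * y) (c * d) := by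
  have := hF.isUltrametric
  have e : x * y - algebraMap K F (c * d) =
      (x - algebraMap K F c) * y + algebraMap K F c * (y - algebraMap K F d) := by
    rw [map_mul]
    ring
  rw [ReducesTo, e]
  refine (IsUltrametricDist.norm_add_le_max _ _).trans_lt (max_lt ?_ ?_)
  · rw [norm_mul]
    exact mul_lt_one_of_nonneg_of_lt_one_left (norm_nonneg _) h (h'.norm_le_one hF)
  · rw [norm_mul]
    exact mul_lt_one_of_nonneg_of_lt_one_right (hF.norm_const_le _) (norm_nonneg _) h'

theorem pow (hF : IsValuedClosure K (F := F) π) (h : ReducesTo x c) (l : ℕ) :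
    ReducesTo (x ^ l) (c ^ l) := by
  induction l with
  | zero => simpa using one
  | succ l ih =>
    rw [pow_succ, pow_succ]
    exact ih.mul hF h

theorem sum (hF : IsValuedClosure K (F := F) π) {ι : Type*} (s : Finset ι) {f : ι → F}
    {g : ι → K} (h : ∀ i ∈ s, ReducesTo (f i) (g i)) :
    ReducesTo (∑ i ∈ s, f i) (∑ i ∈ s, g i) := by
  have := hF.isUltrametric
  rw [ReducesTo, map_sum, ← Finset.sum_sub_distrib]
  exact exists_norm_sum_lt_one h

/-- The reduction of a divided difference of `x ^ l`. -/
theorem geom_sum (hF : IsValuedClosure K (F := F) π) (h : ReducesTo x c) (h' : ReducesTo y c)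
    (l : ℕ) : ReducesTo (∑ i ∈ Finset.range l, x ^ i * y ^ (l - 1 - i)) (l * c ^ (l - 1)) := by
  have e : (l * c ^ (l - 1) : K) = ∑ i ∈ Finset.range l, c ^ i * c ^ (l - 1 - i) := by
    rw [Finset.sum_congr rfl (g := fun _ => c ^ (l - 1)), Finset.sum_const, Finset.card_range,
      nsmul_eq_mul]
    intro i hi
    rw [← pow_add, Nat.add_sub_cancel' (by have := Finset.mem_range.1 hi; omega)]
  rw [e]
  exact sum hF _ fun i _ => (h.pow hF i).mul hF (h'.pow hF _)

theorem gal [Algebra K E] [IsScalarTower K E F] (hF : IsValuedClosure K (F := F) π)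
    (h : ReducesTo x c) (τ : F ≃ₐ[E] F) : ReducesTo (τ x) c := by
  have e : τ (algebraMap K F c) = algebraMap K F c := by
    rw [IsScalarTower.algebraMap_apply K E F, τ.commutes]
  rw [ReducesTo, ← e, ← map_sub, hF.norm_gal]
  exact h

end ReducesTo

theorem gal_const [Algebra K E] [IsScalarTower K E F] (τ : F ≃ₐ[E] F) (c : K) :
    τ (algebraMap K F c) = algebraMap K F c := by
  rw [IsScalarTower.algebraMap_apply K E F, τ.commutes]

theorem IsValuedClosure.normal (hF : IsValuedClosure K (F := F) π) : Normal E F := by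
  have := hF.isAlgClosed
  have := hF.isAlgebraic
  exact normal_iff.2 fun x => ⟨Algebra.IsIntegral.isIntegral x, IsAlgClosed.splits _⟩

end Reduction

/-! ### Tame inertia -/

section Tame

variable {K E F : Type*} [Field K] [Field E] [NormedField F] [Algebra K F] [Algebra E F] {π : E}

/-- The Galois group acts on a root `z` of the uniformizer through roots of unity. -/
theorem exists_gal_eq_mul [IsAlgClosed K] {N : ℕ} (hN : (N : K) ≠ 0) {z : F} (hz0 : z ≠ 0)
    (hz : z ^ N = algebraMap E F π) (τ : F ≃ₐ[E] F) :
    ∃ c : K, c ^ N = 1 ∧ τ z = algebraMap K F c * z := by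
  have hN0 : N ≠ 0 := by
    rintro rfl
    simp at hN
  have : NeZero (N : K) := ⟨hN⟩
  have : NeZero N := ⟨hN0⟩
  obtain ⟨ω, hω⟩ := HasEnoughRootsOfUnity.exists_primitiveRoot K N
  have hω' := hω.map_of_injective (algebraMap K F).injective
  have h1 : (τ z / z) ^ N = 1 := by
    rw [div_pow, ← map_pow, hz, τ.commutes, div_self]
    rw [← hz]
    exact pow_ne_zero _ hz0
  obtain ⟨i, -, hi⟩ := hω'.eq_pow_of_pow_eq_one h1
  refine ⟨ω ^ i, by rw [← pow_mul, mul_comm, pow_mul, hω.pow_eq_one, one_pow], ?_⟩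
  rw [map_pow, hi, div_mul_cancel₀ _ hz0]

/-- All roots of unity of order prime to the characteristic arise from the Galois action on a root
of the uniformizer. -/
theorem IsValuedClosure.exists_gal_eq [Algebra K E] [IsScalarTower K E F]
    (hF : IsValuedClosure K (F := F) π) {N : ℕ}
    (hN : (N : K) ≠ 0) {z : F} (hz : z ^ N = algebraMap E F π) {ω : K} (hω : ω ^ N = 1) :
    ∃ τ : F ≃ₐ[E] F, τ z = algebraMap K F ω * z := by
  classical
  have := hF.normal
  have hN0 : 0 < N := Nat.pos_of_ne_zero (by
    rintro rfl
    simp at hN)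
  have hπ : π ≠ 0 := by
    rintro rfl
    simpa using hF.norm_uniformizer_pos
  have hNE : (N : E) ≠ 0 := by
    rw [← map_natCast (algebraMap K E)]
    exact (map_ne_zero _).2 hN
  -- The number of conjugates of `z` is a positive multiple of `N`, because they all have norm `‖π‖
  -- ^ (1 / N)`. So they exhaust the at most `N` roots.
  let S := (Polynomial.nthRoots N (algebraMap E F π)).toFinset.filter
    fun x => ∃ τ : F ≃ₐ[E] F, τ z = x
  have hsep : ∀ x : F, x ^ N = algebraMap E F π → IsSeparable E x := by
    intro x hx
    refine (Polynomial.separable_X_pow_sub_C π hNE hπ).of_dvd (minpoly.dvd _ _ ?_)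
    simp [hx]
  have hmem : ∀ x, x ∈ S ↔ x ^ N = algebraMap E F π ∧ ∃ τ : F ≃ₐ[E] F, τ z = x := by
    intro x
    rw [Finset.mem_filter, Multiset.mem_toFinset, Polynomial.mem_nthRoots hN0]
  have hzS : z ∈ S := (hmem z).2 ⟨hz, 1, rfl⟩
  have hdvd : N ∣ S.card := by
    refine hF.dvd_card (b := 1) ?_ (fun x hx => hsep x ((hmem x).1 hx).1) hN0 (by simp) ?_
    · intro σ x hx
      obtain ⟨h1, τ, h2⟩ := (hmem x).1 hx
      exact (hmem _).2 ⟨by rw [← map_pow, h1, σ.commutes], σ * τ, by rw [← h2]; rfl⟩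
    · intro x hx
      rw [← norm_pow, ((hmem x).1 hx).1, pow_one]
  have hle : (Polynomial.nthRoots N (algebraMap E F π)).toFinset.card ≤ S.card :=
    ((Multiset.toFinset_card_le _).trans (Polynomial.card_nthRoots _ _)).trans
      (Nat.le_of_dvd (Finset.card_pos.2 ⟨z, hzS⟩) hdvd)
  have heq : S = (Polynomial.nthRoots N (algebraMap E F π)).toFinset :=
    Finset.eq_of_subset_of_card_le (Finset.filter_subset _ _) hle
  have h1 : algebraMap K F ω * z ∈ S := by
    rw [heq, Multiset.mem_toFinset, Polynomial.mem_nthRoots hN0, mul_pow, ← map_pow, hω, map_one,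
      one_mul, hz]
  exact ((hmem _).1 h1).2

end Tame

/-! ### Recognition of affine groups -/

section AffineActions

variable {ι : Type*} {p k : ℕ} [Fact p.Prime] {H : Subgroup (Equiv.Perm ι)} {A : Set ι}

/-- A transitive group of affine maps that contains a homothety of generating ratio is the whole
affine group. -/
theorem actsAsAGL1_of_bijOn (hA : Preserves H A) {ε : ι → GaloisField p k}
    (hε : Set.BijOn ε A Set.univ)
    (haff : ∀ g ∈ H, ∃ u v, u ≠ 0 ∧ ∀ j ∈ A, ε (g j) = u * ε j + v)
    (htrans : ∀ x ∈ A, ∀ y ∈ A, ∃ g ∈ H, g x = y) {h : Equiv.Perm ι} (hh : h ∈ H)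
    {γ f : GaloisField p k} (hγ : ∀ u, u ≠ 0 → ∃ l : ℕ, γ ^ l = u)
    (hhε : ∀ j ∈ A, ε (h j) = γ * (ε j - f) + f) : ActsAsAGL1 p k H A := by
  have hpow : ∀ l : ℕ, ∀ j ∈ A, ε ((h ^ l) j) = γ ^ l * (ε j - f) + f := by
    intro l
    induction l with
    | zero => intro j _; simp
    | succ l ih =>
      intro j hj
      rw [pow_succ, Equiv.Perm.mul_apply, ih _ (hA h hh j hj), hhε j hj]
      ring
  let e : A ≃ GaloisField p k := Equiv.ofBijective (fun a : A => ε a)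
    ⟨fun a b hab => Subtype.ext (hε.injOn a.2 b.2 hab), fun t => by
      obtain ⟨a, ha, rfl⟩ := hε.surjOn (Set.mem_univ t)
      exact ⟨⟨a, ha⟩, rfl⟩⟩
  have he : ∀ a : A, e a = ε a := fun _ => rfl
  refine ⟨e, le_antisymm ?_ ?_⟩
  · rintro _ ⟨σ, ⟨g, hg, hgσ⟩, rfl⟩
    obtain ⟨u, v, hu, huv⟩ := haff g hg
    refine ⟨u, v, hu, fun x => ?_⟩
    change e (σ (e.symm x)) = _
    rw [he, ← hgσ, huv _ (e.symm x).2, ← he, e.apply_symm_apply]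
  · rintro τ ⟨a, b, ha, hτ⟩
    obtain ⟨j₀, hj₀, hf⟩ := hε.surjOn (Set.mem_univ f)
    obtain ⟨j₁, hj₁, hf'⟩ := hε.surjOn (Set.mem_univ (a * f + b))
    obtain ⟨g, hg, hgj⟩ := htrans j₀ hj₀ j₁ hj₁
    obtain ⟨u, v, hu, huv⟩ := haff g hg
    -- The element `g` already has the right value at the centre `f` of the homothety `h`; a power
    -- of `h` corrects the ratio without moving `f`.
    obtain ⟨l, hl⟩ := hγ (a / u) (div_ne_zero ha hu)
    have hv := huv j₀ hj₀
    rw [hgj, hf, hf'] at hv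
    refine ⟨e.permCongr.symm τ, ⟨g * h ^ l, H.mul_mem hg (H.pow_mem hh l), fun x => ?_⟩, ?_⟩
    · refine hε.injOn (hA _ (H.mul_mem hg (H.pow_mem hh l)) x x.2) (Subtype.coe_prop _) ?_
      have e1 : ε ((e.permCongr.symm τ x : A) : ι) = τ (ε x) := by
        rw [← he, ← he]
        simp
      rw [e1, hτ, Equiv.Perm.mul_apply, huv _ (hA _ (H.pow_mem hh l) x x.2), hpow l x x.2, hl]
      have e2 : u * (a / u * (ε x - f) + f) + v = a * (ε x - f) + (u * f + v) := by
        field_simp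
        ring
      rw [e2, ← hv]
      ring
    · ext x
      simp

theorem fixedPointAndOrbit_of_bijOn (hA : Preserves H A) {ε : ι → GaloisField p k} (hk : k ≠ 0)
    (hε : Set.BijOn ε A Set.univ) {h : Equiv.Perm ι} (hh : h ∈ H)
    {γ f : GaloisField p k} (hγ : ∀ u, u ≠ 0 → ∃ l : ℕ, γ ^ l = u)
    (hhε : ∀ j ∈ A, ε (h j) = γ * (ε j - f) + f) :
    FixedPointAndOrbit (p ^ k - 1) (Subgroup.zpowers h) A := by
  have hpow : ∀ l : ℕ, ∀ j ∈ A, ε ((h ^ l) j) = γ ^ l * (ε j - f) + f := by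
    intro l
    induction l with
    | zero => intro j _; simp
    | succ l ih =>
      intro j hj
      rw [pow_succ, Equiv.Perm.mul_apply, ih _ (hA h hh j hj), hhε j hj]
      ring
  obtain ⟨j₀, hj₀, hf⟩ := hε.surjOn (Set.mem_univ f)
  obtain ⟨j₁, hj₁, hf'⟩ := hε.surjOn (Set.mem_univ (f + 1))
  have hzH : Subgroup.zpowers h ≤ H := (Subgroup.zpowers_le).2 hh
  have hfix : ∀ g ∈ Subgroup.zpowers h, g j₀ = j₀ := by
    have : Subgroup.zpowers h ≤ MulAction.stabilizer (Equiv.Perm ι) j₀ := by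
      rw [Subgroup.zpowers_le, MulAction.mem_stabilizer_iff]
      refine hε.injOn (hA h hh j₀ hj₀) hj₀ ?_
      rw [hhε j₀ hj₀, hf]
      ring
    exact fun g hg => this hg
  have hne : j₁ ≠ j₀ := by
    rintro rfl
    rw [hf] at hf'
    simp at hf'
  have horb : MulAction.orbit (Subgroup.zpowers h) j₁ = A \ {j₀} := by
    ext x
    constructor
    · rintro ⟨⟨g, hg⟩, rfl⟩
      refine ⟨hA g (hzH hg) j₁ hj₁, fun hx => hne ?_⟩
      exact g.injective ((Set.mem_singleton_iff.1 hx).trans (hfix g hg).symm)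
    · rintro ⟨hx, hx0⟩
      have : ε x - f ≠ 0 := fun h0 => hx0 (hε.injOn hx hj₀ (by rw [hf, sub_eq_zero.1 h0]))
      obtain ⟨l, hl⟩ := hγ _ this
      refine ⟨⟨h ^ l, Subgroup.npow_mem_zpowers h l⟩, ?_⟩
      refine hε.injOn (hA _ (H.pow_mem hh l) j₁ hj₁) hx ?_
      rw [hpow l j₁ hj₁, hl, hf']
      ring
  refine ⟨j₀, j₁, ?_, ?_, ?_, ?_⟩
  · ext x
    constructor
    · rintro ⟨⟨g, hg⟩, rfl⟩
      exact hfix g hg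
    · rintro rfl
      exact MulAction.mem_orbit_self _
  · have hcard : A.ncard = p ^ k := by
      rw [← hε.injOn.ncard_image, hε.image_eq, Set.ncard_univ, GaloisField.card p k hk]
    rw [horb, Set.ncard_sdiff_singleton_of_mem hj₀, hcard]
  · rw [horb]
    simp
  · rw [horb, Set.singleton_union, Set.insert_sdiff_singleton, Set.insert_eq_of_mem hj₀]

/-- The iterate of order `p ^ k` of an affine map over the field with `p ^ k` elements has a fixed
point and the same ratio. -/
theorem exists_iterate_affine (hk : k ≠ 0) {ε : ι → GaloisField p k} {h : Equiv.Perm ι}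
    (hh : ∀ j ∈ A, h j ∈ A) {γ s : GaloisField p k} (hhε : ∀ j ∈ A, ε (h j) = γ * ε j + s) :
    ∃ f, ∀ j ∈ A, ε ((h ^ p ^ k) j) = γ * (ε j - f) + f := by
  have : Fintype (GaloisField p k) := Fintype.ofFinite _
  have hc : Fintype.card (GaloisField p k) = p ^ k := by
    rw [← Nat.card_eq_fintype_card, GaloisField.card p k hk]
  -- For a generator `γ` of the multiplicative group this happens only if `p ^ k = 2`. The map is
  -- then a translation, perhaps without fixed point, and its iterate is the identity. In the other
  -- case the fixed point is `s / (1 - γ)`, and `γ ^ p ^ k = γ` keeps the ratio.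
  by_cases hγ : γ = 1
  · refine ⟨0, fun j hj => ?_⟩
    have hpow : ∀ l : ℕ, ∀ j ∈ A, ε ((h ^ l) j) = ε j + l * s := by
      intro l
      induction l with
      | zero => intro j _; simp
      | succ l ih =>
        intro j hj
        rw [pow_succ, Equiv.Perm.mul_apply, ih _ (hh j hj), hhε j hj, hγ]
        push_cast
        ring
    have h0 : ((p ^ k : ℕ) : GaloisField p k) = 0 := by
      rw [CharP.cast_eq_zero_iff _ p]
      exact dvd_pow_self p hk
    rw [hpow _ j hj, h0, hγ]
    ring
  · have hγ' : 1 - γ ≠ 0 := sub_ne_zero.2 (Ne.symm hγ)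
    refine ⟨s / (1 - γ), fun j hj => ?_⟩
    have hpow : ∀ l : ℕ, ∀ j ∈ A,
        ε ((h ^ l) j) = γ ^ l * (ε j - s / (1 - γ)) + s / (1 - γ) := by
      intro l
      induction l with
      | zero => intro j _; simp
      | succ l ih =>
        intro j hj
        rw [pow_succ, Equiv.Perm.mul_apply, ih _ (hh j hj), hhε j hj]
        field_simp
        ring
    rw [hpow _ j hj, ← hc, FiniteField.pow_card]

/-- The fixed points of the `p ^ k`-power map in an algebraically closed field are the elements of
the field with `p ^ k` elements. -/
theorem exists_galoisField_hom (K : Type*) [Field K] [IsAlgClosed K] [CharP K p] (hk : k ≠ 0) :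
    ∃ i : GaloisField p k →+* K, ∀ t : K, t ^ p ^ k = t → ∃ s, i s = t := by
  let _ : Algebra (ZMod p) K := ZMod.algebra K p
  have : Fintype (GaloisField p k) := Fintype.ofFinite _
  have hc : Fintype.card (GaloisField p k) = p ^ k := by
    rw [← Nat.card_eq_fintype_card, GaloisField.card p k hk]
  let i : GaloisField p k →+* K :=
    ((IsAlgClosed.lift : GaloisField p k →ₐ[ZMod p] K) : GaloisField p k →+* K)
  classical
  have hq : 1 < p ^ k := Nat.one_lt_pow hk (Fact.out : p.Prime).one_lt
  have hne := FiniteField.X_pow_card_sub_X_ne_zero K hq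
  refine ⟨i, fun t ht => ?_⟩
  have hsub : Finset.univ.image i ⊆
      (Polynomial.X ^ p ^ k - Polynomial.X : Polynomial K).roots.toFinset := by
    intro x hx
    obtain ⟨s, -, rfl⟩ := Finset.mem_image.1 hx
    rw [Multiset.mem_toFinset, Polynomial.mem_roots hne]
    have h1 : (i s) ^ p ^ k = i s := by rw [← map_pow, ← hc, FiniteField.pow_card]
    simp [h1]
  have heq := Finset.eq_of_subset_of_card_le hsub (by
    rw [Finset.card_image_of_injective _ i.injective, Finset.card_univ, hc]
    refine (Multiset.toFinset_card_le _).trans ((Polynomial.card_roots' _).trans ?_)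
    rw [FiniteField.X_pow_card_sub_X_natDegree_eq K hq])
  have ht' : t ∈ Finset.univ.image i := by
    rw [heq, Multiset.mem_toFinset, Polynomial.mem_roots hne]
    simp [ht]
  obtain ⟨s, -, hs⟩ := Finset.mem_image.1 ht'
  exact ⟨s, hs⟩

/-- Recognition of the affine group, and of an element with one fixed point and one other orbit,
through a coordinate with values in an algebraically closed field. -/
theorem actsAsAGL1_of_coordinate {K : Type*} [Field K] [IsAlgClosed K] [CharP K p] (hk : k ≠ 0)
    (hA : Preserves H A) (hcard : A.ncard = p ^ k) {ε : ι → K} (hinj : Set.InjOn ε A)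
    (hε : ∀ j ∈ A, ε j ^ p ^ k = ε j)
    (haff : ∀ g ∈ H, ∃ u v, u ^ (p ^ k - 1) = 1 ∧ ∀ j ∈ A, ε (g j) = u * ε j + v)
    (htrans : ∀ x ∈ A, ∀ y ∈ A, ∃ g ∈ H, g x = y) {h : Equiv.Perm ι} (hh : h ∈ H)
    {γ s : K} (hγ : IsPrimitiveRoot γ (p ^ k - 1)) (hhε : ∀ j ∈ A, ε (h j) = γ * ε j + s) :
    ActsAsAGL1 p k H A ∧ FixedPointAndOrbit (p ^ k - 1) (Subgroup.zpowers (h ^ p ^ k)) A := by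
  classical
  have : Fintype (GaloisField p k) := Fintype.ofFinite _
  have hc : Fintype.card (GaloisField p k) = p ^ k := by
    rw [← Nat.card_eq_fintype_card, GaloisField.card p k hk]
  have hq : 1 < p ^ k := Nat.one_lt_pow hk (Fact.out : p.Prime).one_lt
  obtain ⟨i, hi⟩ := exists_galoisField_hom (p := p) K hk
  have hu : ∀ u : K, u ^ (p ^ k - 1) = 1 → u ^ p ^ k = u := by
    intro u hu
    rw [← Nat.sub_add_cancel hq.le, pow_succ, hu, one_mul]
  -- The map `r` inverts the embedding of the finite field on its image; its values elsewhere play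
  -- no role.
  have hsec : ∃ r : K → GaloisField p k, ∀ t, t ^ p ^ k = t → i (r t) = t := by
    choose! r hr using hi
    exact ⟨r, hr⟩
  obtain ⟨r, hr⟩ := hsec
  have hAne : A.Nonempty := Set.nonempty_of_ncard_ne_zero (by omega)
  obtain ⟨j₀, hj₀⟩ := hAne
  have hε' : ∀ j ∈ A, i (r (ε j)) = ε j := fun j hj => hr _ (hε j hj)
  have hinj' : Set.InjOn (fun j => r (ε j)) A := fun x hx y hy hxy =>
    hinj hx hy (by rw [← hε' x hx, ← hε' y hy]; exact congrArg i hxy)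
  have hbij : Set.BijOn (fun j => r (ε j)) A Set.univ := by
    refine ⟨fun _ _ => Set.mem_univ _, hinj', ?_⟩
    rw [Set.SurjOn, Set.univ_subset_iff]
    refine Set.eq_of_subset_of_ncard_le (Set.subset_univ _) ?_ (Set.toFinite _)
    rw [hinj'.ncard_image, hcard, Set.ncard_univ, GaloisField.card p k hk]
  have key : ∀ g ∈ H, ∀ u v : K, u ^ (p ^ k - 1) = 1 → (∀ j ∈ A, ε (g j) = u * ε j + v) →
      ∀ j ∈ A, r (ε (g j)) = r u * r (ε j) + r v := by
    intro g hg u v h1 h2 j hj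
    -- The translation part is determined by the image of one point, so it too lies in the finite
    -- field.
    have hv : v ^ p ^ k = v := by
      have e : v = ε (g j₀) - u * ε j₀ := by rw [h2 j₀ hj₀]; ring
      rw [e, sub_pow_char_pow, mul_pow, hu u h1, hε _ hj₀, hε _ (hA g hg _ hj₀)]
    apply i.injective
    rw [map_add, map_mul, hr _ (hu u h1), hr _ hv, hε' j hj, hε' _ (hA g hg j hj), h2 j hj]
  have hγr := (hγ : IsPrimitiveRoot γ (p ^ k - 1))
  rw [← hr γ (hu γ hγ.pow_eq_one)] at hγr
  have hγ' : IsPrimitiveRoot (r γ) (p ^ k - 1) := hγr.of_map_of_injective i.injective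
  have : NeZero (p ^ k - 1) := ⟨by omega⟩
  have hgen : ∀ u : GaloisField p k, u ≠ 0 → ∃ l : ℕ, r γ ^ l = u := by
    intro u hu
    obtain ⟨l, -, hl⟩ := hγ'.eq_pow_of_pow_eq_one (ξ := u) (by
      rw [← hc]
      exact FiniteField.pow_card_sub_one_eq_one u hu)
    exact ⟨l, hl⟩
  obtain ⟨f, hf⟩ := exists_iterate_affine (A := A) hk (hA h hh) (ε := fun j => r (ε j))
    (key h hh γ s hγ.pow_eq_one hhε)
  have hhq : h ^ p ^ k ∈ H := H.pow_mem hh _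
  refine ⟨actsAsAGL1_of_bijOn hA hbij ?_ htrans hhq hgen hf,
    fixedPointAndOrbit_of_bijOn hA hk hbij hhq hgen hf⟩
  intro g hg
  obtain ⟨u, v, h1, h2⟩ := haff g hg
  refine ⟨r u, r v, fun h0 => ?_, key g hg u v h1 h2⟩
  have := hr u (hu u h1)
  rw [h0, map_zero] at this
  rw [← this, zero_pow (by omega)] at h1
  exact zero_ne_one h1

end AffineActions

/-! ### The local monodromy group of an arc -/

section ArcGroup

variable {ι : Type*}

/-- The elements of `G` that realize the Galois action on the points `e` of an arc. -/
def arcGroup (E : Type*) {F : Type*} [Field E] [Field F] [Algebra E F]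
    (G : Subgroup (Equiv.Perm ι)) (e : ι → F) : Subgroup (Equiv.Perm ι) where
  carrier := {g | g ∈ G ∧ ∃ τ : F ≃ₐ[E] F, ∀ i, e (g i) = τ (e i)}
  one_mem' := ⟨G.one_mem, 1, fun _ => rfl⟩
  mul_mem' := by
    rintro g g' ⟨hg, τ, hτ⟩ ⟨hg', τ', hτ'⟩
    exact ⟨G.mul_mem hg hg', τ * τ', fun i => by
      rw [Equiv.Perm.mul_apply, hτ, hτ', AlgEquiv.mul_apply]⟩
  inv_mem' := by
    rintro g ⟨hg, τ, hτ⟩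
    refine ⟨G.inv_mem hg, τ⁻¹, fun i => ?_⟩
    have h : e i = τ (e (g⁻¹ i)) := by
      rw [← hτ]
      exact congrArg e (g.apply_symm_apply i).symm
    rw [h]
    exact (τ.symm_apply_apply _).symm

theorem arcGroup_le {E F : Type*} [Field E] [Field F] [Algebra E F]
    (G : Subgroup (Equiv.Perm ι)) (e : ι → F) : arcGroup E G e ≤ G := fun _ hg => hg.1

variable {K E F : Type*} [Field K] [Field E] [NormedField F]
  [Algebra K F] [Algebra E F] {π : E} {G : Subgroup (Equiv.Perm ι)}
  {ρ : ι → K} {n m : ℕ} {a b : E} {e : ι → F}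

namespace IsArc

theorem reducesTo (he : IsArc G ρ n m a b e) {ζ : K} {i : ι} (hi : ρ i = ζ) :
    ReducesTo (e i) ζ := hi ▸ he.near i

theorem exists_mem_arcGroup (he : IsArc G ρ n m a b e) (τ : F ≃ₐ[E] F) :
    ∃ g ∈ arcGroup E G e, ∀ i, e (g i) = τ (e i) := by
  obtain ⟨g, hg, h⟩ := he.gal τ
  exact ⟨g, ⟨hg, τ, h⟩, h⟩

variable [Algebra K E] [IsScalarTower K E F]

/-- Galois elements preserve the norm and fix the constants, hence do not change reductions. -/
theorem preserves_cluster (he : IsArc G ρ n m a b e) (hF : IsValuedClosure K (F := F) π) (ζ : K) :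
    Preserves (arcGroup E G e) {i | ρ i = ζ} := by
  rintro g ⟨-, τ, hτ⟩ i rfl
  have h1 : ReducesTo (e (g i)) (ρ i) := by
    rw [hτ]
    exact (he.reducesTo rfl).gal hF τ
  exact (he.reducesTo rfl).unique hF h1

theorem dvd_ncard_orbit [Finite ι] (he : IsArc G ρ n m a b e) (hF : IsValuedClosure K (F := F) π)
    {i : ι} (κ : K) {r s : ℕ} (hr : 0 < r) (hrs : r.Coprime s)
    (h : ‖e i - algebraMap K F κ‖ ^ r = ‖algebraMap E F π‖ ^ s) :
    r ∣ (MulAction.orbit (arcGroup E G e) i).ncard := by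
  classical
  have : Fintype ι := Fintype.ofFinite ι
  let S := (Set.toFinite (MulAction.orbit (arcGroup E G e) i)).toFinset.image
    fun j => e j - algebraMap K F κ
  have hinj : Function.Injective fun j => e j - algebraMap K F κ := fun x y hxy =>
    he.injective (sub_left_injective hxy)
  have hcard : (MulAction.orbit (arcGroup E G e) i).ncard = S.card := by
    rw [Finset.card_image_of_injective _ hinj, Set.ncard_eq_toFinset_card]
  have hmem : ∀ x, x ∈ S ↔ ∃ j ∈ MulAction.orbit (arcGroup E G e) i,
      e j - algebraMap K F κ = x := by
    intro x
    simp [S]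
  rw [hcard]
  refine hF.dvd_card ?_ ?_ hr hrs ?_
  · intro σ x hx
    obtain ⟨j, ⟨g, rfl⟩, rfl⟩ := (hmem x).1 hx
    obtain ⟨g', hg', hσ⟩ := he.exists_mem_arcGroup σ
    refine (hmem _).2 ⟨g' ((g : Equiv.Perm ι) i), ⟨⟨g', hg'⟩ * g, rfl⟩, ?_⟩
    rw [hσ, map_sub, gal_const]
    rfl
  · intro x hx
    obtain ⟨j, -, rfl⟩ := (hmem x).1 hx
    rw [IsScalarTower.algebraMap_apply K E F]
    exact Field.isSeparable_sub (he.separable j) (isSeparable_algebraMap _)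
  · intro x hx
    obtain ⟨j, ⟨⟨g, -, τ, hτ⟩, rfl⟩, rfl⟩ := (hmem x).1 hx
    have : e (g i) - algebraMap K F κ = τ (e i - algebraMap K F κ) := by
      rw [hτ, map_sub, gal_const]
    change ‖e (g i) - algebraMap K F κ‖ ^ r = _
    rw [this, hF.norm_gal, h]

/-- A cluster of roots at a distance from its centre that forces total ramification is an orbit of
the Galois group. -/
theorem orbit_eq_cluster [Finite ι] (he : IsArc G ρ n m a b e)
    (hF : IsValuedClosure K (F := F) π) {ζ : K} {r s : ℕ} (hr : 0 < r) (hrs : r.Coprime s)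
    {S : Set ι} (hS : Preserves (arcGroup E G e) S) (hcard : S.ncard = r)
    (h : ∀ i ∈ S, ‖e i - algebraMap K F ζ‖ ^ r = ‖algebraMap E F π‖ ^ s) :
    ActsTransitively (arcGroup E G e) S := by
  intro i hi
  have hsub : MulAction.orbit (arcGroup E G e) i ⊆ S := by
    rintro _ ⟨⟨g, hg⟩, rfl⟩
    exact hS g hg i hi
  refine Set.eq_of_subset_of_ncard_le hsub ?_ (Set.toFinite _)
  rw [hcard]
  refine Nat.le_of_dvd ?_ (he.dvd_ncard_orbit hF ζ hr hrs (h i hi))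
  rw [Set.ncard_pos (Set.toFinite _)]
  exact ⟨i, MulAction.mem_orbit_self i⟩

end IsArc

end ArcGroup

/-! ### Affine action on a cluster of `p ^ k` roots -/

section AffineClusters

variable {ι : Type*} {K E F : Type*} [Field K] [IsAlgClosed K] [Field E] [NormedField F]
  [Algebra K F] [Algebra E F] [Algebra K E] [IsScalarTower K E F]
  {π : E} {G : Subgroup (Equiv.Perm ι)}
  {ρ : ι → K} {n m : ℕ} {a b : E} {e : ι → F} {p k : ℕ} [Fact p.Prime] [CharP K p]

/-- The differences of the roots in a cluster satisfy, to leading order, an additive polynomial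
equation `y ^ q = π * y`. When the cluster is a single Galois orbit, the Galois group acts on it
through the affine group. -/
theorem IsArc.actsAsAGL1_cluster (he : IsArc G ρ n m a b e) (hF : IsValuedClosure K (F := F) π)
    (hk : k ≠ 0) {ζ : K} (hcard : {i | ρ i = ζ}.ncard = p ^ k) {δ δ' : K} (hδ : δ ≠ 0)
    (hδ' : δ' ≠ 0)
    (hrel : ∀ i j, ρ i = ζ → ρ j = ζ → ∃ D D' : F, ReducesTo D δ ∧ ReducesTo D' δ' ∧
      (e i - e j) ^ p ^ k * D = algebraMap E F π * (e i - e j) * D')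
    (htrans : ActsTransitively (arcGroup E G e) {i | ρ i = ζ})
    {r : ℕ} (hr : 0 < r) (hrK : ((r * (p ^ k - 1) : ℕ) : K) ≠ 0) {z : F}
    (hz : z ^ (r * (p ^ k - 1)) = algebraMap E F π) {ω : K}
    (hω : IsPrimitiveRoot ω (r * (p ^ k - 1))) {τ : F ≃ₐ[E] F} (hτ : τ z = algebraMap K F ω * z)
    {h : Equiv.Perm ι} (hh : h ∈ arcGroup E G e) (hhτ : ∀ i, e (h i) = τ (e i)) :
    ActsAsAGL1 p k (arcGroup E G e) {i | ρ i = ζ} ∧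
      FixedPointAndOrbit (p ^ k - 1) (Subgroup.zpowers (h ^ p ^ k)) {i | ρ i = ζ} := by
  have := hF.isUltrametric
  have hq : 1 < p ^ k := Nat.one_lt_pow hk (Fact.out : p.Prime).one_lt
  have hπ : algebraMap E F π ≠ 0 := norm_pos_iff.1 hF.norm_uniformizer_pos
  have hN : 0 < r * (p ^ k - 1) := Nat.mul_pos hr (by omega)
  have hz0 : z ≠ 0 := by
    rintro rfl
    rw [zero_pow hN.ne'] at hz
    exact hπ hz.symm
  -- With this `κ` the scale `ϖ = κ * z ^ r` solves the leading-order equation `δ * y ^ q = δ' * π *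
  -- y` exactly, so that the rescaled differences reduce to solutions of `t ^ q = t`.
  obtain ⟨κ, hκ⟩ := IsAlgClosed.exists_pow_nat_eq (δ' / δ) (n := p ^ k - 1) (by omega)
  have hκ0 : κ ≠ 0 := by
    rintro rfl
    rw [zero_pow (by omega)] at hκ
    exact div_ne_zero hδ' hδ hκ.symm
  have hκF : algebraMap K F κ ≠ 0 := (map_ne_zero _).2 hκ0
  set ϖ : F := algebraMap K F κ * z ^ r with hϖ
  have hϖ0 : ϖ ≠ 0 := mul_ne_zero hκF (pow_ne_zero _ hz0)
  have hϖq : algebraMap K F δ * ϖ ^ p ^ k = algebraMap K F δ' * algebraMap E F π * ϖ := by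
    have e1 : p ^ k = p ^ k - 1 + 1 := by omega
    have e2 : algebraMap K F δ * algebraMap K F κ ^ (p ^ k - 1) = algebraMap K F δ' := by
      rw [← map_pow, hκ, ← map_mul, mul_div_cancel₀ _ hδ]
    have e3 : ϖ ^ (p ^ k - 1) = algebraMap K F κ ^ (p ^ k - 1) * algebraMap E F π := by
      rw [hϖ, mul_pow, ← pow_mul, hz]
    rw [e1, pow_succ, e3, ← e2]
    ring
  have hy : ∀ i j, ρ i = ζ → ρ j = ζ → ∃ D D' : F, ReducesTo D δ ∧ ReducesTo D' δ' ∧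
      ((e i - e j) / ϖ) ^ p ^ k * D * algebraMap K F δ' =
        ((e i - e j) / ϖ) * D' * algebraMap K F δ := by
    intro i j hi hj
    obtain ⟨D, D', hD, hD', h1⟩ := hrel i j hi hj
    refine ⟨D, D', hD, hD', ?_⟩
    have h2 : algebraMap K F δ' * algebraMap E F π ≠ 0 :=
      mul_ne_zero ((map_ne_zero _).2 hδ') hπ
    rw [div_pow]
    have h3 : ϖ ^ p ^ k ≠ 0 := pow_ne_zero _ hϖ0
    field_simp
    linear_combination algebraMap K F δ' * ϖ * h1 - (e i - e j) * D' * hϖq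
  have hnorm : ∀ i j, ρ i = ζ → ρ j = ζ → i ≠ j → ‖(e i - e j) / ϖ‖ = 1 := by
    intro i j hi hj hij
    obtain ⟨D, D', hD, hD', h1⟩ := hy i j hi hj
    have h2 : (e i - e j) / ϖ ≠ 0 :=
      div_ne_zero (sub_ne_zero.2 fun h => hij (he.injective h)) hϖ0
    have h3 := congrArg norm h1
    rw [norm_mul, norm_mul, norm_mul, norm_mul, norm_pow, hD.norm_eq_one hF hδ,
      hD'.norm_eq_one hF hδ', hF.norm_const _ hδ, hF.norm_const _ hδ', mul_one, mul_one, mul_one,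
      mul_one] at h3
    have e1 : p ^ k = p ^ k - 1 + 1 := by omega
    rw [e1, pow_succ] at h3
    have h4 := mul_right_cancel₀ (norm_ne_zero_iff.2 h2) (h3.trans (one_mul _).symm)
    exact (pow_eq_one_iff_of_nonneg (norm_nonneg _) (by omega)).1 h4
  obtain ⟨j₀, hj₀⟩ : {i | ρ i = ζ}.Nonempty := Set.nonempty_of_ncard_ne_zero (by omega)
  have hle : ∀ i, ρ i = ζ → ‖(e i - e j₀) / ϖ‖ ≤ 1 := by
    intro i hi
    by_cases hij : i = j₀
    · simp [hij]
    · exact (hnorm i j₀ hi hj₀ hij).le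
  have hres : ∀ i, ∃ c : K, ρ i = ζ → ReducesTo ((e i - e j₀) / ϖ) c := by
    intro i
    by_cases hi : ρ i = ζ
    · obtain ⟨c, hc⟩ := hF.exists_residue _ (hle i hi)
      exact ⟨c, fun _ => hc⟩
    · exact ⟨0, fun h => absurd h hi⟩
  choose ε hε using hres
  -- An automorphism multiplies `ϖ` by the constant `c ^ r` and preserves residues, so it is affine
  -- in the coordinate; the translation part records where the base point `j₀` goes.
  have hgal : ∀ (g : Equiv.Perm ι) (σ : F ≃ₐ[E] F) (c : K), (∀ i, e (g i) = σ (e i)) →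
      σ z = algebraMap K F c * z → g ∈ arcGroup E G e →
      ∀ i ∈ {i | ρ i = ζ}, ε (g i) = c ^ r * ε i + ε (g j₀) := by
    intro g σ c hgσ hσz hg i hi
    have hgi := he.preserves_cluster hF ζ g hg i hi
    have hgj := he.preserves_cluster hF ζ g hg j₀ hj₀
    refine (hε _ hgi).unique hF ?_
    have hcz : algebraMap K F c ≠ 0 := by
      intro h0
      rw [h0, zero_mul, map_eq_zero] at hσz
      exact hz0 hσz
    have e1 : σ ϖ = algebraMap K F c ^ r * ϖ := by
      rw [hϖ, map_mul, gal_const, map_pow, hσz]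
      ring
    have e2 : (e (g i) - e j₀) / ϖ = algebraMap K F (c ^ r) * σ ((e i - e j₀) / ϖ) +
        (e (g j₀) - e j₀) / ϖ := by
      rw [map_div₀, e1, map_sub, ← hgσ, ← hgσ, map_pow]
      field_simp
      ring
    rw [e2]
    exact ((ReducesTo.const _).mul hF ((hε i hi).gal hF σ)).add hF (hε _ hgj)
  refine actsAsAGL1_of_coordinate (K := K) (ε := ε) (γ := ω ^ r) (s := ε (h j₀)) hk
    (he.preserves_cluster hF ζ) hcard ?_ ?_ ?_ ?_ hh (hω.pow hN rfl) (hgal h τ ω hhτ hτ hh)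
  · intro i hi j hj hij
    by_contra hne
    have h1 := (hε i hi).sub hF (hε j hj)
    rw [hij, sub_self, ReducesTo.zero_iff, ← sub_div, sub_sub_sub_cancel_right,
      hnorm i j hi hj hne] at h1
    exact lt_irrefl _ h1
  · intro i hi
    obtain ⟨D, D', hD, hD', h1⟩ := hy i j₀ hi hj₀
    have h2 := (((hε i hi).pow hF (p ^ k)).mul hF hD).mul hF (ReducesTo.const δ')
    rw [h1] at h2
    have h3 := h2.unique hF (((hε i hi).mul hF hD').mul hF (ReducesTo.const δ))
    have h4 : (ε i ^ p ^ k - ε i) * (δ * δ') = 0 := by linear_combination h3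
    exact sub_eq_zero.1 ((mul_eq_zero.1 h4).resolve_right (mul_ne_zero hδ hδ'))
  · rintro g hg
    obtain ⟨-, σ, hσ⟩ := id hg
    obtain ⟨c, hc, hcz⟩ := exists_gal_eq_mul hrK hz0 hz σ
    exact ⟨c ^ r, ε (g j₀), by rw [← pow_mul, hc], hgal g σ c hσ hcz hg⟩
  · intro x hx y hy
    rw [← htrans x hx] at hy
    obtain ⟨⟨g, hg⟩, hgx⟩ := hy
    exact ⟨g, hg, hgx⟩

end AffineClusters

/-! ### Roots of unity as centres of clusters -/

section RootsOfUnity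

theorem exists_enumeration_rootsOfUnity (K : Type*) [Field K] [IsAlgClosed K] {d : ℕ}
    (hd : (d : K) ≠ 0) :
    ∃ η : Fin d → K, Function.Injective η ∧ ∀ x, x ^ d = 1 ↔ ∃ i, η i = x := by
  have : NeZero (d : K) := ⟨hd⟩
  have : NeZero d := ⟨by rintro rfl; simp at hd⟩
  obtain ⟨ω, hω⟩ := HasEnoughRootsOfUnity.exists_primitiveRoot K d
  refine ⟨fun i => ω ^ (i : ℕ), fun i j hij => Fin.ext (hω.pow_inj i.2 j.2 hij), fun x => ⟨?_, ?_⟩⟩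
  · intro hx
    obtain ⟨i, hi, h⟩ := hω.eq_pow_of_pow_eq_one hx
    exact ⟨⟨i, hi⟩, h⟩
  · rintro ⟨i, rfl⟩
    rw [← pow_mul, mul_comm, pow_mul, hω.pow_eq_one, one_pow]

/-- This separates the centres: an arc bent so as to keep one `η i` as a root, a condition on `η i ^
m`, is in general position at all the others. -/
theorem eq_of_pow_eq_pow_of_coprime {K : Type*} [Field K] {x y : K} {d m : ℕ} (hdm : d.Coprime m)
    (hx : x ^ d = 1) (hy : y ^ d = 1) (h : x ^ m = y ^ m) : x = y := by
  by_cases hy0 : y = 0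
  · subst hy0
    rcases Nat.eq_zero_or_pos d with rfl | hd
    · rw [Nat.coprime_zero_left] at hdm
      simpa [hdm] using h
    · rw [zero_pow hd.ne'] at hy
      exact absurd hy zero_ne_one
  · have h1 : (x / y) ^ d = 1 := by rw [div_pow, hx, hy, div_one]
    have h2 : (x / y) ^ m = 1 := by rw [div_pow, h, div_self (pow_ne_zero _ hy0)]
    have h3 : (x / y) ^ d.gcd m = 1 := pow_gcd_eq_one.2 ⟨h1, h2⟩
    rw [hdm.gcd_eq_one, pow_one] at h3
    exact (div_eq_one_iff_eq hy0).1 h3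

end RootsOfUnity

/-! ### Sizes of the clusters -/

section ClusterSizes

open Polynomial

variable {K ι : Type*} [Field K] [Fintype ι] {ρ : ι → K}

theorem ncard_eq_count_roots [DecidableEq K] {f : K[X]} (h : ∏ i, (X - C (ρ i)) = f) (ζ : K) :
    {i | ρ i = ζ}.ncard = Multiset.count ζ f.roots := by
  have h1 : f.roots = Finset.univ.val.map ρ := by
    rw [← h]
    exact roots_multiset_prod_X_sub_C (Finset.univ.val.map ρ) |> fun e => by
      simpa [Multiset.map_map, Function.comp_def] using e
  rw [h1, Multiset.count_map, Set.ncard_eq_toFinset_card']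
  simp only [Set.toFinset_ofPred, Finset.card, Finset.filter_val]
  congr 1
  exact Multiset.filter_congr fun x _ => eq_comm

theorem count_roots_X_pow_sub_one [DecidableEq K] {d : ℕ} (hd : (d : K) ≠ 0) {ζ : K} (hζ : ζ ^ d = 1) :
    Multiset.count ζ (X ^ d - 1 : K[X]).roots = 1 := by
  have hd0 : d ≠ 0 := by
    rintro rfl
    simp at hd
  refine Multiset.count_eq_one_of_mem (nodup_roots (X_pow_sub_one_separable_iff.2 hd)) ?_
  have hne : (X ^ d - 1 : K[X]) ≠ 0 := X_pow_sub_C_ne_zero (Nat.pos_of_ne_zero hd0) 1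
  rw [mem_roots hne]
  simp [hζ]

theorem ncard_cluster_pow {q d : ℕ} (hd : (d : K) ≠ 0)
    {m : ℕ} (h : ∏ i, (X - C (ρ i)) = (X ^ m * (X ^ d - 1) ^ q : K[X])) {ζ : K}
    (hζ : ζ ^ d = 1) : {i | ρ i = ζ}.ncard = q := by
  classical
  have hd0 : d ≠ 0 := by
    rintro rfl
    simp at hd
  have hne : (X ^ d - 1 : K[X]) ≠ 0 := X_pow_sub_C_ne_zero (Nat.pos_of_ne_zero hd0) 1
  have hζ0 : ζ ≠ 0 := by
    rintro rfl
    rw [zero_pow hd0] at hζ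
    exact zero_ne_one hζ
  rw [ncard_eq_count_roots h, roots_mul (mul_ne_zero (pow_ne_zero _ X_ne_zero)
    (pow_ne_zero _ hne)), roots_pow, roots_pow, roots_X, Multiset.count_add, Multiset.count_nsmul,
    Multiset.count_nsmul, count_roots_X_pow_sub_one hd hζ, Multiset.count_singleton, if_neg hζ0]
  ring

theorem ncard_cluster_zero {q d : ℕ} (hd : d ≠ 0)
    {m : ℕ} (h : ∏ i, (X - C (ρ i)) = (X ^ m * (X ^ d - 1) ^ q : K[X])) :
    {i | ρ i = 0}.ncard = m := by
  classical
  have hne : (X ^ d - 1 : K[X]) ≠ 0 := X_pow_sub_C_ne_zero (Nat.pos_of_ne_zero hd) 1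
  have h0 : Multiset.count (0 : K) (X ^ d - 1 : K[X]).roots = 0 := by
    rw [Multiset.count_eq_zero, mem_roots hne]
    simp [hd]
  rw [ncard_eq_count_roots h, roots_mul (mul_ne_zero (pow_ne_zero _ X_ne_zero)
    (pow_ne_zero _ hne)), roots_pow, roots_pow, roots_X, Multiset.count_add, Multiset.count_nsmul,
    Multiset.count_nsmul, h0, Multiset.count_singleton, if_pos rfl]
  ring

theorem cluster_cases {q d m : ℕ} (h : ∏ i, (X - C (ρ i)) = (X ^ m * (X ^ d - 1) ^ q : K[X]))
    (i : ι) : (m ≠ 0 ∧ ρ i = 0) ∨ ρ i ^ d = 1 := by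
  have h1 := congrArg (eval (ρ i)) h
  rw [eval_prod, Finset.prod_eq_zero (Finset.mem_univ i) (by simp)] at h1
  simp only [eval_mul, eval_pow, eval_X, eval_sub, eval_one] at h1
  rcases mul_eq_zero.1 h1.symm with h2 | h2
  · exact Or.inl ⟨fun h0 => by simp [h0] at h2, eq_zero_of_pow_eq_zero h2⟩
  · exact Or.inr (sub_eq_zero.1 (eq_zero_of_pow_eq_zero h2))

end ClusterSizes

/-! ### Recognition of regular cyclic actions -/

section CyclicActions

variable {ι K : Type*} [Field K] {H : Subgroup (Equiv.Perm ι)} {B : Set ι} {m : ℕ}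

/-- Recognition of a regular cyclic action through a coordinate whose values are the roots of
unity. -/
theorem actsAsCyclic_of_coordinate (hm : m ≠ 0) (hB : Preserves H B) (hcard : B.ncard = m)
    {ε : ι → K} (hinj : Set.InjOn ε B) (hε : ∀ j ∈ B, ε j ^ m = 1)
    (hmul : ∀ g ∈ H, ∃ u, u ^ m = 1 ∧ ∀ j ∈ B, ε (g j) = u * ε j) {h : Equiv.Perm ι} (hh : h ∈ H)
    {η : K} (hη : IsPrimitiveRoot η m) (hhε : ∀ j ∈ B, ε (h j) = η * ε j) :
    ActsAsCyclic m H h B := by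
  have : NeZero m := ⟨hm⟩
  have hroot : ∀ x : K, x ^ m = 1 → ∃ l : ℕ, η ^ l = x := fun x hx => by
    obtain ⟨l, -, hl⟩ := hη.eq_pow_of_pow_eq_one hx
    exact ⟨l, hl⟩
  have hpow : ∀ l l' : ℕ, η ^ l = η ^ l' ↔ (l : ZMod m) = l' := by
    intro l l'
    rw [ZMod.natCast_eq_natCast_iff]
    obtain ⟨v, hv⟩ := hη.isUnit hm
    conv_rhs => rw [hη.eq_orderOf]
    rw [← hv, orderOf_units, ← pow_eq_pow_iff_modEq, Units.ext_iff, Units.val_pow_eq_pow_val,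
      Units.val_pow_eq_pow_val]
  choose f hf using fun b : B => hroot _ (hε b b.2)
  have hinj' : Function.Injective fun b : B => (f b : ZMod m) := by
    intro x y hxy
    have := (hpow _ _).2 hxy
    rw [hf, hf] at this
    exact Subtype.ext (hinj x.2 y.2 this)
  have hfin : Finite B := Set.finite_of_ncard_ne_zero (hcard ▸ hm)
  have : Fintype B := Fintype.ofFinite B
  let e : B ≃ ZMod m := Equiv.ofBijective _
    ((Fintype.bijective_iff_injective_and_card _).2 ⟨hinj', by
      rw [ZMod.card, ← Nat.card_eq_fintype_card, Nat.card_coe_set_eq, hcard]⟩)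
  have he : ∀ b : B, e b = f b := fun _ => rfl
  have hact : ∀ g : Equiv.Perm ι, (∀ j ∈ B, g j ∈ B) → ∀ l : ℕ,
      (∀ j ∈ B, ε (g j) = η ^ l * ε j) → ∀ b b' : B, g b = b' ↔ e b' = e b + l := by
    intro g hgB l hg b b'
    rw [he, he, ← Nat.cast_add, ← hpow, pow_add, hf, hf]
    constructor
    · intro hb
      rw [← hb, hg b b.2, mul_comm]
    · intro hb
      exact hinj (hgB b b.2) b'.2 (by rw [hg b b.2, hb, mul_comm])
  let τ : Equiv.Perm B := e.permCongr.symm (Equiv.addRight 1)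
  have hτ : ∀ b, e (τ b) = e b + 1 := fun b => by simp [τ]
  have hτpow : ∀ (l : ℕ) b, e ((τ ^ l) b) = e b + l := by
    intro l
    induction l with
    | zero => intro b; simp
    | succ l ih =>
      intro b
      rw [pow_succ', Equiv.Perm.mul_apply, hτ, ih]
      push_cast
      ring
  have hhτ : ∀ b : B, h b = τ b := fun b =>
    (hact h (hB h hh) 1 (by simpa using hhε) b (τ b)).2 (by rw [hτ, Nat.cast_one])
  have hτmem : τ ∈ imageInSym H B := ⟨h, hh, hhτ⟩
  have himage : ∀ σ ∈ imageInSym H B, ∃ l : ℕ, ∀ b, e (σ b) = e b + l := by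
    rintro σ ⟨g, hg, hgσ⟩
    obtain ⟨u, hu, hgu⟩ := hmul g hg
    obtain ⟨l, rfl⟩ := hroot u hu
    exact ⟨l, fun b => (hact g (hB g hg) l hgu b (σ b)).1 (hgσ b)⟩
  refine ⟨⟨e, le_antisymm ?_ ?_⟩, τ, hhτ, le_antisymm ((Subgroup.zpowers_le).2 hτmem) ?_⟩
  · rintro _ ⟨σ, hσ, rfl⟩
    obtain ⟨l, hl⟩ := himage σ hσ
    refine ⟨l, fun x => ?_⟩
    change e (σ (e.symm x)) = _
    rw [hl, e.apply_symm_apply]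
  · rintro t ⟨c, hc⟩
    refine ⟨τ ^ c.val, Subgroup.pow_mem _ hτmem _, Equiv.ext fun x => ?_⟩
    change e ((τ ^ c.val) (e.symm x)) = _
    rw [hτpow, e.apply_symm_apply, hc, ZMod.natCast_zmod_val]
  · intro σ hσ
    obtain ⟨l, hl⟩ := himage σ hσ
    have : σ = τ ^ l := Equiv.ext fun b => e.injective (by rw [hl, hτpow])
    rw [this]
    exact Subgroup.npow_mem_zpowers τ l

end CyclicActions

theorem cast_exponent_ne_zero (K : Type*) [Field K] {p n m : ℕ} [Fact p.Prime] [CharP K p]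
    (hmn : m < n) (hcop : n.Coprime m) (hp : p ∣ n ∨ p ∣ n - m) : (m : K) ≠ 0 := by
  intro h
  have hpm : p ∣ m := (CharP.cast_eq_zero_iff K p m).1 h
  have hpn : p ∣ n := hp.elim id fun h' => by
    have := dvd_add h' hpm
    rwa [Nat.sub_add_cancel hmn.le] at this
  exact (Fact.out : p.Prime).one_lt.ne' (Nat.dvd_one.1 (hcop ▸ Nat.dvd_gcd hpn hpm))

theorem cast_pow_sub_one_ne_zero (K : Type*) [Field K] {p k : ℕ} [Fact p.Prime] [CharP K p]
    (hk : k ≠ 0) : ((p ^ k - 1 : ℕ) : K) ≠ 0 := by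
  rw [Nat.cast_sub (Nat.one_le_pow _ _ (Fact.out : p.Prime).pos), Nat.cast_pow,
    CharP.cast_eq_zero, zero_pow hk]
  simp

/-- Near `ζ` the polynomial `x ^ d - 1 = x ^ d - ζ ^ d` is `x - ζ` times a divided difference, which
reduces to the derivative `d * ζ ^ (d - 1)`. -/
theorem exists_reducesTo_root_sub_const {K E F : Type*} [Field K] [Field E] [NormedField F]
    [Algebra K F] [Algebra E F] {π : E} (hF : IsValuedClosure K (F := F) π) {d : ℕ} (q : ℕ) {ζ : K}
    (hζ : ζ ^ d = 1) {x : F} (hx : ReducesTo x ζ) :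
    ∃ D : F, ReducesTo D ((d * ζ ^ (d - 1)) ^ q) ∧
      (x ^ d - 1) ^ q = (x - algebraMap K F ζ) ^ q * D := by
  refine ⟨_, (hx.geom_sum hF (ReducesTo.const ζ) d).pow hF q, ?_⟩
  rw [← mul_pow, mul_sum_geom, ← map_pow, hζ, map_one]

/-! ### The case `p ∣ n`: arcs near `u ^ n = 1` -/

section DegreeDivisible

open Polynomial

variable {ι : Type*} [Fintype ι] {K E F : Type*} [Field K] [IsAlgClosed K] [Field E]
  [NormedField F] [Algebra K F] [Algebra E F] [Algebra K E] [IsScalarTower K E F]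
  {π : E} {G : Subgroup (Equiv.Perm ι)} {n m p k d : ℕ} [Fact p.Prime] [CharP K p]

/-- Sections of the curve of degree divisible by the characteristic, close to the multiple section
`X ^ n = 1`. -/
theorem exists_subgroups_of_dvd_degree (hF : IsValuedClosure K (F := F) π)
    (harcs : ∃ ρ : ι → K, ∏ i, (X - C (ρ i)) = (X ^ n + C 0 * X ^ m + C (-1) : K[X]) ∧
      ∀ a b : E, a ≠ 0 → b ≠ 0 → ‖algebraMap E F a - algebraMap K F 0‖ < 1 →
        ‖algebraMap E F b - algebraMap K F (-1)‖ < 1 → ∃ e : ι → F, IsArc G ρ n m a b e)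
    (hcop : n.Coprime m) (hmn : m < n) (hpn : p ∣ n)
    (hn : n = p ^ k * d) (hpd : ¬ p ∣ d) :
    ∃ (A : Fin d → Set ι) (H : Subgroup (Equiv.Perm ι)) (Hi : Fin d → Subgroup (Equiv.Perm ι)),
      ∃ h ∈ H,
      H ≤ G ∧
      (∀ i, Hi i ≤ G) ∧
      Pairwise (fun i j => Disjoint (A i) (A j)) ∧
      (⋃ i, A i) = Set.univ ∧
      (∀ i, (A i).ncard = p ^ k) ∧
      (∀ i, Preserves H (A i)) ∧
      (∀ i, ActsAsAGL1 p k H (A i)) ∧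
      (∀ i, FixedPointAndOrbit (p ^ k - 1) (Subgroup.zpowers h) (A i)) ∧
      (∀ i, FixedPointAndOrbit (p ^ k - 1) (Hi i) (A i)) ∧
      (∀ i j, j ≠ i → Preserves (Hi i) (A j) ∧ ActsWithAGL1 p k (Hi i) (A j)) := by
  have := hF.isUltrametric
  have := hF.isAlgClosed
  have hCF : CharP F p := charP_of_injective_algebraMap (algebraMap K F).injective p
  have hk : k ≠ 0 := by
    rintro rfl
    rw [pow_zero, one_mul] at hn
    exact hpd (hn ▸ hpn)
  have hq : 1 < p ^ k := Nat.one_lt_pow hk (Fact.out : p.Prime).one_lt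
  have hd : (d : K) ≠ 0 := fun h => hpd ((CharP.cast_eq_zero_iff K p d).1 h)
  have hd0 : d ≠ 0 := by
    rintro rfl
    simp at hpd
  have hmK : (m : K) ≠ 0 := cast_exponent_ne_zero K hmn hcop (Or.inl hpn)
  have hqK : ((1 * (p ^ k - 1) : ℕ) : K) ≠ 0 := by
    rw [one_mul]
    exact cast_pow_sub_one_ne_zero K hk
  have hdm : d.Coprime m := hcop.coprime_dvd_left ⟨p ^ k, by rw [hn, mul_comm]⟩
  have hπ : algebraMap E F π ≠ 0 := norm_pos_iff.1 hF.norm_uniformizer_pos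
  obtain ⟨ρ, hρ, harc⟩ := harcs
  replace hρ : ∏ i, (X - C (ρ i)) = (X ^ 0 * (X ^ d - 1) ^ p ^ k : K[X]) := by
    rw [hρ, sub_pow_char_pow, ← pow_mul, mul_comm d, ← hn]
    simp [sub_eq_add_neg]
  obtain ⟨η, hηinj, hη⟩ := exists_enumeration_rootsOfUnity K hd
  have hηd : ∀ i, η i ^ d = 1 := fun i => (hη _).2 ⟨i, rfl⟩
  have hcard : ∀ i, {j | ρ j = η i}.ncard = p ^ k := fun i => ncard_cluster_pow hd hρ (hηd i)
  have hη0 : ∀ i, η i ≠ 0 := by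
    intro i h
    have := hηd i
    rw [h, zero_pow hd0] at this
    exact zero_ne_one this
  -- On the arc `a = π`, `b = -1 - c * π` the equation reads `u ^ n - 1 = π * (c - u ^ m)`. A root
  -- of unity `η i` stays a root exactly when `c = η i ^ m`.
  have harc' : ∀ c : K, ∃ e : ι → F, IsArc G ρ n m π (-1 - algebraMap K E c * π) e := by
    intro c
    have h1 : ‖algebraMap E F (-1 - algebraMap K E c * π) - algebraMap K F (-1)‖ < 1 := by
      have e : algebraMap E F (-1 - algebraMap K E c * π) - algebraMap K F (-1) =
          -(algebraMap K F c * algebraMap E F π) := by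
        rw [map_sub, map_mul, ← IsScalarTower.algebraMap_apply K E F, map_neg, map_neg, map_one,
          map_one]
        ring
      rw [e, norm_neg, norm_mul]
      exact mul_lt_one_of_nonneg_of_lt_one_right (hF.norm_const_le c) (norm_nonneg _)
        hF.norm_uniformizer_lt
    refine harc _ _ (fun h => hπ (by simp [h])) (fun h => ?_) (by simpa using
      hF.norm_uniformizer_lt) h1
    rw [h, map_zero] at h1
    simp at h1
  have hrelation : ∀ {b : E} {x y : F} {ζ : K},
      x ^ n + algebraMap E F π * x ^ m + algebraMap E F b = 0 →
      y ^ n + algebraMap E F π * y ^ m + algebraMap E F b = 0 → ReducesTo x ζ → ReducesTo y ζ →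
      ∃ D D' : F, ReducesTo D ((d * ζ ^ (d - 1)) ^ p ^ k) ∧ ReducesTo D' (-(m * ζ ^ (m - 1))) ∧
        (x - y) ^ p ^ k * D = algebraMap E F π * (x - y) * D' := by
    intro b x y ζ hx hy hxζ hyζ
    refine ⟨_, _, (hxζ.geom_sum hF hyζ d).pow hF (p ^ k), (hxζ.geom_sum hF hyζ m).neg, ?_⟩
    rw [← mul_pow, mul_sum_geom, sub_pow_char_pow, ← pow_mul, ← pow_mul, mul_comm d, ← hn, mul_assoc,
      mul_neg, mul_sum_geom]
    linear_combination hx - hy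
  have hδ : ∀ i, ((d : K) * η i ^ (d - 1)) ^ p ^ k ≠ 0 := fun i =>
    pow_ne_zero _ (mul_ne_zero hd (pow_ne_zero _ (hη0 i)))
  have hδ' : ∀ i, -((m : K) * η i ^ (m - 1)) ≠ 0 := fun i =>
    neg_ne_zero.2 (mul_ne_zero hmK (pow_ne_zero _ (hη0 i)))
  obtain ⟨z, hz⟩ := IsAlgClosed.exists_pow_nat_eq (algebraMap E F π) (n := 1 * (p ^ k - 1))
    (by omega)
  have : NeZero ((1 * (p ^ k - 1) : ℕ) : K) := ⟨hqK⟩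
  have : NeZero (1 * (p ^ k - 1)) := ⟨by omega⟩
  obtain ⟨ω, hω⟩ := HasEnoughRootsOfUnity.exists_primitiveRoot K (1 * (p ^ k - 1))
  obtain ⟨τ, hτ⟩ := hF.exists_gal_eq hqK hz hω.pow_eq_one
  have hAGL : ∀ (c : K) (e : ι → F), IsArc G ρ n m π (-1 - algebraMap K E c * π) e →
      ∀ h ∈ arcGroup E G e, (∀ i, e (h i) = τ (e i)) → ∀ i, c ≠ η i ^ m →
      ActsAsAGL1 p k (arcGroup E G e) {j | ρ j = η i} ∧
      FixedPointAndOrbit (p ^ k - 1) (Subgroup.zpowers (h ^ p ^ k)) {j | ρ j = η i} := by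
    intro c e he h hh hhτ i hc
    refine he.actsAsAGL1_cluster hF hk (hcard i) (hδ i) (hδ' i) ?_ ?_ one_pos hqK hz hω hτ hh hhτ
    · intro j j' hj hj'
      exact hrelation (he.root j) (he.root j') (he.reducesTo hj) (he.reducesTo hj')
    -- Here `c - e j ^ m` reduces to `c - η i ^ m ≠ 0`, so the roots are at distance `‖π‖ ^ (1 / p ^
    -- k)` from `η i`: total ramification.
    · refine he.orbit_eq_cluster hF (ζ := η i) (r := p ^ k) (s := 1) (by omega)
        (Nat.coprime_one_right _) (he.preserves_cluster hF _) (hcard i) ?_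
      intro j hj
      obtain ⟨D, hD, h1⟩ := exists_reducesTo_root_sub_const hF (p ^ k) (hηd i)
        (he.reducesTo hj)
      have h2 : ReducesTo (algebraMap K F c - e j ^ m) (c - η i ^ m) :=
        (ReducesTo.const c).sub hF ((he.reducesTo hj).pow hF m)
      have h3 : (e j - algebraMap K F (η i)) ^ p ^ k * D =
          algebraMap E F π * (algebraMap K F c - e j ^ m) := by
        rw [← h1, sub_pow_char_pow, ← pow_mul, mul_comm d, ← hn, one_pow]
        have h4 := he.root j
        rw [map_sub, map_mul, ← IsScalarTower.algebraMap_apply K E F, map_neg, map_one] at h4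
        linear_combination h4
      have h5 := congrArg norm h3
      rwa [norm_mul, norm_mul, hD.norm_eq_one hF (hδ i), h2.norm_eq_one hF (sub_ne_zero.2 hc),
        mul_one, mul_one, norm_pow, ← pow_one ‖algebraMap E F π‖] at h5
  have hfix : ∀ (i : Fin d) (e : ι → F),
      IsArc G ρ n m π (-1 - algebraMap K E (η i ^ m) * π) e →
      FixedPointAndOrbit (p ^ k - 1) (arcGroup E G e) {j | ρ j = η i} := by
    intro i e he
    have hroot : algebraMap K F (η i) ^ n + algebraMap E F π * algebraMap K F (η i) ^ m +
        algebraMap E F (-1 - algebraMap K E (η i ^ m) * π) = 0 := by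
      have e1 : η i ^ n = 1 := by rw [hn, mul_comm, pow_mul, hηd, one_pow]
      rw [map_sub, map_mul, ← IsScalarTower.algebraMap_apply K E F, ← map_pow, ← map_pow, e1]
      simp
      ring
    -- The constant `η i` is a root for this arc, hence a fixed point of the Galois group.
    obtain ⟨j₀, hj₀⟩ := he.surj _ hroot
    have hj₀A : j₀ ∈ {j | ρ j = η i} := by
      change ρ j₀ = η i
      refine (he.reducesTo rfl).unique hF ?_
      rw [hj₀]
      exact ReducesTo.const _
    have hfix₀ : ∀ g ∈ arcGroup E G e, g j₀ = j₀ := by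
      rintro g ⟨-, σ, hσ⟩
      exact he.injective (by rw [hσ, hj₀, gal_const])
    have hlt : 1 < {j | ρ j = η i}.ncard := by rw [hcard]; exact hq
    obtain ⟨j₁, hj₁, hne⟩ := Set.exists_ne_of_one_lt_ncard hlt j₀
    have hsub : MulAction.orbit (arcGroup E G e) j₁ ⊆ {j | ρ j = η i} \ {j₀} := by
      rintro _ ⟨⟨g, hg⟩, rfl⟩
      exact ⟨he.preserves_cluster hF _ g hg j₁ hj₁, fun hx =>
        hne (g.injective ((Set.mem_singleton_iff.1 hx).trans (hfix₀ g hg).symm))⟩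
    have hcard' : ({j | ρ j = η i} \ {j₀}).ncard = p ^ k - 1 := by
      rw [Set.ncard_sdiff_singleton_of_mem hj₀A, hcard]
    have horb : MulAction.orbit (arcGroup E G e) j₁ = {j | ρ j = η i} \ {j₀} := by
      refine Set.eq_of_subset_of_ncard_le hsub ?_ (Set.toFinite _)
      rw [hcard']
      refine Nat.le_of_dvd ((Set.ncard_pos (Set.toFinite _)).2 ⟨j₁, MulAction.mem_orbit_self _⟩) ?_
      refine he.dvd_ncard_orbit hF (η i) (s := 1) (by omega) (Nat.coprime_one_right _) ?_
      -- The relation for differences, applied with the constant root `η i`, puts the other roots at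
      -- distance `‖π‖ ^ (1 / (p ^ k - 1))`.
      obtain ⟨D, D', hD, hD', h1⟩ := hrelation (he.root j₁) hroot (he.reducesTo hj₁)
        (ReducesTo.const (η i))
      have h2 : e j₁ - algebraMap K F (η i) ≠ 0 := by
        rw [← hj₀, sub_ne_zero]
        exact fun h => hne (he.injective h)
      have h3 := congrArg norm h1
      rw [norm_mul, norm_mul, norm_mul, hD.norm_eq_one hF (hδ i), hD'.norm_eq_one hF (hδ' i),
        mul_one, mul_one, norm_pow] at h3
      have e1 : p ^ k = p ^ k - 1 + 1 := by omega
      rw [e1, pow_succ] at h3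
      rw [pow_one]
      exact mul_right_cancel₀ (norm_ne_zero_iff.2 h2) h3
    refine ⟨j₀, j₁, ?_, by rw [horb, hcard'], by rw [horb]; simp, ?_⟩
    · ext x
      constructor
      · rintro ⟨⟨g, hg⟩, rfl⟩
        exact hfix₀ g hg
      · rintro rfl
        exact MulAction.mem_orbit_self _
    · rw [horb, Set.singleton_union, Set.insert_sdiff_singleton, Set.insert_eq_of_mem hj₀A]
  obtain ⟨e₀, he₀⟩ := harc' 0
  choose e he using fun i => harc' (η i ^ m)
  obtain ⟨h, hh, hhτ⟩ := he₀.exists_mem_arcGroup τ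
  -- The value `c = 0` differs from every `η i ^ m`, so one arc serves all clusters at once.
  have hAGL₀ := fun i => hAGL 0 e₀ he₀ h hh hhτ i (pow_ne_zero m (hη0 i)).symm
  refine ⟨fun i => {j | ρ j = η i}, arcGroup E G e₀, fun i => arcGroup E G (e i), h ^ p ^ k,
    Subgroup.pow_mem _ hh _, arcGroup_le _ _, fun i => arcGroup_le _ _, ?_, ?_, hcard,
    fun i => he₀.preserves_cluster hF _, fun i => (hAGL₀ i).1, fun i => (hAGL₀ i).2,
    fun i => hfix i _ (he i), fun i j hij => ⟨(he i).preserves_cluster hF _, ?_⟩⟩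
  · intro i j hij
    exact Set.disjoint_left.2 fun x hx hx' => hij (hηinj (hx.symm.trans hx'))
  · refine Set.eq_univ_of_forall fun x => Set.mem_iUnion.2 ?_
    obtain ⟨i, hi⟩ := (hη (ρ x)).1 ((cluster_cases hρ x).resolve_left fun h => h.1 rfl)
    exact ⟨i, hi.symm⟩
  · obtain ⟨h', hh', hhτ'⟩ := (he i).exists_mem_arcGroup τ
    obtain ⟨f, hf⟩ := (hAGL _ _ (he i) h' hh' hhτ' j fun h => hij (hηinj
      (eq_of_pow_eq_pow_of_coprime hdm (hηd j) (hηd i) h.symm))).1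
    exact ⟨f, hf.ge⟩

end DegreeDivisible

/-! ### The roots near `0` -/

section ClusterAtZero

variable {ι : Type*} {K E F : Type*} [Field K] [Field E]
  [NormedField F] [Algebra K F] [Algebra E F]
  {π : E} {G : Subgroup (Equiv.Perm ι)} {ρ : ι → K} {n m r : ℕ} {a b : E} {e : ι → F}

theorem ReducesTo.inv (hF : IsValuedClosure K (F := F) π) {x : F} {c : K} (h : ReducesTo x c)
    (hc : c ≠ 0) : ReducesTo x⁻¹ c⁻¹ := by
  have hx1 := h.norm_eq_one hF hc
  have hx : x ≠ 0 := norm_ne_zero_iff.1 (by rw [hx1]; exact one_ne_zero)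
  have hcF : algebraMap K F c ≠ 0 := (map_ne_zero _).2 hc
  have e1 : x⁻¹ - algebraMap K F c⁻¹ = -(x - algebraMap K F c) / (x * algebraMap K F c) := by
    rw [map_inv₀]
    field_simp
    ring
  rw [ReducesTo, e1, norm_div, norm_neg, norm_mul, hx1, hF.norm_const c hc, mul_one, div_one]
  exact h

namespace IsArc

theorem reducesTo_factor (he : IsArc G ρ n m a b e) (hF : IsValuedClosure K (F := F) π)
    (ha : ReducesTo (algebraMap E F a) (-1 : K)) (hr : r ≠ 0) {i : ι} (hi : ρ i = 0) :
    ReducesTo (e i ^ r + algebraMap E F a) (-1 : K) := by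
  have := ((he.reducesTo hi).pow hF r).add hF ha
  rwa [zero_pow hr, zero_add] at this

/-- In this form the second factor reduces to `-1` near `0`, so the equation is a perturbation of `u
^ m = b`. -/
theorem root_factor (he : IsArc G ρ n m a b e) (hn : n = m + r) (i : ι) :
    e i ^ m * (e i ^ r + algebraMap E F a) = -algebraMap E F b := by
  have := he.root i
  rw [hn] at this
  linear_combination this

theorem norm_pow_eq_of_cluster_zero (he : IsArc G ρ n m a b e)
    (hF : IsValuedClosure K (F := F) π) (ha : ReducesTo (algebraMap E F a) (-1 : K))
    (hn : n = m + r) (hr : r ≠ 0) {i : ι} (hi : ρ i = 0) : ‖e i‖ ^ m = ‖algebraMap E F b‖ := by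
  have h1 := congrArg norm (he.root_factor hn i)
  rwa [norm_mul, norm_neg, norm_pow, (he.reducesTo_factor hF ha hr hi).norm_eq_one hF
    (by simp), mul_one] at h1

/-- For the ratio `u` of two distinct roots, compare the two equations and cancel `u - 1`. If `u`
reduced to `1`, the remaining factor would reduce to `-m`, although it is zero. So roots near `0`
are as well separated as `m`-th roots of unity. -/
theorem not_reducesTo_div_of_ne (he : IsArc G ρ n m a b e) (hF : IsValuedClosure K (F := F) π)
    (ha : ReducesTo (algebraMap E F a) (-1 : K)) (hb : algebraMap E F b ≠ 0) (hn : n = m + r)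
    (hr : r ≠ 0) (hm : m ≠ 0) (hmK : (m : K) ≠ 0) {i j : ι} (hj : ρ j = 0)
    (hij : i ≠ j) : ¬ ReducesTo (e i / e j) (1 : K) := by
  intro h
  have hej : e j ≠ 0 := by
    intro h0
    have := he.root_factor hn j
    rw [h0, zero_pow hm, zero_mul] at this
    exact hb (neg_eq_zero.1 this.symm)
  set u := e i / e j with hu
  have hei : e i = u * e j := by rw [hu, div_mul_cancel₀ _ hej]
  have hu1 : u - 1 ≠ 0 := by
    intro h0
    rw [sub_eq_zero.1 h0, one_mul] at hei
    exact hij (he.injective hei)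
  have h1 := he.root_factor hn i
  rw [← he.root_factor hn j, hei] at h1
  have h2 : u ^ m * ((u * e j) ^ r + algebraMap E F a) = e j ^ r + algebraMap E F a := by
    refine mul_left_cancel₀ (pow_ne_zero m hej) ?_
    rw [← h1]
    ring
  have h3 : (u - 1) * (e j ^ r * ∑ l ∈ Finset.range (m + r), u ^ l * 1 ^ (m + r - 1 - l) +
      algebraMap E F a * ∑ l ∈ Finset.range m, u ^ l * 1 ^ (m - 1 - l)) = 0 := by
    have e1 := mul_sum_geom u 1 (m + r)
    have e2 := mul_sum_geom u 1 m
    rw [one_pow] at e1 e2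
    rw [mul_add, mul_left_comm, e1, mul_left_comm, e2]
    rw [mul_pow] at h2
    linear_combination h2
  have h4 := (mul_eq_zero.1 h3).resolve_left hu1
  have h5 := (((he.reducesTo hj).pow hF r).mul hF (h.geom_sum hF ReducesTo.one (m + r))).add hF
    (ha.mul hF (h.geom_sum hF ReducesTo.one m))
  rw [h4, zero_pow hr, zero_mul, zero_add, one_pow, mul_one, neg_one_mul] at h5
  have h6 := h5.unique hF (ReducesTo.zero_iff.2 (by simp))
  exact hmK (neg_eq_zero.1 h6)

theorem norm_le_norm_sub_of_cluster_zero (he : IsArc G ρ n m a b e)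
    (hF : IsValuedClosure K (F := F) π)
    (ha : ReducesTo (algebraMap E F a) (-1 : K)) (hb : algebraMap E F b ≠ 0) (hn : n = m + r)
    (hr : r ≠ 0) (hm : m ≠ 0) (hmK : (m : K) ≠ 0) {i j : ι} (hj : ρ j = 0)
    (hij : i ≠ j) : ‖e j‖ ≤ ‖e i - e j‖ := by
  by_contra! hlt
  have hej : 0 < ‖e j‖ := (norm_nonneg _).trans_lt hlt
  refine he.not_reducesTo_div_of_ne hF ha hb hn hr hm hmK hj hij ?_
  rw [ReducesTo, map_one, div_sub_one (norm_pos_iff.1 hej), norm_div]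
  exact (div_lt_one hej).2 hlt

variable [Algebra K E] [IsScalarTower K E F]

/-- A root that is approximated by a constant up to the distance to the other roots in its cluster
is fixed by the Galois group. -/
theorem apply_eq_self_of_isolated (he : IsArc G ρ n m a b e) (hF : IsValuedClosure K (F := F) π)
    {i : ι} {w : E} (hw : algebraMap E F w ≠ 0) {κ : K}
    (hle : ‖e i - algebraMap K F κ‖ ≤ ‖algebraMap E F w‖)
    (hsep : ∀ j, ρ j = ρ i → j ≠ i → ‖algebraMap E F w‖ ≤ ‖e j - e i‖)
    {g : Equiv.Perm ι} (hg : g ∈ arcGroup E G e) : g i = i := by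
  by_contra hne
  have h1 := hsep (g i) (he.preserves_cluster hF (ρ i) g hg i rfl) hne
  obtain ⟨-, τ, hτ⟩ := hg
  obtain ⟨c, hc⟩ := hF.exists_residue ((e i - algebraMap K F κ) / algebraMap E F w) (by
    rw [norm_div]
    exact div_le_one_of_le₀ hle (norm_nonneg _))
  -- Both `κ` and `w` are fixed by `τ`, so `(e i - κ) / w` and its conjugate have the same residue.
  -- The two roots are then closer than `‖w‖`, contrary to `hsep`.
  have h2 := (ReducesTo.gal hF hc τ).sub hF hc
  rw [map_div₀, τ.commutes, map_sub, gal_const, ← hτ, ← sub_div, sub_sub_sub_cancel_right,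
    sub_self, ReducesTo.zero_iff, norm_div, div_lt_one (norm_pos_iff.2 hw)] at h2
  exact absurd h1 (not_le.2 h2)

/-- The Galois group acts through a regular cyclic group on the roots near `0`. -/
theorem actsAsCyclic_cluster_zero [IsAlgClosed K] (he : IsArc G ρ n m a π e)
    (hF : IsValuedClosure K (F := F) π)
    (ha : ReducesTo (algebraMap E F a) (-1 : K)) (hn : n = m + r)
    (hr : r ≠ 0) (hm : m ≠ 0) (hmK : (m : K) ≠ 0) (hcard : {i | ρ i = 0}.ncard = m)
    {s l : ℕ} (hs : s ≠ 0) (hsK : ((m * s : ℕ) : K) ≠ 0) {z : F}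
    (hz : z ^ (m * s) = algebraMap E F π) {ω : K} (hω : IsPrimitiveRoot ω (m * s))
    {τ : F ≃ₐ[E] F} (hτ : τ z = algebraMap K F ω * z) {h : Equiv.Perm ι}
    (hh : h ∈ arcGroup E G e) (hhτ : ∀ i, e (h i) = τ (e i)) (hlm : l.Coprime m) :
    ActsAsCyclic m (arcGroup E G e) (h ^ l) {i | ρ i = 0} := by
  have hπ : algebraMap E F π ≠ 0 := norm_pos_iff.1 hF.norm_uniformizer_pos
  have hms : m * s ≠ 0 := mul_ne_zero hm hs
  have hz0 : z ≠ 0 := by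
    rintro rfl
    rw [zero_pow hms] at hz
    exact hπ hz.symm
  have hw0 : z ^ s ≠ 0 := pow_ne_zero _ hz0
  have hwm : (z ^ s) ^ m = algebraMap E F π := by rw [← pow_mul, mul_comm, hz]
  have hnorm : ∀ i, ρ i = 0 → ‖e i / z ^ s‖ = 1 := by
    intro i hi
    rw [norm_div, div_eq_one_iff_eq (norm_ne_zero_iff.2 hw0)]
    refine (pow_left_inj₀ (norm_nonneg _) (norm_nonneg _) hm).1 ?_
    rw [he.norm_pow_eq_of_cluster_zero hF ha hn hr hi, ← norm_pow, hwm]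
  have hres : ∀ i, ∃ c : K, ρ i = 0 → ReducesTo (e i / z ^ s) c := by
    intro i
    by_cases hi : ρ i = 0
    · obtain ⟨c, hc⟩ := hF.exists_residue _ (hnorm i hi).le
      exact ⟨c, fun _ => hc⟩
    · exact ⟨0, fun h => absurd h hi⟩
  choose ε hε using hres
  have hε0 : ∀ i, ρ i = 0 → ε i ≠ 0 := by
    intro i hi h0
    have := hε i hi
    rw [h0, ReducesTo.zero_iff, hnorm i hi] at this
    exact lt_irrefl _ this
  have hgal : ∀ (g : Equiv.Perm ι) (σ : F ≃ₐ[E] F) (c : K), (∀ i, e (g i) = σ (e i)) →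
      σ z = algebraMap K F c * z → c ≠ 0 → g ∈ arcGroup E G e →
      ∀ i ∈ {i | ρ i = 0}, ε (g i) = c ^ s * ε i := by
    intro g σ c hgσ hσz hc hg i hi
    refine (hε _ (he.preserves_cluster hF 0 g hg i hi)).unique hF ?_
    have hcF : algebraMap K F c ≠ 0 := (map_ne_zero _).2 hc
    have e2 : e (g i) / z ^ s = algebraMap K F (c ^ s) * σ (e i / z ^ s) := by
      rw [map_div₀, map_pow, map_pow, ← hgσ, hσz]
      field_simp
      ring
    rw [e2]
    exact (ReducesTo.const _).mul hF ((hε i hi).gal hF σ)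
  have hω0 : ω ≠ 0 := hω.ne_zero hms
  refine actsAsCyclic_of_coordinate (ε := ε) (η := (ω ^ s) ^ l) hm (he.preserves_cluster hF 0)
    hcard ?_ ?_ ?_ (Subgroup.pow_mem _ hh l) ?_ ?_
  · intro i hi j hj hij
    by_contra hne
    refine he.not_reducesTo_div_of_ne hF ha hπ hn hr hm hmK hj hne ?_
    have h1 := (hε i hi).mul hF ((hε j hj).inv hF (hε0 j hj))
    rwa [hij, mul_inv_cancel₀ (hε0 j hj), ← div_eq_mul_inv, div_div_div_cancel_right₀ hw0] at h1
  · intro i hi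
    -- The `m`-th power of `e i / z ^ s`, times a factor reducing to `-1`, is exactly `-1`; so the
    -- residue is an `m`-th root of unity.
    have h1 := ((hε i hi).pow hF m).mul hF (he.reducesTo_factor hF ha hr hi)
    rw [div_pow, hwm, div_mul_eq_mul_div, he.root_factor hn, neg_div, div_self hπ] at h1
    have h2 := h1.unique hF ReducesTo.one.neg
    linear_combination -h2
  · intro g hg
    obtain ⟨-, σ, hσ⟩ := id hg
    obtain ⟨c, hc, hcz⟩ := exists_gal_eq_mul hsK hz0 hz σ
    refine ⟨c ^ s, by rw [← pow_mul, mul_comm, hc], hgal g σ c hσ hcz ?_ hg⟩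
    rintro rfl
    rw [zero_pow hms] at hc
    exact zero_ne_one hc
  · exact (hω.pow (Nat.pos_of_ne_zero hms) (mul_comm m s)).pow_of_coprime l hlm
  · have hstep := hgal h τ ω hhτ hτ hω0 hh
    intro i hi
    have hpow : ∀ l : ℕ, ε ((h ^ l) i) = (ω ^ s) ^ l * ε i := by
      intro l
      induction l with
      | zero => simp
      | succ l ih =>
        rw [pow_succ', Equiv.Perm.mul_apply, hstep _
          (he.preserves_cluster hF 0 _ (Subgroup.pow_mem _ hh l) i hi), ih]
        ring
    exact hpow l

end IsArc

end ClusterAtZero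

/-! ### The case `p ∣ n - m`: arcs near `u ^ n = u ^ m` -/

section CodegreeDivisible

open Polynomial

variable {ι : Type*} [Fintype ι] {K E F : Type*} [Field K] [IsAlgClosed K] [Field E]
  [NormedField F] [Algebra K F] [Algebra E F] [Algebra K E] [IsScalarTower K E F]
  {π : E} {G : Subgroup (Equiv.Perm ι)} {n m p k d : ℕ} [Fact p.Prime] [CharP K p]

/-- Sections of the curve with `n - m` divisible by the characteristic, close to the multiple
section `X ^ n = X ^ m`. -/
theorem exists_subgroups_of_dvd_codegree (hF : IsValuedClosure K (F := F) π)
    (harcs : ∃ ρ : ι → K, ∏ i, (X - C (ρ i)) = (X ^ n + C (-1) * X ^ m + C 0 : K[X]) ∧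
      ∀ a b : E, a ≠ 0 → b ≠ 0 → ‖algebraMap E F a - algebraMap K F (-1)‖ < 1 →
        ‖algebraMap E F b - algebraMap K F 0‖ < 1 → ∃ e : ι → F, IsArc G ρ n m a b e)
    (hm : 0 < m) (hmn : m < n) (hcop : n.Coprime m) (hpnm : p ∣ n - m)
    (hnm : n - m = p ^ k * d) (hpd : ¬ p ∣ d) :
    ∃ (A : Fin d → Set ι) (B : Set ι) (H : Subgroup (Equiv.Perm ι))
      (Hi : Fin d → Subgroup (Equiv.Perm ι)),
      ∃ h ∈ H,
      H ≤ G ∧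
      (∀ i, Hi i ≤ G) ∧
      Pairwise (fun i j => Disjoint (A i) (A j)) ∧
      (∀ i, Disjoint (A i) B) ∧
      (⋃ i, A i) ∪ B = Set.univ ∧
      (∀ i, (A i).ncard = p ^ k) ∧
      B.ncard = m ∧
      (∀ i, Preserves H (A i)) ∧
      Preserves H B ∧
      (∀ i, ActsAsAGL1 p k H (A i)) ∧
      (∀ i, FixedPointAndOrbit (p ^ k - 1) (Subgroup.zpowers h) (A i)) ∧
      ActsAsCyclic m H h B ∧
      (∀ i, ∀ g ∈ Hi i, ∀ x ∈ A i ∪ B, g x = x) ∧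
      (∀ i j, j ≠ i → ActsTransitively (Hi i) (A j)) := by
  have := hF.isUltrametric
  have := hF.isAlgClosed
  have hCF : CharP F p := charP_of_injective_algebraMap (algebraMap K F).injective p
  have hk : k ≠ 0 := by
    rintro rfl
    rw [pow_zero, one_mul] at hnm
    exact hpd (hnm ▸ hpnm)
  have hq : 1 < p ^ k := Nat.one_lt_pow hk (Fact.out : p.Prime).one_lt
  have hd : (d : K) ≠ 0 := fun h => hpd ((CharP.cast_eq_zero_iff K p d).1 h)
  have hd0 : d ≠ 0 := by
    rintro rfl
    simp at hpd
  have hqd0 : p ^ k * d ≠ 0 := mul_ne_zero (by omega) hd0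
  have hn : n = m + p ^ k * d := by omega
  have hmK : (m : K) ≠ 0 := cast_exponent_ne_zero K hmn hcop (Or.inr hpnm)
  have hpm : ¬ p ∣ m := fun h => hmK ((CharP.cast_eq_zero_iff K p m).2 h)
  have hqm : (p ^ k).Coprime m :=
    ((Nat.Prime.coprime_iff_not_dvd (Fact.out : p.Prime)).2 hpm).pow_left k
  have hqq : (p ^ k).Coprime (p ^ k - 1) := by
    have : (p ^ k - 1 + 1).Coprime (p ^ k - 1) := by simp
    rwa [Nat.sub_add_cancel hq.le] at this
  have hN : ((m * (p ^ k - 1) : ℕ) : K) ≠ 0 := by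
    rw [Nat.cast_mul]
    exact mul_ne_zero hmK (cast_pow_sub_one_ne_zero K hk)
  have hN0 : m * (p ^ k - 1) ≠ 0 := mul_ne_zero hm.ne' (by omega)
  have hdm : d.Coprime m := by
    have h1 : (n - m).Coprime m := (Nat.coprime_sub_self_left hmn.le).2 hcop
    exact h1.coprime_dvd_left ⟨p ^ k, by rw [hnm, mul_comm]⟩
  have hπ : algebraMap E F π ≠ 0 := norm_pos_iff.1 hF.norm_uniformizer_pos
  obtain ⟨ρ, hρ, harc⟩ := harcs
  replace hρ : ∏ i, (X - C (ρ i)) = (X ^ m * (X ^ d - 1) ^ p ^ k : K[X]) := by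
    rw [hρ, sub_pow_char_pow, ← pow_mul, mul_comm d, mul_sub, ← pow_add, ← hn]
    simp [sub_eq_add_neg]
  obtain ⟨η, hηinj, hη⟩ := exists_enumeration_rootsOfUnity K hd
  have hηd : ∀ i, η i ^ d = 1 := fun i => (hη _).2 ⟨i, rfl⟩
  have hcard : ∀ i, {j | ρ j = η i}.ncard = p ^ k := fun i => ncard_cluster_pow hd hρ (hηd i)
  have hcard₀ : {j | ρ j = 0}.ncard = m := ncard_cluster_zero hd0 hρ
  have hη0 : ∀ i, η i ≠ 0 := by
    intro i h
    have := hηd i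
    rw [h, zero_pow hd0] at this
    exact zero_ne_one this
  have hηF0 : ∀ i, algebraMap K F (η i) ≠ 0 := fun i => (_root_.map_ne_zero _).2 (hη0 i)
  -- On the arcs `a = -1 - β * b` the equation reads `u ^ n - u ^ m = b * (β * u ^ m - 1)`, so `η i`
  -- stays a root exactly when `β * η i ^ m = 1`.
  have ha : ∀ (β : K) {b : E}, ‖algebraMap E F b‖ < 1 →
      ReducesTo (algebraMap E F (-1 - algebraMap K E β * b)) (-1 : K) := by
    intro β b hb
    have e : algebraMap E F (-1 - algebraMap K E β * b) - algebraMap K F (-1) =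
        -(algebraMap K F β * algebraMap E F b) := by
      rw [map_sub, map_mul, ← IsScalarTower.algebraMap_apply K E F, map_neg, map_neg, map_one,
        map_one]
      ring
    rw [ReducesTo, e, norm_neg, norm_mul]
    exact mul_lt_one_of_nonneg_of_lt_one_right (hF.norm_const_le β) (norm_nonneg _) hb
  have harc' : ∀ (β : K) {b : E}, b ≠ 0 → ‖algebraMap E F b‖ < 1 →
      ∃ e : ι → F, IsArc G ρ n m (-1 - algebraMap K E β * b) b e := by
    intro β b hb0 hb
    refine harc _ _ (fun h => ?_) hb0 (ha β hb) (by simpa using hb)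
    have h1 := ha β hb
    rw [h, map_zero] at h1
    simp [ReducesTo] at h1
  have hrelation : ∀ {a b : E} {x y : F} {ζ : K},
      x ^ n + algebraMap E F a * x ^ m + algebraMap E F b = 0 →
      y ^ n + algebraMap E F a * y ^ m + algebraMap E F b = 0 → ReducesTo x ζ → ReducesTo y ζ →
      ∃ D D' : F, ReducesTo D ((d * ζ ^ (d - 1)) ^ p ^ k * (ζ ^ m * ζ ^ m)) ∧
        ReducesTo D' (m * ζ ^ (m - 1)) ∧
        (x - y) ^ p ^ k * D = algebraMap E F b * (x - y) * D' := by
    intro a b x y ζ hx hy hxζ hyζ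
    refine ⟨_, _, ((hxζ.geom_sum hF hyζ d).pow hF (p ^ k)).mul hF
      ((hxζ.pow hF m).mul hF (hyζ.pow hF m)), hxζ.geom_sum hF hyζ m, ?_⟩
    rw [← mul_assoc, ← mul_pow, mul_sum_geom, sub_pow_char_pow, ← pow_mul, ← pow_mul, mul_comm d,
      mul_assoc (algebraMap E F b), mul_sum_geom]
    rw [hn, pow_add] at hx hy
    linear_combination y ^ m * hx - x ^ m * hy
  have hdistance : ∀ (i : Fin d) (β : K) {b : E} {x : F}, ReducesTo x (η i) →
      x ^ n + algebraMap E F (-1 - algebraMap K E β * b) * x ^ m + algebraMap E F b = 0 →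
      β * η i ^ m - 1 ≠ 0 → ‖x - algebraMap K F (η i)‖ ^ p ^ k = ‖algebraMap E F b‖ := by
    intro i β b x hx hroot hβ
    obtain ⟨D, hD, h1⟩ := exists_reducesTo_root_sub_const hF (p ^ k) (hηd i) hx
    have h2 : ReducesTo (algebraMap K F β * x ^ m - 1) (β * η i ^ m - 1) :=
      ((ReducesTo.const β).mul hF (hx.pow hF m)).sub hF ReducesTo.one
    have h3 : (x - algebraMap K F (η i)) ^ p ^ k * D * x ^ m =
        algebraMap E F b * (algebraMap K F β * x ^ m - 1) := by
      rw [← h1, sub_pow_char_pow, ← pow_mul, mul_comm d, one_pow]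
      rw [map_sub, map_mul, ← IsScalarTower.algebraMap_apply K E F, map_neg, map_one, hn,
        pow_add] at hroot
      linear_combination hroot
    have h5 := congrArg norm h3
    rwa [norm_mul, norm_mul, norm_mul, norm_pow, norm_pow, hx.norm_eq_one hF (hη0 i), one_pow,
      h2.norm_eq_one hF hβ, hD.norm_eq_one hF (pow_ne_zero _ (mul_ne_zero hd
      (pow_ne_zero _ (hη0 i)))), mul_one, mul_one, mul_one] at h5
  have hδ : ∀ i, ((d : K) * η i ^ (d - 1)) ^ p ^ k * (η i ^ m * η i ^ m) ≠ 0 := fun i =>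
    mul_ne_zero (pow_ne_zero _ (mul_ne_zero hd (pow_ne_zero _ (hη0 i))))
      (mul_ne_zero (pow_ne_zero _ (hη0 i)) (pow_ne_zero _ (hη0 i)))
  have hδ' : ∀ i, (m : K) * η i ^ (m - 1) ≠ 0 := fun i =>
    mul_ne_zero hmK (pow_ne_zero _ (hη0 i))
  have hpair : ∀ (i : Fin d) {a b : E} {x y : F}, ReducesTo x (η i) → ReducesTo y (η i) →
      x ^ n + algebraMap E F a * x ^ m + algebraMap E F b = 0 →
      y ^ n + algebraMap E F a * y ^ m + algebraMap E F b = 0 → x ≠ y →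
      ‖x - y‖ ^ (p ^ k - 1) = ‖algebraMap E F b‖ := by
    intro i a b x y hxζ hyζ hx hy hxy
    obtain ⟨D, D', hD, hD', h1⟩ := hrelation hx hy hxζ hyζ
    have h3 := congrArg norm h1
    rw [norm_mul, norm_mul, norm_mul, hD.norm_eq_one hF (hδ i), hD'.norm_eq_one hF (hδ' i),
      mul_one, mul_one, norm_pow] at h3
    have e1 : p ^ k = p ^ k - 1 + 1 := by omega
    rw [e1, pow_succ] at h3
    exact mul_right_cancel₀ (norm_ne_zero_iff.2 (sub_ne_zero.2 hxy)) h3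
  -- A single root of `π` serves both kinds of clusters: `z ^ m` is the scale for differences around
  -- `η i`, and `z ^ (p ^ k - 1)` is the scale around `0`. Thus one `τ` yields an `h` with all the
  -- required properties.
  obtain ⟨z, hz⟩ := IsAlgClosed.exists_pow_nat_eq (algebraMap E F π) (n := m * (p ^ k - 1))
    (Nat.pos_of_ne_zero hN0)
  have : NeZero ((m * (p ^ k - 1) : ℕ) : K) := ⟨hN⟩
  have : NeZero (m * (p ^ k - 1)) := ⟨hN0⟩
  obtain ⟨ω, hω⟩ := HasEnoughRootsOfUnity.exists_primitiveRoot K (m * (p ^ k - 1))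
  obtain ⟨τ, hτ⟩ := hF.exists_gal_eq hN hz hω.pow_eq_one
  have hπ0 : π ≠ 0 := fun h => hπ (by simp [h])
  obtain ⟨e₀, he₀⟩ := harc' 0 hπ0 hF.norm_uniformizer_lt
  obtain ⟨h, hh, hhτ⟩ := he₀.exists_mem_arcGroup τ
  have hAGL : ∀ i, ActsAsAGL1 p k (arcGroup E G e₀) {j | ρ j = η i} ∧
      FixedPointAndOrbit (p ^ k - 1) (Subgroup.zpowers (h ^ p ^ k)) {j | ρ j = η i} := by
    intro i
    refine he₀.actsAsAGL1_cluster hF hk (hcard i) (hδ i) (hδ' i) ?_ ?_ hm hN hz hω hτ hh hhτ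
    · intro j j' hj hj'
      exact hrelation (he₀.root j) (he₀.root j') (he₀.reducesTo hj) (he₀.reducesTo hj')
    · refine he₀.orbit_eq_cluster hF (ζ := η i) (r := p ^ k) (s := 1) (by omega)
        (Nat.coprime_one_right _) (he₀.preserves_cluster hF _) (hcard i) fun j hj => ?_
      rw [pow_one]
      exact hdistance i 0 (he₀.reducesTo hj) (he₀.root j) (by simp)
  -- With `b = π ^ (m * (p ^ k - 1))` and `η i` an exact root, differences in that cluster have norm
  -- `‖π ^ m‖` and roots near `0` have norm `‖π ^ (p ^ k - 1)‖`. These are norms of elements of `E`,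
  -- as `apply_eq_self_of_isolated` requires.
  have hbN : ‖algebraMap E F (π ^ (m * (p ^ k - 1)))‖ =
      ‖algebraMap E F π‖ ^ (m * (p ^ k - 1)) := by rw [map_pow, norm_pow]
  have hblt : ‖algebraMap E F (π ^ (m * (p ^ k - 1)))‖ < 1 := by
    rw [hbN]
    exact pow_lt_one₀ (norm_nonneg _) hF.norm_uniformizer_lt hN0
  have hb0 : π ^ (m * (p ^ k - 1)) ≠ 0 := pow_ne_zero _ hπ0
  choose e he using fun i => harc' (η i ^ m)⁻¹ hb0 hblt
  have hfix : ∀ i, ∀ g ∈ arcGroup E G (e i), ∀ x, ρ x = η i → g x = x := by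
    intro i g hg x hx
    have hroot : algebraMap K F (η i) ^ n +
        algebraMap E F (-1 - algebraMap K E (η i ^ m)⁻¹ * π ^ (m * (p ^ k - 1))) *
          algebraMap K F (η i) ^ m + algebraMap E F (π ^ (m * (p ^ k - 1))) = 0 := by
      have e1 : algebraMap K F (η i) ^ (p ^ k * d) = 1 := by
        rw [← map_pow, mul_comm, pow_mul, hηd, one_pow, map_one]
      rw [map_sub, map_mul, ← IsScalarTower.algebraMap_apply K E F, hn, pow_add, e1, map_inv₀,
        map_pow (algebraMap K F), map_neg, map_one]
      have := pow_ne_zero m (hηF0 i)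
      field_simp
      ring
    have hnorm : ∀ y : F, ‖y‖ ^ (p ^ k - 1) = ‖algebraMap E F (π ^ (m * (p ^ k - 1)))‖ →
        ‖y‖ = ‖algebraMap E F (π ^ m)‖ := by
      intro y hy
      refine (pow_left_inj₀ (norm_nonneg _) (norm_nonneg _) (n := p ^ k - 1) (by omega)).1 ?_
      rw [hy, pow_mul, map_pow, norm_pow]
    refine (he i).apply_eq_self_of_isolated hF (w := π ^ m) (κ := η i) ?_ ?_ ?_ hg
    · rw [map_pow]
      exact pow_ne_zero _ hπ
    · by_cases hxη : e i x = algebraMap K F (η i)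
      · rw [hxη, sub_self, norm_zero]
        exact norm_nonneg _
      · exact (hnorm _ (hpair i ((he i).reducesTo hx) (ReducesTo.const _) ((he i).root x) hroot
          hxη)).le
    · intro j hj hjx
      exact (hnorm _ (hpair i ((he i).reducesTo (hj.trans hx)) ((he i).reducesTo hx)
        ((he i).root j) ((he i).root x) fun h => hjx ((he i).injective h))).ge
  have hfix₀ : ∀ i, ∀ g ∈ arcGroup E G (e i), ∀ x, ρ x = 0 → g x = x := by
    intro i g hg x hx
    have hx' : ‖e i x‖ = ‖algebraMap E F (π ^ (p ^ k - 1))‖ := by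
      refine (pow_left_inj₀ (norm_nonneg _) (norm_nonneg _) hm.ne').1 ?_
      rw [(he i).norm_pow_eq_of_cluster_zero hF (ha _ hblt) hn hqd0 hx, mul_comm, pow_mul,
        map_pow _ _ m, norm_pow]
    refine (he i).apply_eq_self_of_isolated hF (w := π ^ (p ^ k - 1)) (κ := 0) ?_ ?_ ?_ hg
    · rw [map_pow]
      exact pow_ne_zero _ hπ
    · rw [map_zero, sub_zero, hx']
    · intro j _ hjx
      rw [← hx']
      exact (he i).norm_le_norm_sub_of_cluster_zero hF (ha _ hblt)
        ((_root_.map_ne_zero _).2 hb0) hn hqd0 hm.ne' hmK hx hjx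
  refine ⟨fun i => {j | ρ j = η i}, {j | ρ j = 0}, arcGroup E G e₀, fun i => arcGroup E G (e i),
    h ^ p ^ k, Subgroup.pow_mem _ hh _, arcGroup_le _ _, fun i => arcGroup_le _ _, ?_, ?_, ?_,
    hcard, hcard₀, fun i => he₀.preserves_cluster hF _, he₀.preserves_cluster hF _,
    fun i => (hAGL i).1, fun i => (hAGL i).2, ?_, ?_, ?_⟩
  · intro i j hij
    exact Set.disjoint_left.2 fun x hx hx' => hij (hηinj (hx.symm.trans hx'))
  · intro i
    exact Set.disjoint_left.2 fun x hx hx' => hη0 i (hx.symm.trans hx')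
  · refine Set.eq_univ_of_forall fun x => ?_
    rcases cluster_cases hρ x with hx | hx
    · exact Or.inr hx.2
    · obtain ⟨i, hi⟩ := (hη (ρ x)).1 hx
      exact Or.inl (Set.mem_iUnion.2 ⟨i, hi.symm⟩)
  -- The power `p ^ k` that gave `h` its fixed points is prime to `m`, so it still acts on `B` as a
  -- generator.
  · exact he₀.actsAsCyclic_cluster_zero hF (ha 0 hF.norm_uniformizer_lt) hn hqd0 hm.ne' hmK hcard₀
      (by omega) hN hz hω hτ hh hhτ hqm
  · rintro i g hg x (hx | hx)
    · exact hfix i g hg x hx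
    · exact hfix₀ i g hg x hx
  · intro i j hij
    -- Around `η j` the roots are at distance `‖b‖ ^ (1 / p ^ k)`, and `p ^ k` is prime to the
    -- valuation `m * (p ^ k - 1)` of `b`: ramification is total.
    refine (he i).orbit_eq_cluster hF (ζ := η j) (r := p ^ k) (s := m * (p ^ k - 1)) (by omega)
      (Nat.Coprime.mul_right hqm hqq) ((he i).preserves_cluster hF _) (hcard j) fun x hx => ?_
    rw [← hbN]
    refine hdistance j _ ((he i).reducesTo hx) ((he i).root x) ?_
    rw [sub_ne_zero, Ne, inv_mul_eq_one₀ (pow_ne_zero _ (hη0 i))]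
    exact fun h => hij (hηinj (eq_of_pow_eq_pow_of_coprime hdm (hηd j) (hηd i) h.symm))

end CodegreeDivisible

end SectionalMonodromy

/-! ### The two cases assembled, with arcs centred at `(0, -1)` and `(-1, 0)` -/

theorem lemma5p3 {K : Type*} [Field K] [IsAlgClosed K] (p : ℕ) [Fact p.Prime] [CharP K p]
    (n m : ℕ) (hm : 0 < m) (hmn : m < n) (hcop : Nat.Coprime n m)
    {F : Type*} [Field F] [IsAlgClosed F] [Algebra K F] (δ : ℙ F (Fin 3 → F))
    (hδ : IsEtaleOver (trinomialCurve K n m) δ) :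
    (p ∣ n → ∀ k d : ℕ, n = p ^ k * d → ¬ p ∣ d →
      ∃ (A : Fin d → Set (fiber (trinomialCurve K n m) δ))
        (H : Subgroup (Equiv.Perm (fiber (trinomialCurve K n m) δ)))
        (Hi : Fin d → Subgroup (Equiv.Perm (fiber (trinomialCurve K n m) δ))),
        ∃ h ∈ H,
        H ≤ monodromyGroup (trinomialCurve K n m) δ ∧
        (∀ i, Hi i ≤ monodromyGroup (trinomialCurve K n m) δ) ∧
        Pairwise (fun i j => Disjoint (A i) (A j)) ∧
        (⋃ i, A i) = Set.univ ∧
        (∀ i, (A i).ncard = p ^ k) ∧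
        (∀ i, Preserves H (A i)) ∧
        (∀ i, ActsAsAGL1 p k H (A i)) ∧
        (∀ i, FixedPointAndOrbit (p ^ k - 1) (Subgroup.zpowers h) (A i)) ∧
        (∀ i, FixedPointAndOrbit (p ^ k - 1) (Hi i) (A i)) ∧
        (∀ i j, j ≠ i → Preserves (Hi i) (A j) ∧
          ActsWithAGL1 p k (Hi i) (A j))) ∧
    (p ∣ n - m → ∀ k d : ℕ, n - m = p ^ k * d → ¬ p ∣ d →
      ∃ (A : Fin d → Set (fiber (trinomialCurve K n m) δ))
        (B : Set (fiber (trinomialCurve K n m) δ))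
        (H : Subgroup (Equiv.Perm (fiber (trinomialCurve K n m) δ)))
        (Hi : Fin d → Subgroup (Equiv.Perm (fiber (trinomialCurve K n m) δ))),
        ∃ h ∈ H,
        H ≤ monodromyGroup (trinomialCurve K n m) δ ∧
        (∀ i, Hi i ≤ monodromyGroup (trinomialCurve K n m) δ) ∧
        Pairwise (fun i j => Disjoint (A i) (A j)) ∧
        (∀ i, Disjoint (A i) B) ∧
        (⋃ i, A i) ∪ B = Set.univ ∧
        (∀ i, (A i).ncard = p ^ k) ∧
        B.ncard = m ∧
        (∀ i, Preserves H (A i)) ∧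
        Preserves H B ∧
        (∀ i, ActsAsAGL1 p k H (A i)) ∧
        (∀ i, FixedPointAndOrbit (p ^ k - 1) (Subgroup.zpowers h) (A i)) ∧
        ActsAsCyclic m H h B ∧
        (∀ i, ∀ g ∈ Hi i, ∀ x ∈ A i ∪ B, g x = x) ∧
        (∀ i j, j ≠ i → ActsTransitively (Hi i) (A j))) := by
  have hfin := SectionalMonodromy.finite_fiber hm hmn hcop (K := K) δ
  have : Fintype (fiber (trinomialCurve K n m) δ) := hfin.fintype
  obtain ⟨E, C, _, _, _, _, _, _, π, hC⟩ := SectionalMonodromy.exists_isValuedClosure K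
  refine ⟨fun hp k d hn hd => ?_, fun hp k d hn hd => ?_⟩
  · exact SectionalMonodromy.exists_subgroups_of_dvd_degree hC
      (SectionalMonodromy.exists_arcs_fiber p hm hmn hcop (Or.inl hp) hδ hC 0 (-1)) hcop hmn hp hn hd
  · exact SectionalMonodromy.exists_subgroups_of_dvd_codegree hC
      (SectionalMonodromy.exists_arcs_fiber p hm hmn hcop (Or.inr hp) hδ hC (-1) 0) hm hmn hcop hp
      hn hd
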